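/- **Setting.** For each row below let $M:(\mathbb C^4,0)\to \mathrm{Sym}_3(\mathbb C)$ be the symmetric matrix family in the variables $x,y,z,w$ (entries listed as $m_{11},m_{12},m_{13};m_{22},m_{23};m_{33}$), $M'$ the odd function germ on $(\mathbb C^2,0)$, and $\widetilde M\subset(\mathbb C^3,0)$ the complete intersection curve germ (given by two even functions of $a,b,c$): * $\mathrm I_{k+1}$ ($k\ge 1$), $\tau=k+1$: $M=(x,0,z;\,y+x^k,w;\,y)$, $M'=ac^2+a^{2k+1}$, $\widetilde M:\ c^2+2bc+a^{2k}=ab=0$; * $\mathrm{II}_4$, $\tau=4$: $M=(x,w^2,y;\,y,z;\,w)$, $M'=b^3+c^5$, $\widetilde M:\ b^2-ac=ab-c^4=0$; * $\mathrm{II}_5$, $\tau=5$: $M=(x,0,y+w^2;\,y,z;\,w)$, $M'=b^3-bc^4$, $\widetilde M:\ b^2-ac+c^4=ab=0$; * $\mathrm{II}_6$, $\tau=6$: $M=(x,w^3,y;\,y,z;\,w)$, $M'=b^3+c^7$, $\widetilde M:\ b^2-ac=ab-c^6=0$. The following equivalences of deformations are used. * For $M$: deformations by holomorphic families of symmetric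 matrices, up to $\mathrm{SL}$-equivalence, that is, up to parameter-dependent changes of the source coordinates and $M\mapsto A^{\top}MA$ with $A$ a holomorphic family of matrices of determinant $1$. * For $M'$: deformations by odd functions, up to $\mathcal R_{odd,2}$, that is, up to coordinate changes commuting with $-\mathrm{id}$. * For $\widetilde M$: deformations of the defining map by even maps, up to $\mathcal K_{odd,3}$, that is, up to coordinate changes commuting with $-\mathrm{id}$ and multiplication of the defining map by holomorphic families of invertible $2\times2$ matrices. All these changes are the identity for the zero value of the parameters; for non-zero values they need not fix the origin. A deformation germ is versal if every deformation germ over a base $(\mathbb C^l,0)$ is equivalent to one induced from it by a holomorphic map germ of the bases; it is miniversal if it is versal with the least possible number of parameters. Bifurcation diagrams in the base of a deformation are the following sets. * $\Sigma\subset\Lambda$, for a deformation $M_\lambda$ of $M$: the set of $\lambda$ for which $M_\lambda$ is not transversal to the stratification by corank of the set of degenerate matrices in $\mathrm{Sym}_3(\mathbb C)$. * $\Sigma'\subset\Lambda'$, for a deformation $M'_\lambda$ of $M'$: the set of $\lambda$ for which $M'_\lambda=0$ is not smooth (there is a point with $M'_\lambda=0$ and $dM'_\lambda=0$). * $\widetilde\Sigma\subset\widetilde\Lambda$,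 for a deformation $\widetilde M_\lambda$ of $\widetilde M$: the set of $\lambda$ for which the curve $\widetilde M_\lambda=0$ is singular (at some point of it the differential of the defining map has rank less than $2$). For a deformation germ, only points in an arbitrarily small neighbourhood of the origin of the source and parameters near $0$ are considered. **Proposition.** In each row the following holds. (1) Globally, take $\Lambda=\Lambda'=\widetilde\Lambda=\mathbb C^\tau$ and the quasi-homogeneous deformations * $\mathrm I_{k+1}$: $M_\lambda=(x,\lambda_k,z;\;y+x^k+\sum_{i<k}\lambda_i x^i,\,w;\;y)$, $\;M'_\lambda=ac^2+a^{2k+1}+\sum_{i<k}\lambda_i a^{2i+1}+\lambda_k c$, $\;\widetilde M_\lambda=(c^2+2bc+a^{2k}+\sum_{i<k}\lambda_i a^{2i},\ ab-\lambda_k)$; * $\mathrm{II}_\tau$: $M_\lambda=(x,\,p(w),\,y+q(w);\;y,z;\;w)$ and $\widetilde M_\lambda=(b^2-ac+q(c^2),\ ab-p(c^2))$, where $(p,q)=(w^2+\lambda_1w+\lambda_0,\ \lambda_3w+\lambda_2)$, $(\lambda_2w^2+\lambda_1w+\lambda_0,\ w^2+\lambda_4w+\lambda_3)$, $(w^3+\lambda_2w^2+\lambda_1w+\lambda_0,\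 \lambda_5w^2+\lambda_4w+\lambda_3)$ for $\tau=4,5,6$ respectively; and $M'_\lambda=b^3+c^5+\lambda_0c+\lambda_1c^3+\lambda_2b+\lambda_3bc^2$ for $\tau=4$, $M'_\lambda=b^3-bc^4+\lambda_0c+\lambda_1c^3+\lambda_2c^5+\lambda_3b+\lambda_4bc^2$ for $\tau=5$, $M'_\lambda=b^3+c^7+\lambda_0c+\lambda_1c^3+\lambda_2c^5+\lambda_3b+\lambda_4bc^2+\lambda_5bc^4$ for $\tau=6$. There are biholomorphisms $\Lambda\to\Lambda'$ and $\Lambda'\to\widetilde\Lambda$ of $\mathbb C^\tau$ onto itself, preserving the origin, which send $\Sigma$ onto $\Sigma'$ and $\Sigma'$ onto $\widetilde\Sigma$: $$(\Lambda,\Sigma)\simeq(\Lambda',\Sigma')\simeq(\widetilde\Lambda,\widetilde\Sigma).$$ (2) For germs, take an arbitrary $\mathrm{SL}$-miniversal deformation of $M$, an arbitrary $\mathcal R_{odd,2}$-miniversal deformation of $M'$ and an arbitrary $\mathcal K_{odd,3}$-miniversal deformation of $\widetilde M$, each with base $(\mathbb C^\tau,0)$. Then the germs at $0$ of the bifurcation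 diagrams $\Sigma,\Sigma',\widetilde\Sigma$ are well defined (they do not depend on the choice of a sufficiently small neighbourhood of the origin in the source), and the germs of pairs are biholomorphic: $$(\Lambda,\Sigma,0)\simeq(\Lambda',\Sigma',0)\simeq(\widetilde\Lambda,\widetilde\Sigma,0).$$ -/

import Mathlib

open Filter Topology

namespace CorankThree

noncomputable section

/-! ## Bifurcation diagrams -/

/-- The stratum of symmetric `n × n` matrices of corank `c`. -/
def corankStratum (n c : ℕ) : Set (Matrix (Fin n) (Fin n) ℂ) :=
  {A | A.IsSymm ∧ A.rank + c = n}

/-- `B` is tangent at `A` to the set `S` of matrices: it is the velocity at `0` of a holomorphic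
curve that runs in `S` and passes through `A` at time `0`. -/
def IsTangentTo {n : ℕ} (S : Set (Matrix (Fin n) (Fin n) ℂ)) (A B : Matrix (Fin n) (Fin n) ℂ) :
    Prop :=
  ∃ γ : ℂ → Matrix (Fin n) (Fin n) ℂ,
    (∀ i j, AnalyticAt ℂ (fun s => γ s i j) 0) ∧ γ 0 = A ∧ (∀ᶠ s in 𝓝 0, γ s ∈ S) ∧
      ∀ i j, deriv (fun s => γ s i j) 0 = B i j

/-- The family `f` of symmetric matrices fails at `u` to be transversal to the stratification of
the set of degenerate symmetric matrices by corank: `f u` is in the stratum of some corank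
`c ≥ 1`, and the image of the differential of `f` at `u` and the tangent space of that stratum do
not span the space of symmetric matrices. -/
def NotTransversalAt {s n : ℕ} (f : (Fin s → ℂ) → Matrix (Fin n) (Fin n) ℂ) (u : Fin s → ℂ) :
    Prop :=
  ∃ c, 1 ≤ c ∧ f u ∈ corankStratum n c ∧
    ¬ ∀ C : Matrix (Fin n) (Fin n) ℂ, C.IsSymm →
      ∃ (v : Fin s → ℂ) (B : Matrix (Fin n) (Fin n) ℂ), IsTangentTo (corankStratum n c) (f u) B ∧
        ∀ i j, C i j = fderiv ℂ (fun x => f x i j) u v + B i j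

/-- The zero level of the function `f` is not smooth at `x`. -/
def IsSingularZero {p : ℕ} (f : (Fin p → ℂ) → ℂ) (x : Fin p → ℂ) : Prop :=
  f x = 0 ∧ fderiv ℂ f x = 0

/-- `x` is a singular point of the complete intersection `g = 0`. -/
def IsSingularPoint {p q : ℕ} (g : (Fin p → ℂ) → (Fin q → ℂ)) (x : Fin p → ℂ) : Prop :=
  g x = 0 ∧ ¬ Function.Surjective (fderiv ℂ g x)

/-- The (global) bifurcation diagram: the parameter values `t` for which some point `u` of the
whole space is degenerate. The relation `bad u t` says that the member with parameter `t` is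
degenerate at the point `u`. -/
def bifurcationSet {s m : ℕ} (bad : (Fin s → ℂ) → (Fin m → ℂ) → Prop) : Set (Fin m → ℂ) :=
  {t | ∃ u, bad u t}

/-- The set `S` represents the germ at `0` of the bifurcation diagram of a deformation germ: for
every sufficiently small neighbourhood `U` of the origin of the source, `S` agrees near `0` with
the set of parameter values for which there is a degenerate point in `U`. (The germ of `S` at `0`
is uniquely determined by this.) -/
def RepresentsDiagram {s m : ℕ} (bad : (Fin s → ℂ) → (Fin m → ℂ) → Prop) (S : Set (Fin m → ℂ)) :
    Prop :=
  ∃ U₀ ∈ 𝓝 (0 : Fin s → ℂ), ∀ U ∈ 𝓝 (0 : Fin s → ℂ), U ⊆ U₀ →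
    ∀ᶠ t in 𝓝 (0 : Fin m → ℂ), t ∈ S ↔ ∃ u ∈ U, bad u t

/-! ## Biholomorphisms of pairs -/

/-- The pairs `(ℂᵐ, S)` and `(ℂᵐ, S')` are biholomorphic (with the origin going to the origin). -/
def Biholomorphic {m : ℕ} (S S' : Set (Fin m → ℂ)) : Prop :=
  ∃ e : (Fin m → ℂ) ≃ (Fin m → ℂ),
    Differentiable ℂ e ∧ Differentiable ℂ e.symm ∧ e 0 = 0 ∧ e '' S = S'

/-- The germs at `0` of the pairs `(ℂᵐ, S)` and `(ℂᵐ, S')` are biholomorphic. -/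
def GermBiholomorphic {m : ℕ} (S S' : Set (Fin m → ℂ)) : Prop :=
  ∃ θ η : (Fin m → ℂ) → (Fin m → ℂ),
    AnalyticAt ℂ θ 0 ∧ AnalyticAt ℂ η 0 ∧ θ 0 = 0 ∧ η 0 = 0 ∧
      (∀ᶠ t in 𝓝 0, η (θ t) = t) ∧ (∀ᶠ t in 𝓝 0, θ (η t) = t) ∧
        ∀ᶠ t in 𝓝 0, t ∈ S ↔ θ t ∈ S'

/-! ## Miniversal deformations

All objects below are germs at the origin; a germ is given by a function, of which only the values
near the origin matter. -/

/-- `F` is a deformation, over the base `(ℂᵐ, 0)`, of the germ `M` of a symmetric matrix family. -/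
def IsSymmDeformation {s n m : ℕ} (M : (Fin s → ℂ) → Matrix (Fin n) (Fin n) ℂ)
    (F : (Fin s → ℂ) → (Fin m → ℂ) → Matrix (Fin n) (Fin n) ℂ) : Prop :=
  (∀ i j, AnalyticAt ℂ (fun p : (Fin s → ℂ) × (Fin m → ℂ) => F p.1 p.2 i j) 0) ∧
    (∀ᶠ p in 𝓝 (0 : (Fin s → ℂ) × (Fin m → ℂ)), (F p.1 p.2).IsSymm) ∧
      ∀ᶠ u in 𝓝 (0 : Fin s → ℂ), F u 0 = M u

/-- `F` is a deformation of the odd function germ `f` in the class of odd functions. -/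
def IsOddDeformation {p m : ℕ} (f : (Fin p → ℂ) → ℂ) (F : (Fin p → ℂ) → (Fin m → ℂ) → ℂ) : Prop :=
  AnalyticAt ℂ (fun z : (Fin p → ℂ) × (Fin m → ℂ) => F z.1 z.2) 0 ∧
    (∀ᶠ z in 𝓝 (0 : (Fin p → ℂ) × (Fin m → ℂ)), F (-z.1) z.2 = -F z.1 z.2) ∧
      ∀ᶠ x in 𝓝 (0 : Fin p → ℂ), F x 0 = f x

/-- `F` is a deformation of the complete intersection germ `g = 0`, given by an even map germ `g`,
in the class of centrally symmetric complete intersections. -/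
def IsEvenDeformation {p q m : ℕ} (g : (Fin p → ℂ) → (Fin q → ℂ))
    (F : (Fin p → ℂ) → (Fin m → ℂ) → (Fin q → ℂ)) : Prop :=
  AnalyticAt ℂ (fun z : (Fin p → ℂ) × (Fin m → ℂ) => F z.1 z.2) 0 ∧
    (∀ᶠ z in 𝓝 (0 : (Fin p → ℂ) × (Fin m → ℂ)), F (-z.1) z.2 = F z.1 z.2) ∧
      ∀ᶠ x in 𝓝 (0 : Fin p → ℂ), F x 0 = g x

/-- `ψ` is a holomorphic map germ `(ℂˡ, 0) → (ℂᵐ, 0)` of bases. -/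
def IsBaseChange {l m : ℕ} (ψ : (Fin l → ℂ) → (Fin m → ℂ)) : Prop :=
  AnalyticAt ℂ ψ 0 ∧ ψ 0 = 0

/-- `Φ` is the germ of a holomorphic family, with parameters in `(ℂˡ, 0)`, of changes of
coordinates in the source, the one for the zero parameter being the identity. -/
def IsCoordinateChange {s l : ℕ} (Φ : (Fin s → ℂ) → (Fin l → ℂ) → (Fin s → ℂ)) : Prop :=
  AnalyticAt ℂ (fun p : (Fin s → ℂ) × (Fin l → ℂ) => Φ p.1 p.2) 0 ∧
    ∀ᶠ u in 𝓝 (0 : Fin s → ℂ), Φ u 0 = u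

/-- The changes of coordinates in the family `Φ` commute with the central symmetry `x ↦ -x`. -/
def IsOddCoordinateChange {s l : ℕ} (Φ : (Fin s → ℂ) → (Fin l → ℂ) → (Fin s → ℂ)) : Prop :=
  IsCoordinateChange Φ ∧
    ∀ᶠ p in 𝓝 (0 : (Fin s → ℂ) × (Fin l → ℂ)), Φ (-p.1) p.2 = -Φ p.1 p.2

/-- `A` is the germ of a holomorphic family of `n × n` matrices depending on a point and on a
parameter, equal to the identity matrix when the parameter is zero. -/
def IsMatrixChange {s l n : ℕ} (A : (Fin s → ℂ) → (Fin l → ℂ) → Matrix (Fin n) (Fin n) ℂ) :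
    Prop :=
  (∀ i j, AnalyticAt ℂ (fun p : (Fin s → ℂ) × (Fin l → ℂ) => A p.1 p.2 i j) 0) ∧
    ∀ᶠ u in 𝓝 (0 : Fin s → ℂ), A u 0 = 1

/-- The deformation germ `G` is `SL`-equivalent to one induced from `F` by a map of bases. -/
def SLInduced {s n m l : ℕ} (F : (Fin s → ℂ) → (Fin m → ℂ) → Matrix (Fin n) (Fin n) ℂ)
    (G : (Fin s → ℂ) → (Fin l → ℂ) → Matrix (Fin n) (Fin n) ℂ) : Prop :=
  ∃ (ψ : (Fin l → ℂ) → (Fin m → ℂ)) (Φ : (Fin s → ℂ) → (Fin l → ℂ) → (Fin s → ℂ))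
    (A : (Fin s → ℂ) → (Fin l → ℂ) → Matrix (Fin n) (Fin n) ℂ),
    IsBaseChange ψ ∧ IsCoordinateChange Φ ∧ IsMatrixChange A ∧
      (∀ᶠ p in 𝓝 (0 : (Fin s → ℂ) × (Fin l → ℂ)), (A p.1 p.2).det = 1) ∧
        ∀ᶠ p in 𝓝 (0 : (Fin s → ℂ) × (Fin l → ℂ)),
          G p.1 p.2 = (A p.1 p.2).transpose * F (Φ p.1 p.2) (ψ p.2) * A p.1 p.2

/-- The deformation germ `G` is `R_odd`-equivalent to one induced from `F` by a map of bases. -/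
def ROddInduced {p m l : ℕ} (F : (Fin p → ℂ) → (Fin m → ℂ) → ℂ)
    (G : (Fin p → ℂ) → (Fin l → ℂ) → ℂ) : Prop :=
  ∃ (ψ : (Fin l → ℂ) → (Fin m → ℂ)) (Φ : (Fin p → ℂ) → (Fin l → ℂ) → (Fin p → ℂ)),
    IsBaseChange ψ ∧ IsOddCoordinateChange Φ ∧
      ∀ᶠ z in 𝓝 (0 : (Fin p → ℂ) × (Fin l → ℂ)), G z.1 z.2 = F (Φ z.1 z.2) (ψ z.2)

/-- The deformation germ `G` is `K_odd`-equivalent to one induced from `F` by a map of bases. -/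
def KOddInduced {p q m l : ℕ} (F : (Fin p → ℂ) → (Fin m → ℂ) → (Fin q → ℂ))
    (G : (Fin p → ℂ) → (Fin l → ℂ) → (Fin q → ℂ)) : Prop :=
  ∃ (ψ : (Fin l → ℂ) → (Fin m → ℂ)) (Φ : (Fin p → ℂ) → (Fin l → ℂ) → (Fin p → ℂ))
    (B : (Fin p → ℂ) → (Fin l → ℂ) → Matrix (Fin q) (Fin q) ℂ),
    IsBaseChange ψ ∧ IsOddCoordinateChange Φ ∧ IsMatrixChange B ∧
      ∀ᶠ z in 𝓝 (0 : (Fin p → ℂ) × (Fin l → ℂ)),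
        G z.1 z.2 = (B z.1 z.2).mulVec (F (Φ z.1 z.2) (ψ z.2))

/-- `F` is an `SL`-versal deformation of `M`: every deformation is induced from it. -/
def IsSLVersal {s n m : ℕ} (M : (Fin s → ℂ) → Matrix (Fin n) (Fin n) ℂ)
    (F : (Fin s → ℂ) → (Fin m → ℂ) → Matrix (Fin n) (Fin n) ℂ) : Prop :=
  IsSymmDeformation M F ∧
    ∀ (l : ℕ) (G : (Fin s → ℂ) → (Fin l → ℂ) → Matrix (Fin n) (Fin n) ℂ),
      IsSymmDeformation M G → SLInduced F G

/-- `F` is an `R_odd`-versal deformation of the odd function germ `f`. -/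
def IsROddVersal {p m : ℕ} (f : (Fin p → ℂ) → ℂ) (F : (Fin p → ℂ) → (Fin m → ℂ) → ℂ) : Prop :=
  IsOddDeformation f F ∧
    ∀ (l : ℕ) (G : (Fin p → ℂ) → (Fin l → ℂ) → ℂ), IsOddDeformation f G → ROddInduced F G

/-- `F` is a `K_odd`-versal deformation of the centrally symmetric complete intersection `g = 0`. -/
def IsKOddVersal {p q m : ℕ} (g : (Fin p → ℂ) → (Fin q → ℂ))
    (F : (Fin p → ℂ) → (Fin m → ℂ) → (Fin q → ℂ)) : Prop :=
  IsEvenDeformation g F ∧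
    ∀ (l : ℕ) (G : (Fin p → ℂ) → (Fin l → ℂ) → (Fin q → ℂ)), IsEvenDeformation g G →
      KOddInduced F G

/-- `F` is an `SL`-miniversal deformation of `M`: versal, with the least possible number of
parameters. -/
def IsSLMiniversal {s n m : ℕ} (M : (Fin s → ℂ) → Matrix (Fin n) (Fin n) ℂ)
    (F : (Fin s → ℂ) → (Fin m → ℂ) → Matrix (Fin n) (Fin n) ℂ) : Prop :=
  IsSLVersal M F ∧
    ∀ (l : ℕ) (G : (Fin s → ℂ) → (Fin l → ℂ) → Matrix (Fin n) (Fin n) ℂ), IsSLVersal M G → m ≤ l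

/-- `F` is an `R_odd`-miniversal deformation of the odd function germ `f`. -/
def IsROddMiniversal {p m : ℕ} (f : (Fin p → ℂ) → ℂ) (F : (Fin p → ℂ) → (Fin m → ℂ) → ℂ) : Prop :=
  IsROddVersal f F ∧
    ∀ (l : ℕ) (G : (Fin p → ℂ) → (Fin l → ℂ) → ℂ), IsROddVersal f G → m ≤ l

/-- `F` is a `K_odd`-miniversal deformation of the centrally symmetric complete intersection
`g = 0`. -/
def IsKOddMiniversal {p q m : ℕ} (g : (Fin p → ℂ) → (Fin q → ℂ))
    (F : (Fin p → ℂ) → (Fin m → ℂ) → (Fin q → ℂ)) : Prop :=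
  IsKOddVersal g F ∧
    ∀ (l : ℕ) (G : (Fin p → ℂ) → (Fin l → ℂ) → (Fin q → ℂ)), IsKOddVersal g G → m ≤ l

/-! ## The triples

The coordinates are `(x, y, z, w) = (u 0, u 1, u 2, u 3)` in the source of the matrix families and
`(a, b, c) = (x 0, x 1, x 2)` in the space of the curves. The source of the odd functions has the
coordinates `(a, c) = (x 0, x 1)` for the series `I` and `(b, c) = (x 0, x 1)` for `II`. -/

/-- The simple corank 3 symmetric matrix singularities in four variables: `I k` is `I_{k+1}`. -/
inductive TableRow : Type
  | I (k : ℕ) (hk : 1 ≤ k)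
  | II4
  | II5
  | II6

/-- The Tjurina number `τ`, that is, the dimension of the bases of miniversal deformations. -/
def TableRow.tau : TableRow → ℕ
  | .I k _ => k + 1
  | .II4 => 4
  | .II5 => 5
  | .II6 => 6

/-- The symmetric matrix family `M`. -/
def TableRow.matrix : TableRow → (Fin 4 → ℂ) → Matrix (Fin 3) (Fin 3) ℂ
  | .I k _, u => !![u 0, 0, u 2; 0, u 1 + u 0 ^ k, u 3; u 2, u 3, u 1]
  | .II4, u => !![u 0, u 3 ^ 2, u 1; u 3 ^ 2, u 1, u 2; u 1, u 2, u 3]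
  | .II5, u => !![u 0, 0, u 1 + u 3 ^ 2; 0, u 1, u 2; u 1 + u 3 ^ 2, u 2, u 3]
  | .II6, u => !![u 0, u 3 ^ 3, u 1; u 3 ^ 3, u 1, u 2; u 1, u 2, u 3]

/-- The odd function `M'`. -/
def TableRow.oddFun : TableRow → (Fin 2 → ℂ) → ℂ
  | .I k _, x => x 0 * x 1 ^ 2 + x 0 ^ (2 * k + 1)
  | .II4, x => x 0 ^ 3 + x 1 ^ 5
  | .II5, x => x 0 ^ 3 - x 0 * x 1 ^ 4
  | .II6, x => x 0 ^ 3 + x 1 ^ 7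

/-- The even map whose zero set is the centrally symmetric curve `M̃`. -/
def TableRow.curve : TableRow → (Fin 3 → ℂ) → (Fin 2 → ℂ)
  | .I k _, x => ![x 2 ^ 2 + 2 * x 1 * x 2 + x 0 ^ (2 * k), x 0 * x 1]
  | .II4, x => ![x 1 ^ 2 - x 0 * x 2, x 0 * x 1 - x 2 ^ 4]
  | .II5, x => ![x 1 ^ 2 - x 0 * x 2 + x 2 ^ 4, x 0 * x 1]
  | .II6, x => ![x 1 ^ 2 - x 0 * x 2, x 0 * x 1 - x 2 ^ 6]

/-- The quasi-homogeneous deformation of the matrix family `M`. -/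
def TableRow.matrixDef : (r : TableRow) → (Fin 4 → ℂ) → (Fin r.tau → ℂ) →
    Matrix (Fin 3) (Fin 3) ℂ
  | .I k _, u, (t : Fin (k + 1) → ℂ) =>
      !![u 0, t (Fin.last k), u 2;
         t (Fin.last k), u 1 + u 0 ^ k + ∑ i : Fin k, t i.castSucc * u 0 ^ (i : ℕ), u 3;
         u 2, u 3, u 1]
  | .II4, u, (t : Fin 4 → ℂ) =>
      !![u 0, u 3 ^ 2 + t 1 * u 3 + t 0, u 1 + t 3 * u 3 + t 2;
         u 3 ^ 2 + t 1 * u 3 + t 0, u 1, u 2;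
         u 1 + t 3 * u 3 + t 2, u 2, u 3]
  | .II5, u, (t : Fin 5 → ℂ) =>
      !![u 0, t 2 * u 3 ^ 2 + t 1 * u 3 + t 0, u 1 + u 3 ^ 2 + t 4 * u 3 + t 3;
         t 2 * u 3 ^ 2 + t 1 * u 3 + t 0, u 1, u 2;
         u 1 + u 3 ^ 2 + t 4 * u 3 + t 3, u 2, u 3]
  | .II6, u, (t : Fin 6 → ℂ) =>
      !![u 0, u 3 ^ 3 + t 2 * u 3 ^ 2 + t 1 * u 3 + t 0, u 1 + t 5 * u 3 ^ 2 + t 4 * u 3 + t 3;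
         u 3 ^ 3 + t 2 * u 3 ^ 2 + t 1 * u 3 + t 0, u 1, u 2;
         u 1 + t 5 * u 3 ^ 2 + t 4 * u 3 + t 3, u 2, u 3]

/-- The monomial deformation of the odd function `M'`. -/
def TableRow.oddDef : (r : TableRow) → (Fin 2 → ℂ) → (Fin r.tau → ℂ) → ℂ
  | .I k _, x, (t : Fin (k + 1) → ℂ) =>
      x 0 * x 1 ^ 2 + x 0 ^ (2 * k + 1) + ∑ i : Fin k, t i.castSucc * x 0 ^ (2 * (i : ℕ) + 1) +
        t (Fin.last k) * x 1
  | .II4, x, (t : Fin 4 → ℂ) =>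
      x 0 ^ 3 + x 1 ^ 5 + t 0 * x 1 + t 1 * x 1 ^ 3 + t 2 * x 0 + t 3 * (x 0 * x 1 ^ 2)
  | .II5, x, (t : Fin 5 → ℂ) =>
      x 0 ^ 3 - x 0 * x 1 ^ 4 + t 0 * x 1 + t 1 * x 1 ^ 3 + t 2 * x 1 ^ 5 + t 3 * x 0 +
        t 4 * (x 0 * x 1 ^ 2)
  | .II6, x, (t : Fin 6 → ℂ) =>
      x 0 ^ 3 + x 1 ^ 7 + t 0 * x 1 + t 1 * x 1 ^ 3 + t 2 * x 1 ^ 5 + t 3 * x 0 +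
        t 4 * (x 0 * x 1 ^ 2) + t 5 * (x 0 * x 1 ^ 4)

/-- The monomial deformation of the centrally symmetric curve `M̃`. -/
def TableRow.curveDef : (r : TableRow) → (Fin 3 → ℂ) → (Fin r.tau → ℂ) → (Fin 2 → ℂ)
  | .I k _, x, (t : Fin (k + 1) → ℂ) =>
      ![x 2 ^ 2 + 2 * x 1 * x 2 + x 0 ^ (2 * k) + ∑ i : Fin k, t i.castSucc * x 0 ^ (2 * (i : ℕ)),
        x 0 * x 1 - t (Fin.last k)]
  | .II4, x, (t : Fin 4 → ℂ) =>
      ![x 1 ^ 2 - x 0 * x 2 + t 3 * x 2 ^ 2 + t 2,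
        x 0 * x 1 - x 2 ^ 4 - t 1 * x 2 ^ 2 - t 0]
  | .II5, x, (t : Fin 5 → ℂ) =>
      ![x 1 ^ 2 - x 0 * x 2 + x 2 ^ 4 + t 4 * x 2 ^ 2 + t 3,
        x 0 * x 1 - t 2 * x 2 ^ 4 - t 1 * x 2 ^ 2 - t 0]
  | .II6, x, (t : Fin 6 → ℂ) =>
      ![x 1 ^ 2 - x 0 * x 2 + t 5 * x 2 ^ 4 + t 4 * x 2 ^ 2 + t 3,
        x 0 * x 1 - x 2 ^ 6 - t 2 * x 2 ^ 4 - t 1 * x 2 ^ 2 - t 0]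

theorem TableRow.matrixDef_zero (r : TableRow) (u : Fin 4 → ℂ) :
    r.matrixDef u 0 = r.matrix u := by
  cases r with
  | I k hk =>
    change TableRow.matrixDef (.I k hk) u (fun _ : Fin (k + 1) => (0 : ℂ)) = _
    simp [TableRow.matrixDef, TableRow.matrix]
  | II4 =>
    change TableRow.matrixDef (.II4) u (fun _ : Fin (4) => (0 : ℂ)) = _
    simp [TableRow.matrixDef, TableRow.matrix]
  | II5 =>
    change TableRow.matrixDef (.II5) u (fun _ : Fin (5) => (0 : ℂ)) = _
    simp [TableRow.matrixDef, TableRow.matrix]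
  | II6 =>
    change TableRow.matrixDef (.II6) u (fun _ : Fin (6) => (0 : ℂ)) = _
    simp [TableRow.matrixDef, TableRow.matrix]

theorem TableRow.oddDef_zero (r : TableRow) (x : Fin 2 → ℂ) :
    r.oddDef x 0 = r.oddFun x := by
  cases r with
  | I k hk =>
    change TableRow.oddDef (.I k hk) x (fun _ : Fin (k + 1) => (0 : ℂ)) = _
    simp [TableRow.oddDef, TableRow.oddFun]
  | II4 =>
    change TableRow.oddDef (.II4) x (fun _ : Fin (4) => (0 : ℂ)) = _
    simp [TableRow.oddDef, TableRow.oddFun]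
  | II5 =>
    change TableRow.oddDef (.II5) x (fun _ : Fin (5) => (0 : ℂ)) = _
    simp [TableRow.oddDef, TableRow.oddFun]
  | II6 =>
    change TableRow.oddDef (.II6) x (fun _ : Fin (6) => (0 : ℂ)) = _
    simp [TableRow.oddDef, TableRow.oddFun]

theorem TableRow.curveDef_zero (r : TableRow) (x : Fin 3 → ℂ) :
    r.curveDef x 0 = r.curve x := by
  cases r with
  | I k hk =>
    change TableRow.curveDef (.I k hk) x (fun _ : Fin (k + 1) => (0 : ℂ)) = _
    simp [TableRow.curveDef, TableRow.curve]
  | II4 =>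
    change TableRow.curveDef (.II4) x (fun _ : Fin (4) => (0 : ℂ)) = _
    simp [TableRow.curveDef, TableRow.curve]
  | II5 =>
    change TableRow.curveDef (.II5) x (fun _ : Fin (5) => (0 : ℂ)) = _
    simp [TableRow.curveDef, TableRow.curve]
  | II6 =>
    change TableRow.curveDef (.II6) x (fun _ : Fin (6) => (0 : ℂ)) = _
    simp [TableRow.curveDef, TableRow.curve]

end

end CorankThree

namespace CorankThree

noncomputable section

/-! ## Germs of biholomorphisms -/

/-! All three diagrams of a row are described by one system of equations. In the rows `II`, let `p`
and `q` be the polynomials in the matrix family; the odd function is `b³ + b q(c²) + c p(c²)` (in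
`II5` only after a scaling), and the curve is `b² - ac + q(c²) = ab - p(c²) = 0`. A point where
transversality fails is a point with a nonzero symmetric conormal matrix `S`, that is, `M S = 0` and
`S` is orthogonal to the image of the differential (`notTransversalAt_iff`). The ratio of two
entries of `S`, the ratio `b / c` at a singular zero of the odd function, and the negative of the
ratio of the two coefficients of a conormal covector of the curve all play the role of the same
number `s`. Eliminating the other unknowns leaves the conditions `IsDegenerateII` on `(c, s)` in
each case. The series `I` is treated in the same way with `IsDegenerateI`. So the matrix and curve
diagrams coincide, and the diagram of the odd function agrees with them up to a diagonal linear
change of the parameters: a factor `1 / 2` in the series `I`, and powers of a fourth root of `-1` in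
`II5`.

These global sets also represent the germs at the origin, because degenerate points tend to the
origin with the parameters: their coordinates are controlled by roots of monic polynomials whose
lower coefficients are small (`eventually_root_mem`, `isDegenerateII_small`,
`eventually_isDegenerateI_mem`).

For an arbitrary versal deformation `F` with `τ` parameters, versality is applied to the listed
deformation, which is then induced from `F` by some `ψ : (ℂ^τ, 0) → (ℂ^τ, 0)`. If `dψ` killed a
vector `v`, the listed deformation would be infinitesimally trivial along `v`. Its parameter
directions are independent modulo the tangent space (`TableRow.matrixDef_independent` and its
analogues for the odd functions and the curves), so `v = 0`, and `ψ` is a local biholomorphism by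
the inverse function theorem. Degeneracy is invariant under the equivalences, hence `ψ` carries one
diagram germ to the other (`exists_representsDiagram_of_change`). Versality of the listed
deformations themselves is not needed.

Independence is proved by restricting the tangent relation and a few of its partial derivatives to a
coordinate axis, where it becomes a divisibility statement in the ring of germs in one variable. It
holds even modulo the larger tangent spaces in which the vector fields need not be odd and the
matrices need not be traceless. -/

theorem eventually_comp_of_map_zero {E F : Type*} [NormedAddCommGroup E] [NormedAddCommGroup F]
    {θ : E → F} (hθ : ContinuousAt θ 0) (h0 : θ 0 = 0) {P : F → Prop}
    (hP : ∀ᶠ y in 𝓝 0, P y) : ∀ᶠ x in 𝓝 0, P (θ x) := by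
  have : Tendsto θ (𝓝 0) (𝓝 0) := by simpa [ContinuousAt, h0] using hθ
  exact this.eventually hP

theorem GermBiholomorphic.symm {m : ℕ} {S S' : Set (Fin m → ℂ)} (h : GermBiholomorphic S S') :
    GermBiholomorphic S' S := by
  obtain ⟨θ, η, hθ, hη, h0, h0', h1, h2, h3⟩ := h
  refine ⟨η, θ, hη, hθ, h0', h0, h2, h1, ?_⟩
  filter_upwards [h2, eventually_comp_of_map_zero hη.continuousAt h0' h3] with t ht ht'
  rw [ht', ht]

theorem GermBiholomorphic.trans {m : ℕ} {S S' S'' : Set (Fin m → ℂ)}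
    (h : GermBiholomorphic S S') (h' : GermBiholomorphic S' S'') : GermBiholomorphic S S'' := by
  obtain ⟨θ, η, hθ, hη, h0, h0', h1, h2, h3⟩ := h
  obtain ⟨θ', η', hθ', hη', k0, k0', k1, k2, k3⟩ := h'
  refine ⟨θ' ∘ θ, η ∘ η', ?_, ?_, by simp [h0, k0], by simp [h0', k0'], ?_, ?_, ?_⟩
  · exact AnalyticAt.comp (by rwa [h0]) hθ
  · exact AnalyticAt.comp (by rwa [k0']) hη'
  · filter_upwards [h1, eventually_comp_of_map_zero hθ.continuousAt h0 k1] with t ht ht'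
    simp [ht', ht]
  · filter_upwards [k2, eventually_comp_of_map_zero hη'.continuousAt k0' h2] with t ht ht'
    simp [ht', ht]
  · filter_upwards [h3, eventually_comp_of_map_zero hθ.continuousAt h0 k3] with t ht ht'
    rw [ht, ht', Function.comp]

theorem Biholomorphic.of_linear {m : ℕ} {S S' : Set (Fin m → ℂ)}
    (e : (Fin m → ℂ) ≃L[ℂ] (Fin m → ℂ)) (h : ∀ t, t ∈ S ↔ e t ∈ S') : Biholomorphic S S' := by
  refine ⟨e.toEquiv, e.differentiable, e.symm.differentiable, e.map_zero, ?_⟩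
  ext t
  constructor
  · rintro ⟨t, ht, rfl⟩
    exact (h t).1 ht
  · intro ht
    refine ⟨e.symm t, (h _).2 ?_, ?_⟩ <;> simp [ht]

theorem GermBiholomorphic.of_linear {m : ℕ} {S S' : Set (Fin m → ℂ)}
    (e : (Fin m → ℂ) ≃L[ℂ] (Fin m → ℂ)) (h : ∀ t, t ∈ S ↔ e t ∈ S') : GermBiholomorphic S S' :=
  ⟨e, e.symm, e.toContinuousLinearMap.analyticAt 0, e.symm.toContinuousLinearMap.analyticAt 0,
    e.map_zero, e.symm.map_zero, by simp, by simp, by simp [h]⟩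

/-- The analytic inverse function theorem for self-maps fixing the origin. -/
theorem exists_analytic_inverse {m : ℕ} {ψ : (Fin m → ℂ) → (Fin m → ℂ)} (hψ : AnalyticAt ℂ ψ 0)
    (h0 : ψ 0 = 0) (hinj : ∀ v, fderiv ℂ ψ 0 v = 0 → v = 0) :
    ∃ η : (Fin m → ℂ) → (Fin m → ℂ), AnalyticAt ℂ η 0 ∧ η 0 = 0 ∧
      (∀ᶠ t in 𝓝 0, η (ψ t) = t) ∧ ∀ᶠ t in 𝓝 0, ψ (η t) = t := by
  have hi : Function.Injective (fderiv ℂ ψ 0).toLinearMap :=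
    (injective_iff_map_eq_zero _).2 hinj
  let e : (Fin m → ℂ) ≃L[ℂ] (Fin m → ℂ) :=
    (LinearEquiv.ofInjectiveEndo _ hi).toContinuousLinearEquiv
  have he : (e : (Fin m → ℂ) →L[ℂ] (Fin m → ℂ)) = fderiv ℂ ψ 0 := by
    ext v; rfl
  have hs : HasStrictFDerivAt ψ (e : (Fin m → ℂ) →L[ℂ] (Fin m → ℂ)) 0 := by
    rw [he]; exact hψ.hasStrictFDerivAt
  have hc : ContDiffAt ℂ ⊤ ψ 0 := hψ.contDiffAt
  have hd : HasFDerivAt ψ (e : (Fin m → ℂ) →L[ℂ] (Fin m → ℂ)) 0 := hs.hasFDerivAt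
  refine ⟨hs.localInverse ψ e 0, ?_, ?_, hs.eventually_left_inverse, ?_⟩
  · have := hc.to_localInverse hd (by simp)
    rw [h0] at this
    exact this.analyticAt
  · have := hs.localInverse_apply_image
    rwa [h0] at this
  · have := hs.eventually_right_inverse
    rwa [h0] at this

theorem fderiv_inl_of_eventually_id {s l : ℕ} {Φ : (Fin s → ℂ) → (Fin l → ℂ) → (Fin s → ℂ)}
    {u : Fin s → ℂ}
    (hd : DifferentiableAt ℂ (fun p : (Fin s → ℂ) × (Fin l → ℂ) => Φ p.1 p.2) (u, 0))
    (hu : ∀ᶠ u' in 𝓝 u, Φ u' 0 = u') (v : Fin s → ℂ) :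
    fderiv ℂ (fun p : (Fin s → ℂ) × (Fin l → ℂ) => Φ p.1 p.2) (u, 0) (v, 0) = v := by
  have h1 : HasFDerivAt (fun u' : Fin s → ℂ => (u', (0 : Fin l → ℂ)))
      (ContinuousLinearMap.inl ℂ (Fin s → ℂ) (Fin l → ℂ)) u := by
    exact hasFDerivAt_prodMk_left u 0
  have h2 := (hd.hasFDerivAt (x := (u, 0))).comp u h1
  have h3 : HasFDerivAt (fun u' : Fin s → ℂ => u') (ContinuousLinearMap.id ℂ _) u :=
    hasFDerivAt_id u
  have h4 := h2.unique (h3.congr_of_eventuallyEq (by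
    filter_upwards [hu] with u' hu'
    simpa using hu'))
  have := DFunLike.congr_fun h4 v
  simpa using this

/-- At the origin the partial derivative in the source is the identity, it varies continuously, and
the invertible operators form an open set. -/
theorem IsCoordinateChange.eventually_surjective {s l : ℕ}
    {Φ : (Fin s → ℂ) → (Fin l → ℂ) → (Fin s → ℂ)} (hΦ : IsCoordinateChange Φ) :
    ∀ᶠ p in 𝓝 (0 : (Fin s → ℂ) × (Fin l → ℂ)),
      DifferentiableAt ℂ (fun u => Φ u p.2) p.1 ∧
      Function.Surjective (fderiv ℂ (fun u => Φ u p.2) p.1) := by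
  have ha := hΦ.1.eventually_analyticAt
  let J := ContinuousLinearMap.inl ℂ (Fin s → ℂ) (Fin l → ℂ)
  let D : (Fin s → ℂ) × (Fin l → ℂ) → ((Fin s → ℂ) →L[ℂ] (Fin s → ℂ)) := fun p =>
    (fderiv ℂ (fun p : (Fin s → ℂ) × (Fin l → ℂ) => Φ p.1 p.2) p).comp J
  have hD : ContinuousAt D 0 :=
    (hΦ.1.fderiv.continuousAt).clm_comp continuousAt_const
  have hD0 : D 0 = ContinuousLinearMap.id ℂ _ := by
    ext1 v
    exact fderiv_inl_of_eventually_id hΦ.1.differentiableAt hΦ.2 v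
  have hU : ∀ᶠ p in 𝓝 0, IsUnit (D p) := by
    refine hD.eventually (p := fun L => IsUnit L) ?_
    exact Units.isOpen.mem_nhds (by rw [hD0]; exact isUnit_one)
  filter_upwards [ha, hU] with p hp hu
  have h1 : HasFDerivAt (fun u' : Fin s → ℂ => (u', p.2)) J p.1 := by
    exact hasFDerivAt_prodMk_left p.1 p.2
  have h2 : HasFDerivAt (fun u => Φ u p.2) (D p) p.1 :=
    HasFDerivAt.comp (g := fun p : (Fin s → ℂ) × (Fin l → ℂ) => Φ p.1 p.2)
      (f := fun u' : Fin s → ℂ => (u', p.2)) p.1 hp.differentiableAt.hasFDerivAt h1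
  refine ⟨h2.differentiableAt, ?_⟩
  rw [h2.fderiv]
  obtain ⟨w, hw⟩ := hu
  intro y
  refine ⟨(↑w⁻¹ : (Fin s → ℂ) →L[ℂ] (Fin s → ℂ)) y, ?_⟩
  have := DFunLike.congr_fun w.mul_inv y
  rw [hw] at this
  simpa using this

/-- Transport of the germ of a bifurcation diagram along a family of coordinate changes over an
invertible change of bases. -/
theorem exists_representsDiagram_of_change {s m : ℕ}
    {bad badF : (Fin s → ℂ) → (Fin m → ℂ) → Prop} {S : Set (Fin m → ℂ)}
    (hS : RepresentsDiagram bad S)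
    {Φ : (Fin s → ℂ) → (Fin m → ℂ) → (Fin s → ℂ)} {ψ : (Fin m → ℂ) → (Fin m → ℂ)}
    (hΦ : IsCoordinateChange Φ) (hψ : IsBaseChange ψ) (hinj : ∀ v, fderiv ℂ ψ 0 v = 0 → v = 0)
    (hbad : ∀ᶠ p in 𝓝 (0 : (Fin s → ℂ) × (Fin m → ℂ)),
      bad p.1 p.2 ↔ badF (Φ p.1 p.2) (ψ p.2)) :
    ∃ S', RepresentsDiagram badF S' ∧ GermBiholomorphic S S' := by
  obtain ⟨η, hη, hη0, hl, hr⟩ := exists_analytic_inverse hψ.1 hψ.2 hinj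
  refine ⟨η ⁻¹' S, ?_, ψ, η, hψ.1, hη, hψ.2, hη0, hl, hr, ?_⟩
  swap
  · filter_upwards [hl] with t ht
    simp [ht]
  obtain ⟨V₀, hV₀, hV⟩ := hS
  have hΦ0 : Φ 0 0 = 0 := hΦ.2.self_of_nhds
  -- The derivative of the joint change of source and base at the origin is block triangular with
  -- diagonal blocks the identity and `dψ`, hence invertible. So `Θ` maps neighbourhoods of the
  -- origin onto neighbourhoods of the origin, and degenerate points of `badF` lift.
  let Θ : (Fin s → ℂ) × (Fin m → ℂ) → (Fin s → ℂ) × (Fin m → ℂ) := fun p => (Φ p.1 p.2, ψ p.2)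
  have hΘ0 : Θ 0 = 0 := by simp [Θ, hΦ0, hψ.2]
  have hψ2 : AnalyticAt ℂ (fun p : (Fin s → ℂ) × (Fin m → ℂ) => ψ p.2) 0 :=
    AnalyticAt.comp (g := ψ) (f := Prod.snd) hψ.1 analyticAt_snd
  have hΘ : AnalyticAt ℂ Θ 0 := hΦ.1.prod hψ2
  have hΘs := hΘ.hasStrictFDerivAt
  have hΘf : fderiv ℂ Θ 0 = (fderiv ℂ (fun p : (Fin s → ℂ) × (Fin m → ℂ) => Φ p.1 p.2) 0).prod
      ((fderiv ℂ ψ 0).comp (ContinuousLinearMap.snd ℂ _ _)) := by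
    refine HasFDerivAt.fderiv ?_
    refine hΦ.1.differentiableAt.hasFDerivAt.prodMk ?_
    exact HasFDerivAt.comp (g := ψ) (f := Prod.snd) (0 : (Fin s → ℂ) × (Fin m → ℂ))
      hψ.1.differentiableAt.hasFDerivAt hasFDerivAt_snd
  have hinjΘ : Function.Injective (fderiv ℂ Θ 0).toLinearMap := by
    refine (injective_iff_map_eq_zero _).2 ?_
    rintro ⟨u, t⟩ h
    rw [hΘf] at h
    have h1 := congrArg Prod.fst h
    have h2 := congrArg Prod.snd h
    have ht : t = 0 := hinj t (by simpa using h2)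
    subst ht
    have h3 := fderiv_inl_of_eventually_id hΦ.1.differentiableAt hΦ.2 u
    have hu : u = 0 := by
      rw [← h3]; exact h1
    simp [hu]
  have hsurj : Function.Surjective (fderiv ℂ Θ 0) :=
    LinearMap.injective_iff_surjective.1 hinjΘ
  have hmap : map Θ (𝓝 0) = 𝓝 0 := by
    have := hΘs.map_nhds_eq_of_surj (LinearMap.range_eq_top.2 hsurj)
    rwa [hΘ0] at this
  -- every point near the origin is in the image of a good point near the origin
  have key : ∀ᶠ q in 𝓝 (0 : (Fin s → ℂ) × (Fin m → ℂ)), ∃ p : (Fin s → ℂ) × (Fin m → ℂ),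
      Θ p = q ∧ p.1 ∈ V₀ ∧ η (ψ p.2) = p.2 ∧ (bad p.1 p.2 ↔ badF (Φ p.1 p.2) (ψ p.2)) := by
    rw [← hmap, eventually_map]
    have h1 : ∀ᶠ p in 𝓝 (0 : (Fin s → ℂ) × (Fin m → ℂ)), p.1 ∈ V₀ :=
      eventually_comp_of_map_zero continuousAt_fst rfl hV₀
    have h2 : ∀ᶠ p in 𝓝 (0 : (Fin s → ℂ) × (Fin m → ℂ)), η (ψ p.2) = p.2 :=
      eventually_comp_of_map_zero continuousAt_snd rfl hl
    filter_upwards [h1, h2, hbad] with p h1 h2 h3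
    exact ⟨p, rfl, h1, h2, h3⟩
  obtain ⟨U₀, hU₀, T₀, hT₀, hUT⟩ := mem_nhds_prod_iff.1
    (show _ ∈ 𝓝 ((0, 0) : (Fin s → ℂ) × (Fin m → ℂ)) from key)
  refine ⟨U₀, hU₀, fun U hU hUU => ?_⟩
  have hΘU : ∀ᶠ p in 𝓝 (0 : (Fin s → ℂ) × (Fin m → ℂ)), Φ p.1 p.2 ∈ U := by
    have hc : ContinuousAt (fun p : (Fin s → ℂ) × (Fin m → ℂ) => Φ p.1 p.2) 0 :=
      hΦ.1.continuousAt
    refine eventually_comp_of_map_zero hc (by simpa using hΦ0) hU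
  obtain ⟨V, hVn, T, hT, hVT⟩ :=
    mem_nhds_prod_iff.1 (show _ ∈ 𝓝 ((0, 0) : (Fin s → ℂ) × (Fin m → ℂ)) from hΘU.and hbad)
  -- The smaller neighbourhood is for pushing a degenerate point forward into `U`; for lifting one,
  -- landing in `V₀` is enough.
  have e1 := hV (V ∩ V₀) (inter_mem hVn hV₀) Set.inter_subset_right
  have e2 := hV V₀ hV₀ subset_rfl
  have hηc := hη.continuousAt
  filter_upwards [hT₀, hr, eventually_comp_of_map_zero hηc hη0 e1,
    eventually_comp_of_map_zero hηc hη0 e2, eventually_comp_of_map_zero hηc hη0 hT]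
    with t ht htr h1 h2 h3
  constructor
  · intro hts
    obtain ⟨u, hu, hb⟩ := h1.1 hts
    obtain ⟨hu1, hu2⟩ := hVT (Set.mk_mem_prod hu.1 h3)
    exact ⟨Φ u (η t), hu1, by simpa [htr] using hu2.1 hb⟩
  · rintro ⟨u, hu, hb⟩
    obtain ⟨p, hp, hpV, hpη, hpb⟩ := hUT (Set.mk_mem_prod (hUU hu) ht)
    have hp1 : Φ p.1 p.2 = u := congrArg Prod.fst hp
    have hp2 : ψ p.2 = t := congrArg Prod.snd hp
    rw [hp1, hp2] at hpb
    rw [hp2] at hpη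
    refine h2.2 ⟨p.1, hpV, ?_⟩
    rw [hpη]
    exact hpb.2 hb

end

noncomputable section

/-! ## Transversality to the corank stratification -/

/-- Along a holomorphic curve of matrices of constant rank, the velocity maps the kernel into the
image. -/
theorem exists_mulVec_eq_of_rank_eventuallyEq {n r : ℕ} {γ : ℂ → Matrix (Fin n) (Fin n) ℂ}
    {B : Matrix (Fin n) (Fin n) ℂ} (hγ : ∀ i j, HasDerivAt (fun s => γ s i j) (B i j) 0)
    (hr : ∀ᶠ s in 𝓝 0, (γ s).rank = r) {x : Fin n → ℂ} (hx : (γ 0).mulVec x = 0) :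
    ∃ z, B.mulVec x = (γ 0).mulVec z := by
  by_contra hcon
  push Not at hcon
  let R := LinearMap.range (γ 0).mulVecLin
  have hR : Module.finrank ℂ R = r := hr.self_of_nhds
  let b := Module.finBasisOfFinrankEq ℂ R hR
  choose e he using fun i => (b i).2
  have hli : LinearIndependent ℂ (fun i => (b i : Fin n → ℂ)) :=
    b.linearIndependent.map' R.subtype (Submodule.ker_subtype R)
  have hspan : Submodule.span ℂ (Set.range fun i => (b i : Fin n → ℂ)) ≤ R := by
    rw [Submodule.span_le]
    rintro _ ⟨i, rfl⟩
    exact (b i).2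
  have hli' : LinearIndependent ℂ (fun o : Option (Fin r) =>
      o.casesOn' (B.mulVec x) (fun i => (b i : Fin n → ℂ))) := by
    refine linearIndependent_option'.2 ⟨hli, fun h => ?_⟩
    obtain ⟨z, hz⟩ := hspan h
    exact hcon z hz.symm
  -- For `s ≠ 0` all these vectors lie in the image of `γ s`. Since `γ 0` kills `x`, they tend to `B
  -- x` together with a basis of the image of `γ 0`. If `B x` were outside that image, the limit
  -- would be `r + 1` independent vectors, and independence is an open condition, so the rank of `γ
  -- s` would exceed `r`.
  let g : ℂ → Option (Fin r) → (Fin n → ℂ) := fun s o =>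
    o.casesOn' (s⁻¹ • (γ s).mulVec x) (fun i => (γ s).mulVec (e i))
  have hcont : ∀ i j, ContinuousAt (fun s => γ s i j) 0 := fun i j => (hγ i j).continuousAt
  have hlim : Tendsto g (𝓝[≠] 0) (𝓝 (fun o : Option (Fin r) =>
      o.casesOn' (B.mulVec x) (fun i => (b i : Fin n → ℂ)))) := by
    rw [tendsto_pi_nhds]
    rintro (_ | i)
    · have h1 : HasDerivAt (fun s => (γ s).mulVec x) (B.mulVec x) 0 := by
        rw [hasDerivAt_pi]
        intro i
        simp only [Matrix.mulVec, dotProduct]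
        exact HasDerivAt.fun_sum fun j _ => (hγ i j).mul_const (x j)
      have h2 := hasDerivAt_iff_tendsto_slope.1 h1
      refine h2.congr fun s => ?_
      simp [g, slope, hx]
    · have : (b i : Fin n → ℂ) = (γ 0).mulVec (e i) := (he i).symm
      simp only [Option.casesOn'_some, this, g]
      have h3 : ContinuousAt (fun s => (γ s).mulVec (e i)) 0 := by
        rw [continuousAt_pi]
        intro k
        simp only [Matrix.mulVec, dotProduct]
        exact tendsto_finsetSum _ fun j _ => (hcont k j).mul (continuousAt_const (y := e i j))
      exact h3.tendsto.mono_left nhdsWithin_le_nhds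
  have hev : ∀ᶠ s in 𝓝[≠] (0 : ℂ), LinearIndependent ℂ (g s) :=
    hlim.eventually (isOpen_setOfPred_linearIndependent.mem_nhds hli')
  obtain ⟨s, hs, hsr⟩ := (hev.and (hr.filter_mono nhdsWithin_le_nhds)).exists
  have hle : Submodule.span ℂ (Set.range (g s)) ≤ LinearMap.range (γ s).mulVecLin := by
    rw [Submodule.span_le]
    rintro _ ⟨_ | i, rfl⟩
    · exact ⟨s⁻¹ • x, by simp [g]⟩
    · exact ⟨e i, by simp [g]⟩
  have h1 := Submodule.finrank_mono hle
  rw [finrank_span_eq_card hs] at h1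
  have h2 : Module.finrank ℂ (LinearMap.range (γ s).mulVecLin) = r := hsr
  simp [h2] at h1

/-- A generalized inverse: the rank normal form `V S U` is idempotent up to nothing but reindexing,
so the identity holds after multiplication by the units `V` and `U`, which cancel. -/
theorem exists_mul_mul_self {n : ℕ} (S : Matrix (Fin n) (Fin n) ℂ) :
    ∃ Q : Matrix (Fin n) (Fin n) ℂ, S * Q * S = S := by
  obtain ⟨V, U, e, hV, hU, h⟩ := S.exists_rank_normal_form
  refine ⟨U * (V * S * U) * V, ?_⟩
  have hid : (V * S * U) * (V * S * U) = V * S * U := by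
    rw [h, Matrix.submatrix_mul_equiv, Matrix.fromBlocks_multiply]
    simp
  refine hU.mul_right_cancel (hV.mul_left_cancel ?_)
  calc _ = (V * S * U) * (V * S * U) * (V * S * U) := by simp only [Matrix.mul_assoc]
    _ = V * S * U := by rw [hid, hid]
    _ = _ := by simp only [Matrix.mul_assoc]

/-- Symmetric matrices annihilated by `A` are conormal at `A` to the stratum of `A`. -/
theorem IsTangentTo.trace_mul_eq_zero {n c : ℕ} {A B S : Matrix (Fin n) (Fin n) ℂ}
    (h : IsTangentTo (corankStratum n c) A B) (hS : S.IsSymm) (hAS : A * S = 0) :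
    (S * B).trace = 0 := by
  obtain ⟨γ, hγ, h0, hstr, hB⟩ := h
  have hγ' : ∀ i j, HasDerivAt (fun s => γ s i j) (B i j) 0 := fun i j =>
    hB i j ▸ (hγ i j).differentiableAt.hasDerivAt
  have hr : ∀ᶠ s in 𝓝 0, (γ s).rank = n - c := hstr.mono fun s hs => by
    have := hs.2
    omega
  have hA : A.IsSymm := h0 ▸ hstr.self_of_nhds.1
  have hSA : S * A = 0 := by
    have := congrArg Matrix.transpose hAS
    rwa [Matrix.transpose_mul, hS, hA, Matrix.transpose_zero] at this
  -- Columns of `S` lie in the kernel of `A`, the velocity `B` sends this kernel into the image of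
  -- `A`, and `S` kills that image.
  have hSBS : S * B * S = 0 := by
    ext i j
    have hk : (γ 0).mulVec (S.col j) = 0 := by
      rw [h0]
      ext k
      exact congrFun (congrFun hAS k) j
    obtain ⟨z, hz⟩ := exists_mulVec_eq_of_rank_eventuallyEq hγ' hr hk
    have : (S * B * S).col j = 0 := by
      calc (S * B * S).col j = S.mulVec (B.mulVec (S.col j)) := by
            rw [Matrix.mulVec_mulVec]; rfl
        _ = 0 := by rw [hz, h0, Matrix.mulVec_mulVec, hSA, Matrix.zero_mulVec]
    exact congrFun this i
  -- Writing `S = S Q S` and rotating the trace brings out the factor `S B S`.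
  obtain ⟨Q, hQ⟩ := exists_mul_mul_self S
  calc (S * B).trace = (S * Q * (S * B)).trace := by rw [← Matrix.mul_assoc, hQ]
    _ = (Q * (S * B * S)).trace := by
        rw [Matrix.mul_assoc, Matrix.trace_mul_comm, Matrix.mul_assoc]
    _ = 0 := by rw [hSBS]; simp

/-- Differentiate the congruence curve `(1 + sX)ᵀ A (1 + sX)`; it keeps rank and symmetry while `1 +
sX` is invertible, that is, for small `s`. -/
theorem isTangentTo_transpose_mul_add_mul {n c : ℕ} {A : Matrix (Fin n) (Fin n) ℂ}
    (hA : A ∈ corankStratum n c) (X : Matrix (Fin n) (Fin n) ℂ) :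
    IsTangentTo (corankStratum n c) A (X.transpose * A + A * X) := by
  have hexp : ∀ s : ℂ, (1 + s • X).transpose * A * (1 + s • X) =
      A + s • (X.transpose * A + A * X) + s ^ 2 • (X.transpose * A * X) := by
    intro s
    simp only [Matrix.transpose_add, Matrix.transpose_one, Matrix.transpose_smul, Matrix.add_mul,
      Matrix.mul_add, Matrix.one_mul, Matrix.mul_one, Matrix.smul_mul, Matrix.mul_smul, smul_add,
      smul_smul, pow_two]
    abel
  have hent : ∀ i j, ∀ s : ℂ, ((1 + s • X).transpose * A * (1 + s • X)) i j =
      A i j + s * (X.transpose * A + A * X) i j + s ^ 2 * (X.transpose * A * X) i j := by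
    intro i j s
    rw [hexp]
    simp [mul_add]
  have hder : ∀ i j, HasDerivAt
      (fun s : ℂ => ((1 + s • X).transpose * A * (1 + s • X)) i j)
      ((X.transpose * A + A * X) i j) 0 := by
    intro i j
    simp_rw [hent]
    have h1 := ((hasDerivAt_id (0 : ℂ)).mul_const ((X.transpose * A + A * X) i j)).const_add (A i j)
    have h2 := (((hasDerivAt_id (0 : ℂ)).pow 2).mul_const ((X.transpose * A * X) i j))
    simpa using h1.fun_add h2
  refine ⟨fun s => (1 + s • X).transpose * A * (1 + s • X), ?_, by simp, ?_, fun i j => ?_⟩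
  · intro i j
    simp_rw [hent]
    fun_prop
  · have hdet : ∀ᶠ s in 𝓝 (0 : ℂ), IsUnit (1 + s • X).det := by
      have hc : Continuous fun s : ℂ => (1 + s • X).det := by
        refine Continuous.matrix_det ?_
        fun_prop
      filter_upwards [hc.continuousAt.eventually_ne (x := 0) (y := 0) (by simp)] with s hs
      exact isUnit_iff_ne_zero.2 hs
    filter_upwards [hdet] with s hs
    refine ⟨?_, ?_⟩
    · have : A.IsSymm := hA.1
      simp [Matrix.IsSymm, Matrix.transpose_mul, this.eq, Matrix.mul_assoc]
    · rw [Matrix.rank_mul_eq_left_of_isUnit_det _ _ hs,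
        Matrix.rank_mul_eq_right_of_isUnit_det _ _ (by rwa [Matrix.det_transpose])]
      exact hA.2
  · exact (hder i j).deriv

theorem trace_mul_eq_sum {n : ℕ} {S : Matrix (Fin n) (Fin n) ℂ} (hS : S.IsSymm)
    (B : Matrix (Fin n) (Fin n) ℂ) : (S * B).trace = ∑ i, ∑ j, S i j * B i j := by
  rw [Matrix.trace, Finset.sum_comm]
  refine Finset.sum_congr rfl fun i _ => ?_
  rw [Matrix.diag_apply, Matrix.mul_apply]
  exact Finset.sum_congr rfl fun j _ => by rw [hS.apply]

/-- Non-transversality in terms of conormal vectors. -/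
theorem notTransversalAt_iff {s n : ℕ} {f : (Fin s → ℂ) → Matrix (Fin n) (Fin n) ℂ}
    {u : Fin s → ℂ} (hs : ∀ᶠ x in 𝓝 u, (f x).IsSymm) :
    NotTransversalAt f u ↔ ∃ S : Matrix (Fin n) (Fin n) ℂ, S ≠ 0 ∧ S.IsSymm ∧ f u * S = 0 ∧
      ∀ v, ∑ i, ∑ j, S i j * fderiv ℂ (fun x => f x i j) u v = 0 := by
  have hfu : (f u).IsSymm := hs.self_of_nhds
  constructor
  · rintro ⟨c, -, hA, hnot⟩
    push Not at hnot
    obtain ⟨C, hC, hCn⟩ := hnot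
    let D : (Fin s → ℂ) →ₗ[ℂ] Matrix (Fin n) (Fin n) ℂ :=
      { toFun := fun v => Matrix.of fun i j => fderiv ℂ (fun x => f x i j) u v
        map_add' := fun v w => by ext i j; simp
        map_smul' := fun a v => by ext i j; simp }
    let Ψ : (Fin s → ℂ) × Matrix (Fin n) (Fin n) ℂ →ₗ[ℂ] Matrix (Fin n) (Fin n) ℂ :=
      { toFun := fun p => D p.1 + (p.2.transpose * f u + f u * p.2)
        map_add' := fun p q => by
          simp only [Prod.fst_add, Prod.snd_add, map_add, Matrix.transpose_add, Matrix.add_mul,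
            Matrix.mul_add]
          abel
        map_smul' := fun a p => by simp }
    have hCW : C ∉ LinearMap.range Ψ := by
      rintro ⟨⟨v, X⟩, h⟩
      obtain ⟨i, j, hij⟩ := hCn v _ (isTangentTo_transpose_mul_add_mul hA X)
      exact hij (by rw [← h]; rfl)
    -- Already the tangent directions of the congruence orbit fail to fill up the symmetric matrices
    -- together with the differential. A linear form vanishing on all of these but not on `C` yields
    -- the conormal matrix, once its coefficient matrix `T` is symmetrized.
    obtain ⟨φ, hφC, hφ⟩ := Submodule.exists_le_ker_of_notMem hCW
    have hφ0 : ∀ v X, φ (D v + (X.transpose * f u + f u * X)) = 0 := fun v X =>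
      hφ ⟨(v, X), rfl⟩
    let T : Matrix (Fin n) (Fin n) ℂ := Matrix.of fun i j => φ (Matrix.single i j 1)
    have hT : ∀ B, φ B = ∑ i, ∑ j, T i j * B i j := by
      intro B
      conv_lhs => rw [Matrix.matrix_eq_sum_single B]
      simp only [map_sum]
      refine Finset.sum_congr rfl fun i _ => Finset.sum_congr rfl fun j _ => ?_
      have : Matrix.single i j (B i j) = B i j • Matrix.single i j (1 : ℂ) := by simp
      rw [this, map_smul, smul_eq_mul, mul_comm]
      rfl
    have hTt : ∀ B, φ B = (T.transpose * B).trace := by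
      intro B
      rw [hT, Matrix.trace, Finset.sum_comm]
      rfl
    have hsymm : (T + T.transpose).IsSymm := by
      simp [Matrix.IsSymm, add_comm]
    have htwo : ∀ B : Matrix (Fin n) (Fin n) ℂ, B.IsSymm →
        ∑ i, ∑ j, (T + T.transpose) i j * B i j = 2 * φ B := by
      intro B hB
      have h1 : ∑ i, ∑ j, T.transpose i j * B i j = φ B := by
        rw [hT, Finset.sum_comm]
        refine Finset.sum_congr rfl fun i _ => Finset.sum_congr rfl fun j _ => ?_
        rw [hB.apply]
        rfl
      simp only [Matrix.add_apply, add_mul, Finset.sum_add_distrib]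
      rw [h1, ← hT, two_mul]
    have hDsymm : ∀ v, (D v).IsSymm := by
      intro v
      ext i j
      have : (fun x => f x j i) =ᶠ[𝓝 u] fun x => f x i j := hs.mono fun x hx => hx.apply i j
      change fderiv ℂ (fun x => f x j i) u v = fderiv ℂ (fun x => f x i j) u v
      rw [this.fderiv_eq]
    refine ⟨T + T.transpose, ?_, hsymm, ?_, ?_⟩
    · intro h0
      have := htwo C hC
      rw [h0] at this
      simp at this
      exact hφC this
    -- Vanishing of `φ` on `Xᵀ f(u) + f(u) X` for every `X` is orthogonality of `(T + Tᵀ) f(u)` to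
    -- all matrices.
    · have h1 : ∀ X, ((T + T.transpose) * f u * X).trace = 0 := by
        intro X
        have h2 := hφ0 0 X
        rw [map_zero, zero_add, map_add, hTt, hTt] at h2
        have h3 : (T.transpose * (X.transpose * f u)).trace = (T * f u * X).trace := by
          rw [← Matrix.trace_transpose]
          simp only [Matrix.transpose_mul, Matrix.transpose_transpose, hfu.eq]
          rw [Matrix.trace_mul_comm, Matrix.mul_assoc]
        rw [h3] at h2
        rw [Matrix.add_mul, Matrix.add_mul, Matrix.trace_add, ← h2, Matrix.mul_assoc T.transpose]
      have h4 : (T + T.transpose) * f u = 0 := by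
        ext i j
        have := h1 (Matrix.single j i 1)
        rw [Matrix.trace_mul_comm, Matrix.trace_single_mul] at this
        simpa using this
      have := congrArg Matrix.transpose h4
      rwa [Matrix.transpose_mul, hsymm, hfu, Matrix.transpose_zero] at this
    · intro v
      have h1 := htwo (D v) (hDsymm v)
      have h2 := hφ0 v 0
      simp only [Matrix.transpose_zero, Matrix.zero_mul, Matrix.mul_zero, add_zero] at h2
      rw [h2, mul_zero] at h1
      exact h1
  · rintro ⟨S, hS0, hS, hAS, hv⟩
    have hrank : (f u).rank < n := by
      have h1 := Matrix.rank_add_rank_le_card_of_mul_eq_zero hAS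
      rw [Fintype.card_fin] at h1
      have h2 : 0 < S.rank := by
        rw [Nat.pos_iff_ne_zero]
        intro h
        have h3 : LinearMap.range S.mulVecLin = ⊥ := Submodule.finrank_eq_zero.1 h
        rw [LinearMap.range_eq_bot] at h3
        apply hS0
        ext i j
        have := congrFun (DFunLike.congr_fun h3 (Pi.single j 1)) i
        simpa using this
      omega
    refine ⟨n - (f u).rank, by omega, ⟨hfu, by omega⟩, fun hall => hS0 ?_⟩
    -- The test direction is the complex conjugate of `S`: if it were a sum of a tangent vector and
    -- a value of the differential, its pairing with `S`, which is the sum of the squared moduli of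
    -- the entries, would vanish.
    obtain ⟨v, B, hB, hC⟩ := hall (S.map (starRingEnd ℂ)) (by
      ext i j
      simp [hS.apply i j])
    have h1 := hB.trace_mul_eq_zero hS hAS
    rw [trace_mul_eq_sum hS] at h1
    have h2 : ∑ i, ∑ j, S i j * (starRingEnd ℂ) (S i j) = 0 := by
      have : ∀ i j, S i j * (starRingEnd ℂ) (S i j) =
          S i j * fderiv ℂ (fun x => f x i j) u v + S i j * B i j := by
        intro i j
        have := hC i j
        rw [Matrix.map_apply] at this
        rw [this, mul_add]
      simp only [this, Finset.sum_add_distrib]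
      rw [hv v, h1, add_zero]
    have h3 : ∑ i, ∑ j, Complex.normSq (S i j) = 0 := by
      have : ((∑ i, ∑ j, Complex.normSq (S i j) : ℝ) : ℂ) = 0 := by
        push_cast
        simpa only [Complex.mul_conj] using h2
      exact_mod_cast this
    ext i j
    have h4 := (Finset.sum_eq_zero_iff_of_nonneg fun i _ =>
      Finset.sum_nonneg fun j _ => Complex.normSq_nonneg _).1 h3 i (Finset.mem_univ _)
    have h5 := (Finset.sum_eq_zero_iff_of_nonneg fun j _ => Complex.normSq_nonneg _).1 h4 j
      (Finset.mem_univ _)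
    simpa using h5

/-! ## Invariance of degeneracy under equivalences -/

/-- Entrywise derivative of a curve of matrices. -/
def HasMatrixDerivAt {m n : Type*} (γ : ℂ → Matrix m n ℂ) (B : Matrix m n ℂ) (s : ℂ) : Prop :=
  ∀ i j, HasDerivAt (fun x => γ x i j) (B i j) s

theorem HasMatrixDerivAt.transpose {m n : Type*} {γ : ℂ → Matrix m n ℂ} {B : Matrix m n ℂ} {s : ℂ}
    (h : HasMatrixDerivAt γ B s) : HasMatrixDerivAt (fun x => (γ x).transpose) B.transpose s :=
  fun i j => h j i

theorem HasMatrixDerivAt.mul {l m n : Type*} [Fintype m] {γ : ℂ → Matrix l m ℂ}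
    {δ : ℂ → Matrix m n ℂ} {B : Matrix l m ℂ} {C : Matrix m n ℂ} {s : ℂ}
    (h : HasMatrixDerivAt γ B s) (h' : HasMatrixDerivAt δ C s) :
    HasMatrixDerivAt (fun x => γ x * δ x) (B * δ s + γ s * C) s := by
  intro i j
  simp only [Matrix.mul_apply, Matrix.add_apply, ← Finset.sum_add_distrib]
  exact HasDerivAt.fun_sum fun k _ => (h i k).mul (h' k j)

theorem HasMatrixDerivAt.congr {m n : Type*} {γ δ : ℂ → Matrix m n ℂ} {B : Matrix m n ℂ} {s : ℂ}
    (h : HasMatrixDerivAt γ B s) (he : ∀ᶠ x in 𝓝 s, δ x = γ x) : HasMatrixDerivAt δ B s :=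
  fun i j => (h i j).congr_of_eventuallyEq (he.mono fun x hx => by
    change δ x i j = γ x i j
    rw [hx])

theorem HasMatrixDerivAt.unique {m n : Type*} {γ : ℂ → Matrix m n ℂ} {B C : Matrix m n ℂ} {s : ℂ}
    (h : HasMatrixDerivAt γ B s) (h' : HasMatrixDerivAt γ C s) : B = C := by
  ext i j
  exact (h i j).unique (h' i j)

/-- The entrywise directional derivative. -/
def matrixFDeriv {s : ℕ} {m n : Type*} (f : (Fin s → ℂ) → Matrix m n ℂ) (u v : Fin s → ℂ) :
    Matrix m n ℂ :=
  Matrix.of fun i j => fderiv ℂ (fun x => f x i j) u v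

theorem hasDerivAt_add_smul {s : ℕ} (u v : Fin s → ℂ) :
    HasDerivAt (fun ε : ℂ => u + ε • v) v 0 := by
  simpa using ((hasDerivAt_id (0 : ℂ)).smul_const v).const_add u

theorem hasMatrixDerivAt_line {s : ℕ} {m n : Type*} {f : (Fin s → ℂ) → Matrix m n ℂ}
    {u : Fin s → ℂ} (hf : ∀ i j, DifferentiableAt ℂ (fun x => f x i j) u) (v : Fin s → ℂ) :
    HasMatrixDerivAt (fun ε : ℂ => f (u + ε • v)) (matrixFDeriv f u v) 0 := by
  intro i j
  refine HasFDerivAt.comp_hasDerivAt (l := fun x => f x i j) (f := fun ε : ℂ => u + ε • v) 0 ?_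
    (hasDerivAt_add_smul u v)
  simpa using (hf i j).hasFDerivAt

/-- Conormal matrices correspond under `S ↦ A S Aᵀ`. In the derivative of `Aᵀ (f ∘ Φ) A`, the two
terms that differentiate `A` pair to zero with a conormal matrix, and the remaining term is a
derivative of `f` in an arbitrary direction because `dΦ` is onto. -/
theorem notTransversalAt_congruence_iff {s n : ℕ} {f g : (Fin s → ℂ) → Matrix (Fin n) (Fin n) ℂ}
    {Φ : (Fin s → ℂ) → (Fin s → ℂ)} {A : (Fin s → ℂ) → Matrix (Fin n) (Fin n) ℂ} {u : Fin s → ℂ}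
    (hf : ∀ i j, DifferentiableAt ℂ (fun x => f x i j) (Φ u))
    (hfs : ∀ᶠ x in 𝓝 (Φ u), (f x).IsSymm) (hΦ : DifferentiableAt ℂ Φ u)
    (hsurj : Function.Surjective (fderiv ℂ Φ u))
    (hA : ∀ i j, DifferentiableAt ℂ (fun x => A x i j) u) (hdet : IsUnit (A u).det)
    (hg : ∀ᶠ y in 𝓝 u, g y = (A y).transpose * f (Φ y) * A y) :
    NotTransversalAt g u ↔ NotTransversalAt f (Φ u) := by
  have hgs : ∀ᶠ y in 𝓝 u, (g y).IsSymm := by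
    filter_upwards [hg, hΦ.continuousAt.eventually hfs] with y hy hy'
    rw [hy]
    simp [Matrix.IsSymm, Matrix.transpose_mul, hy'.eq, Matrix.mul_assoc]
  have hD : ∀ v, matrixFDeriv g u v = (matrixFDeriv A u v).transpose * f (Φ u) * A u +
      (A u).transpose * matrixFDeriv f (Φ u) (fderiv ℂ Φ u v) * A u +
      (A u).transpose * f (Φ u) * matrixFDeriv A u v := by
    intro v
    have hlin : Tendsto (fun ε : ℂ => u + ε • v) (𝓝 0) (𝓝 u) := by
      simpa [ContinuousAt] using (hasDerivAt_add_smul u v).continuousAt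
    have h1 := hasMatrixDerivAt_line hA v
    have h2 : HasMatrixDerivAt (fun ε : ℂ => f (Φ (u + ε • v)))
        (matrixFDeriv f (Φ u) (fderiv ℂ Φ u v)) 0 := by
      intro i j
      have h3 : HasDerivAt (fun ε : ℂ => Φ (u + ε • v)) (fderiv ℂ Φ u v) 0 := by
        refine HasFDerivAt.comp_hasDerivAt (l := Φ) (f := fun ε : ℂ => u + ε • v) 0 ?_
          (hasDerivAt_add_smul u v)
        simpa using hΦ.hasFDerivAt
      refine HasFDerivAt.comp_hasDerivAt (l := fun x => f x i j)
        (f := fun ε : ℂ => Φ (u + ε • v)) 0 ?_ h3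
      simpa using (hf i j).hasFDerivAt
    have h4 := ((h1.transpose.mul h2).mul h1).congr (δ := fun ε => g (u + ε • v))
      (hlin.eventually hg)
    have hgd : ∀ i j, DifferentiableAt ℂ (fun x => g x i j) u := by
      intro i j
      have : (fun y => g y i j) =ᶠ[𝓝 u]
          fun y => ∑ l, (∑ k, A y k i * f (Φ y) k l) * A y l j := by
        filter_upwards [hg] with y hy
        rw [hy]
        simp [Matrix.mul_apply]
      refine DifferentiableAt.congr_of_eventuallyEq ?_ this
      refine DifferentiableAt.fun_sum fun l _ => DifferentiableAt.mul ?_ (hA l j)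
      refine DifferentiableAt.fun_sum fun k _ => (hA k i).mul ?_
      exact DifferentiableAt.comp (g := fun x => f x k l) (f := Φ) u (hf k l) hΦ
    have h5 := h4.unique (hasMatrixDerivAt_line hgd v)
    rw [← h5]
    simp only [zero_smul, add_zero, Matrix.add_mul]
  have hA1 := Matrix.mul_nonsing_inv _ hdet
  have hA2 := Matrix.nonsing_inv_mul _ hdet
  have hAt : ∀ X Y : Matrix (Fin n) (Fin n) ℂ,
      (A u).transpose * X = (A u).transpose * Y → X = Y := by
    intro X Y h
    have h1 := congrArg ((A u)⁻¹.transpose * ·) h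
    simpa only [← Matrix.mul_assoc, ← Matrix.transpose_mul, hA1, Matrix.transpose_one,
      Matrix.one_mul] using h1
  have hpair : ∀ S : Matrix (Fin n) (Fin n) ℂ, S.IsSymm → f (Φ u) * (A u * S) = 0 → ∀ v,
      (S * matrixFDeriv g u v).trace =
        ((A u * S * (A u).transpose) * matrixFDeriv f (Φ u) (fderiv ℂ Φ u v)).trace := by
    intro S hS h0 v
    have h0' : S * (A u).transpose * f (Φ u) = 0 := by
      have := congrArg Matrix.transpose h0
      rwa [Matrix.transpose_mul, Matrix.transpose_mul, hS, hfs.self_of_nhds,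
        Matrix.transpose_zero] at this
    rw [hD, Matrix.mul_add, Matrix.mul_add, Matrix.trace_add, Matrix.trace_add]
    have e1 : (S * ((matrixFDeriv A u v).transpose * f (Φ u) * A u)).trace = 0 := by
      rw [Matrix.trace_mul_comm]
      simp only [Matrix.mul_assoc]
      rw [h0]
      simp
    have e2 : S * ((A u).transpose * f (Φ u) * matrixFDeriv A u v) = 0 := by
      simp only [← Matrix.mul_assoc]
      rw [h0', Matrix.zero_mul]
    have e3 : (S * ((A u).transpose * matrixFDeriv f (Φ u) (fderiv ℂ Φ u v) * A u)).trace =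
        ((A u * S * (A u).transpose) * matrixFDeriv f (Φ u) (fderiv ℂ Φ u v)).trace := by
      rw [← Matrix.mul_assoc, Matrix.trace_mul_comm]
      simp only [Matrix.mul_assoc]
    rw [e1, e2, e3]
    simp
  rw [notTransversalAt_iff hgs, notTransversalAt_iff hfs]
  constructor
  · rintro ⟨S, hS0, hS, hgS, hv⟩
    have h0 : f (Φ u) * (A u * S) = 0 := by
      refine hAt _ _ ?_
      rw [Matrix.mul_zero, ← hgS, hg.self_of_nhds]
      simp only [Matrix.mul_assoc]
    have hS' : (A u * S * (A u).transpose).IsSymm := by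
      simp [Matrix.IsSymm, Matrix.transpose_mul, hS.eq, Matrix.mul_assoc]
    refine ⟨A u * S * (A u).transpose, fun h => hS0 ?_, hS', ?_, fun w => ?_⟩
    · have := congrArg (fun X => (A u)⁻¹ * X * (A u)⁻¹.transpose) h
      simp only [Matrix.mul_zero, Matrix.zero_mul] at this
      rw [← this]
      simp only [Matrix.mul_assoc]
      rw [← Matrix.transpose_mul, hA2, ← Matrix.mul_assoc, hA2]
      simp
    · rw [← Matrix.mul_assoc, h0, Matrix.zero_mul]
    · obtain ⟨v, rfl⟩ := hsurj w
      have h1 := hpair S hS h0 v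
      rw [trace_mul_eq_sum hS, trace_mul_eq_sum hS'] at h1
      exact h1.symm.trans (hv v)
  · rintro ⟨S', hS0, hS, hfS, hv⟩
    let S := (A u)⁻¹ * S' * (A u)⁻¹.transpose
    have hSS : A u * S * (A u).transpose = S' := by
      simp only [S, Matrix.mul_assoc]
      rw [← Matrix.transpose_mul, hA1, ← Matrix.mul_assoc, hA1]
      simp
    have hS' : S.IsSymm := by
      simp [S, Matrix.IsSymm, Matrix.transpose_mul, hS.eq, Matrix.mul_assoc]
    have h0 : f (Φ u) * (A u * S) = 0 := by
      have : A u * S = S' * (A u)⁻¹.transpose := by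
        rw [← hSS, Matrix.mul_assoc, ← Matrix.transpose_mul, hA2]
        simp
      rw [this, ← Matrix.mul_assoc, hfS, Matrix.zero_mul]
    refine ⟨S, fun h => hS0 ?_, hS', ?_, fun v => ?_⟩
    · rw [← hSS, h]; simp
    · rw [hg.self_of_nhds, Matrix.mul_assoc, Matrix.mul_assoc, h0, Matrix.mul_zero]
    · have h1 := hpair S hS' h0 v
      rw [hSS, trace_mul_eq_sum hS, trace_mul_eq_sum hS'] at h1
      exact h1.trans (hv _)

theorem isSingularZero_comp_iff {p : ℕ} {f g : (Fin p → ℂ) → ℂ} {Φ : (Fin p → ℂ) → (Fin p → ℂ)}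
    {x : Fin p → ℂ} (hf : DifferentiableAt ℂ f (Φ x)) (hΦ : DifferentiableAt ℂ Φ x)
    (hsurj : Function.Surjective (fderiv ℂ Φ x)) (hg : ∀ᶠ y in 𝓝 x, g y = f (Φ y)) :
    IsSingularZero g x ↔ IsSingularZero f (Φ x) := by
  have h1 : fderiv ℂ g x = (fderiv ℂ f (Φ x)).comp (fderiv ℂ Φ x) := by
    rw [Filter.EventuallyEq.fderiv_eq hg]
    exact fderiv_comp x hf hΦ
  unfold IsSingularZero
  rw [h1, hg.self_of_nhds]
  refine and_congr_right fun _ => ⟨fun h => ?_, fun h => by rw [h]; simp⟩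
  ext1 w
  obtain ⟨v, rfl⟩ := hsurj w
  exact DFunLike.congr_fun h v

/-- At a zero of `f ∘ Φ` the term with the derivative of `B` disappears, so the differential of `g`
is that of `f` composed with the surjection `dΦ` and the invertible matrix `B`. -/
theorem isSingularPoint_mulVec_comp_iff {p q : ℕ} {f g : (Fin p → ℂ) → (Fin q → ℂ)}
    {Φ : (Fin p → ℂ) → (Fin p → ℂ)} {B : (Fin p → ℂ) → Matrix (Fin q) (Fin q) ℂ} {x : Fin p → ℂ}
    (hf : DifferentiableAt ℂ f (Φ x)) (hΦ : DifferentiableAt ℂ Φ x)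
    (hsurj : Function.Surjective (fderiv ℂ Φ x))
    (hB : ∀ i j, DifferentiableAt ℂ (fun y => B y i j) x) (hdet : IsUnit (B x).det)
    (hg : ∀ᶠ y in 𝓝 x, g y = (B y).mulVec (f (Φ y))) :
    IsSingularPoint g x ↔ IsSingularPoint f (Φ x) := by
  have hB1 := Matrix.mul_nonsing_inv _ hdet
  have hB2 := Matrix.nonsing_inv_mul _ hdet
  have hzero : g x = 0 ↔ f (Φ x) = 0 := by
    rw [hg.self_of_nhds]
    constructor
    · intro h
      have := congrArg ((B x)⁻¹.mulVec) h
      simpa [Matrix.mulVec_mulVec, hB2] using this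
    · intro h
      rw [h, Matrix.mulVec_zero]
  unfold IsSingularPoint
  rw [hzero]
  refine and_congr_right fun h0 => not_congr ?_
  have hd : ∀ v, fderiv ℂ g x v = (B x).mulVec (fderiv ℂ f (Φ x) (fderiv ℂ Φ x v)) := by
    intro v
    have hk : HasFDerivAt (fun y => f (Φ y)) ((fderiv ℂ f (Φ x)).comp (fderiv ℂ Φ x)) x :=
      hf.hasFDerivAt.comp x hΦ.hasFDerivAt
    have hi : ∀ i, HasFDerivAt (fun y => g y i)
        (∑ j, ((B x i j) • ((ContinuousLinearMap.proj (R := ℂ) (φ := fun _ : Fin q => ℂ) j).comp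
          ((fderiv ℂ f (Φ x)).comp (fderiv ℂ Φ x))) +
          (f (Φ x) j) • fderiv ℂ (fun y => B y i j) x)) x := by
      intro i
      have : (fun y => g y i) =ᶠ[𝓝 x] fun y => ∑ j, B y i j * f (Φ y) j := by
        filter_upwards [hg] with y hy
        rw [hy]
        rfl
      refine HasFDerivAt.congr_of_eventuallyEq ?_ this
      exact HasFDerivAt.fun_sum fun j _ => (hB i j).hasFDerivAt.mul (hasFDerivAt_pi'.1 hk j)
    rw [(hasFDerivAt_pi.2 hi).fderiv]
    ext i
    simp [h0, Matrix.mulVec, dotProduct]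
  constructor
  · intro h w
    obtain ⟨v, hv⟩ := h ((B x).mulVec w)
    refine ⟨fderiv ℂ Φ x v, ?_⟩
    rw [hd] at hv
    have := congrArg ((B x)⁻¹.mulVec) hv
    simpa [Matrix.mulVec_mulVec, hB2] using this
  · intro h w
    obtain ⟨v', hv'⟩ := h ((B x)⁻¹.mulVec w)
    obtain ⟨v, rfl⟩ := hsurj v'
    refine ⟨v, ?_⟩
    rw [hd, hv']
    simp [Matrix.mulVec_mulVec, hB1]

end

noncomputable section

/-! ## The ring of germs of analytic functions -/

/-- The subring of germs at the origin of analytic functions. -/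
def analyticGermSubring (E : Type*) [NormedAddCommGroup E] [NormedSpace ℂ E] :
    Subring (Germ (𝓝 (0 : E)) ℂ) where
  carrier := {g | ∃ f : E → ℂ, AnalyticAt ℂ f 0 ∧ (f : Germ (𝓝 (0 : E)) ℂ) = g}
  mul_mem' := by
    rintro _ _ ⟨f, hf, rfl⟩ ⟨g, hg, rfl⟩
    exact ⟨f * g, hf.mul hg, rfl⟩
  one_mem' := ⟨1, analyticAt_const, rfl⟩
  add_mem' := by
    rintro _ _ ⟨f, hf, rfl⟩ ⟨g, hg, rfl⟩
    exact ⟨f + g, hf.add hg, rfl⟩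
  zero_mem' := ⟨0, analyticAt_const, rfl⟩
  neg_mem' := by
    rintro _ ⟨f, hf, rfl⟩
    exact ⟨-f, hf.neg, rfl⟩

/-- The ring of germs at the origin of analytic functions. -/
def AnalyticGerm (E : Type*) [NormedAddCommGroup E] [NormedSpace ℂ E] : Type _ :=
  analyticGermSubring E

instance {E : Type*} [NormedAddCommGroup E] [NormedSpace ℂ E] : CommRing (AnalyticGerm E) :=
  inferInstanceAs (CommRing (analyticGermSubring E))

namespace AnalyticGerm

variable {E F : Type*} [NormedAddCommGroup E] [NormedSpace ℂ E] [NormedAddCommGroup F]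
  [NormedSpace ℂ F]

/-- The germ of a function. -/
def of (f : E → ℂ) (hf : AnalyticAt ℂ f 0) : AnalyticGerm E := ⟨f, f, hf, rfl⟩

theorem of_eq_of_iff {f g : E → ℂ} {hf : AnalyticAt ℂ f 0} {hg : AnalyticAt ℂ g 0} :
    of f hf = of g hg ↔ f =ᶠ[𝓝 0] g :=
  Subtype.ext_iff.trans Germ.coe_eq

theorem exists_of (a : AnalyticGerm E) : ∃ f hf, a = of f hf := by
  obtain ⟨_, f, hf, rfl⟩ := a
  exact ⟨f, hf, rfl⟩

/-- Constant germs. -/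
def const : ℂ →+* AnalyticGerm E :=
  ((Germ.coeRingHom (𝓝 (0 : E))).comp (Pi.constRingHom E ℂ)).codRestrict (analyticGermSubring E)
    fun c => ⟨fun _ => c, analyticAt_const, rfl⟩

/-- The value of a germ at the origin. -/
def value : AnalyticGerm E →+* ℂ := Germ.valueRingHom.comp (analyticGermSubring E).subtype

@[simp] theorem value_const (c : ℂ) : value (const c : AnalyticGerm E) = c := rfl

/-- The germ of a linear function. -/
def lin (L : E →L[ℂ] ℂ) : AnalyticGerm E := of L (L.analyticAt 0)

@[simp] theorem value_lin (L : E →L[ℂ] ℂ) : value (lin L) = 0 := L.map_zero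

/-- Pullback of germs along a linear map. -/
def pullback (L : E →L[ℂ] F) : AnalyticGerm F →+* AnalyticGerm E where
  toFun a := ⟨(a.1 : Germ (𝓝 (0 : F)) ℂ).compTendsto L (L.continuous.tendsto' 0 0 L.map_zero), by
    obtain ⟨_, f, hf, rfl⟩ := a
    exact ⟨f ∘ L, AnalyticAt.comp (by rwa [L.map_zero]) (L.analyticAt 0), rfl⟩⟩
  map_one' := rfl
  map_zero' := rfl
  map_mul' := by
    rintro ⟨_, f, hf, rfl⟩ ⟨_, g, hg, rfl⟩
    rfl
  map_add' := by
    rintro ⟨_, f, hf, rfl⟩ ⟨_, g, hg, rfl⟩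
    rfl

@[simp] theorem pullback_const (L : E →L[ℂ] F) (c : ℂ) : pullback L (const c) = const c := rfl

@[simp] theorem pullback_lin (L : E →L[ℂ] F) (l : F →L[ℂ] ℂ) :
    pullback L (lin l) = lin (l.comp L) := rfl

@[simp] theorem value_pullback (L : E →L[ℂ] F) (a : AnalyticGerm F) :
    value (pullback L a) = value a := by
  obtain ⟨f, hf, rfl⟩ := exists_of a
  exact congrArg f L.map_zero

/-- Directional derivative of germs. -/
def derivGerm (e : E) (a : Germ (𝓝 (0 : E)) ℂ) : Germ (𝓝 (0 : E)) ℂ :=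
  Quotient.map' (fun f x => fderiv ℂ f x e)
    (fun _ _ h => (Filter.EventuallyEq.fderiv h).mono fun x hx => by
      change fderiv ℂ _ x e = fderiv ℂ _ x e
      rw [hx]) a

theorem derivGerm_mem (e : E) (a : AnalyticGerm E) : derivGerm e a.1 ∈ analyticGermSubring E := by
  obtain ⟨_, f, hf, rfl⟩ := a
  exact ⟨fun x => fderiv ℂ f x e, AnalyticAt.comp (g := fun l : E →L[ℂ] ℂ => l e)
    ((ContinuousLinearMap.apply ℂ ℂ e).analyticAt _) (AnalyticAt.fderiv hf), rfl⟩

/-- Directional derivative as a derivation of the ring of analytic germs. -/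
def pd (e : E) : Derivation ℤ (AnalyticGerm E) (AnalyticGerm E) :=
  Derivation.mk' (AddMonoidHom.toIntLinearMap
    { toFun := fun a => ⟨derivGerm e a.1, derivGerm_mem e a⟩
      map_zero' := by
        refine Subtype.ext (Germ.coe_eq.2 (Eventually.of_forall fun x => ?_))
        change fderiv ℂ (fun _ => (0 : ℂ)) x e = 0
        simp
      map_add' := by
        rintro ⟨_, f, hf, rfl⟩ ⟨_, g, hg, rfl⟩
        refine Subtype.ext (Germ.coe_eq.2 ?_)
        filter_upwards [hf.eventually_analyticAt, hg.eventually_analyticAt] with x hfx hgx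
        change fderiv ℂ (f + g) x e = fderiv ℂ f x e + fderiv ℂ g x e
        rw [fderiv_add hfx.differentiableAt hgx.differentiableAt]
        rfl })
    (by
      rintro ⟨_, f, hf, rfl⟩ ⟨_, g, hg, rfl⟩
      refine Subtype.ext (Germ.coe_eq.2 ?_)
      filter_upwards [hf.eventually_analyticAt, hg.eventually_analyticAt] with x hfx hgx
      change fderiv ℂ (f * g) x e = f x * fderiv ℂ g x e + g x * fderiv ℂ f x e
      rw [fderiv_mul hfx.differentiableAt hgx.differentiableAt]
      rfl)

@[simp] theorem pd_const (e : E) (c : ℂ) : pd e (const c) = 0 := by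
  refine Subtype.ext (Germ.coe_eq.2 (Eventually.of_forall fun x => ?_))
  change fderiv ℂ (fun _ => c) x e = 0
  simp

@[simp] theorem pd_lin (e : E) (L : E →L[ℂ] ℂ) : pd e (lin L) = const (L e) := by
  refine Subtype.ext (Germ.coe_eq.2 (Eventually.of_forall fun x => ?_))
  change fderiv ℂ L x e = L e
  simp

/-- The coordinate germ in one variable. -/
def var : AnalyticGerm ℂ := lin (ContinuousLinearMap.id ℂ ℂ)

@[simp] theorem value_var : value var = 0 := value_lin _

/-- The factor can be divided out off the origin, and analytic functions that agree on a punctured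
neighbourhood have equal germs. -/
theorem var_mul_cancel {a b : AnalyticGerm ℂ} (h : var * a = var * b) : a = b := by
  obtain ⟨f, hf, rfl⟩ := exists_of a
  obtain ⟨g, hg, rfl⟩ := exists_of b
  refine of_eq_of_iff.2 ((hf.frequently_eq_iff_eventually_eq hg).1 ?_)
  have h1 : ∀ᶠ x : ℂ in 𝓝 0, x * f x = x * g x := Germ.coe_eq.1 (Subtype.ext_iff.1 h)
  refine Eventually.frequently ?_
  filter_upwards [h1.filter_mono nhdsWithin_le_nhds, self_mem_nhdsWithin] with x hx hx0
  exact mul_left_cancel₀ hx0 hx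

theorem var_pow_mul_cancel {a b : AnalyticGerm ℂ} {n : ℕ} (h : var ^ n * a = var ^ n * b) :
    a = b := by
  induction n with
  | zero => simpa using h
  | succ n ih =>
    refine ih (var_mul_cancel ?_)
    rw [← mul_assoc, ← mul_assoc, ← pow_succ', h]

/-- A polynomial divisible by the `m`-th power of the variable as a germ has no terms of degree
less than `m`. -/
theorem coeff_eq_zero_of_eval₂_eq {p : Polynomial ℂ} {m : ℕ} {h : AnalyticGerm ℂ}
    (hp : p.eval₂ const var = var ^ m * h) {i : ℕ} (hi : i < m) : p.coeff i = 0 := by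
  induction m generalizing p i with
  | zero => omega
  | succ m ih =>
    -- The value at the origin gives the constant term; then one factor of the variable is
    -- cancelled, with `divX` in place of `p`.
    have h0 : p.coeff 0 = 0 := by
      have := congrArg value hp
      rw [← Polynomial.divX_mul_X_add p] at this
      simpa [pow_succ] using this
    cases i with
    | zero => exact h0
    | succ i =>
      have h1 : p.divX.eval₂ const var = var ^ m * h := by
        refine var_mul_cancel ?_
        rw [← Polynomial.divX_mul_X_add p, h0] at hp
        simp only [map_zero, add_zero, Polynomial.eval₂_mul, Polynomial.eval₂_X] at hp
        rw [mul_comm, hp, pow_succ]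
        ring
      simpa using ih h1 (i := i) (by omega)

/-- Germs of coordinate functions. -/
def coord {n : ℕ} (i : Fin n) : AnalyticGerm (Fin n → ℂ) := lin (ContinuousLinearMap.proj i)

/-- Partial derivatives of germs. -/
abbrev partialD {n : ℕ} (i : Fin n) :
    Derivation ℤ (AnalyticGerm (Fin n → ℂ)) (AnalyticGerm (Fin n → ℂ)) := pd (Pi.single i 1)

/-- Restriction of germs to a coordinate axis. -/
abbrev axis {n : ℕ} (i : Fin n) : AnalyticGerm (Fin n → ℂ) →+* AnalyticGerm ℂ :=
  pullback (ContinuousLinearMap.single ℂ (fun _ => ℂ) i)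

@[simp] theorem value_coord {n : ℕ} (i : Fin n) : value (coord i) = 0 := value_lin _

@[simp] theorem partialD_coord_self {n : ℕ} (i : Fin n) : partialD i (coord i) = 1 := by
  rw [coord, pd_lin]
  simp

theorem partialD_coord_of_ne {n : ℕ} {i j : Fin n} (h : j ≠ i) : partialD i (coord j) = 0 := by
  rw [coord, pd_lin]
  simp [h]

@[simp] theorem axis_coord_self {n : ℕ} (i : Fin n) : axis i (coord i) = var := by
  rw [coord, pullback_lin, var]
  congr 1
  ext
  simp

theorem axis_coord_of_ne {n : ℕ} {i j : Fin n} (h : j ≠ i) : axis i (coord j) = 0 := by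
  rw [coord, pullback_lin, show (0 : AnalyticGerm ℂ) = lin 0 from rfl]
  congr 1
  ext
  simp [h]

theorem analyticAt_eval_lin (p : Polynomial ℂ) (L : E →L[ℂ] ℂ) (x : E) :
    AnalyticAt ℂ (fun x => p.eval (L x)) x := by
  have h := (L.analyticAt x).aeval_polynomial p
  simpa using h

/-- Turns a polynomial identity between values of functions near the origin into an identity in the
ring of germs, where it can be differentiated and restricted to axes. -/
theorem eval₂_const_lin (p : Polynomial ℂ) (L : E →L[ℂ] ℂ) :
    p.eval₂ const (lin L) = of (fun x => p.eval (L x)) (analyticAt_eval_lin p L 0) := by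
  induction p using Polynomial.induction_on' with
  | add p q hp hq =>
    rw [Polynomial.eval₂_add, hp, hq]
    exact Subtype.ext (Germ.coe_eq.2 (Eventually.of_forall fun x => by simp))
  | monomial n a =>
    rw [Polynomial.eval₂_monomial]
    exact Subtype.ext (Germ.coe_eq.2 (Eventually.of_forall fun x => by simp))

end AnalyticGerm

end

noncomputable section

/-! ## Tangent vectors to orbits -/

/-- The velocity at the zero parameter, in the direction `v`, of a family of coordinate changes. -/
def velocity {s l : ℕ} {W : Type*} [NormedAddCommGroup W] [NormedSpace ℂ W]
    (Φ : (Fin s → ℂ) → (Fin l → ℂ) → W) (v : Fin l → ℂ) (u : Fin s → ℂ) : W :=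
  fderiv ℂ (fun p : (Fin s → ℂ) × (Fin l → ℂ) => Φ p.1 p.2) (u, 0) (0, v)

theorem analyticAt_velocity {s l : ℕ} {W : Type*} [NormedAddCommGroup W] [NormedSpace ℂ W]
    [CompleteSpace W] {Φ : (Fin s → ℂ) → (Fin l → ℂ) → W}
    (hΦ : AnalyticAt ℂ (fun p : (Fin s → ℂ) × (Fin l → ℂ) => Φ p.1 p.2) 0) (v : Fin l → ℂ) :
    AnalyticAt ℂ (velocity Φ v) 0 := by
  have h1 : AnalyticAt ℂ (fun u : Fin s → ℂ => (u, (0 : Fin l → ℂ))) 0 :=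
    analyticAt_id.prod analyticAt_const
  have h2 := AnalyticAt.comp (g := fderiv ℂ (fun p : (Fin s → ℂ) × (Fin l → ℂ) => Φ p.1 p.2))
    (f := fun u : Fin s → ℂ => (u, (0 : Fin l → ℂ))) (x := 0) (AnalyticAt.fderiv hΦ) h1
  exact AnalyticAt.comp (g := fun L : ((Fin s → ℂ) × (Fin l → ℂ)) →L[ℂ] W => L (0, v))
    ((ContinuousLinearMap.apply ℂ W ((0, v) : (Fin s → ℂ) × (Fin l → ℂ))).analyticAt _) h2

theorem eventually_prodMk_zero {E T : Type*} [NormedAddCommGroup E] [NormedAddCommGroup T]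
    {P : E × T → Prop} (hP : ∀ᶠ p in 𝓝 0, P p) : ∀ᶠ u in 𝓝 (0 : E), P (u, 0) :=
  eventually_comp_of_map_zero (by fun_prop) rfl hP

theorem hasDerivAt_velocity {s l : ℕ} {W : Type*} [NormedAddCommGroup W] [NormedSpace ℂ W]
    {Φ : (Fin s → ℂ) → (Fin l → ℂ) → W} {u : Fin s → ℂ}
    (hΦ : DifferentiableAt ℂ (fun p : (Fin s → ℂ) × (Fin l → ℂ) => Φ p.1 p.2) (u, 0))
    (v : Fin l → ℂ) : HasDerivAt (fun ε : ℂ => Φ u (ε • v)) (velocity Φ v u) 0 := by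
  have h1 : HasDerivAt (fun ε : ℂ => (u, ε • v)) ((0 : Fin s → ℂ), v) 0 :=
    (hasDerivAt_const _ _).prodMk (by simpa using (hasDerivAt_id (0 : ℂ)).smul_const v)
  refine HasFDerivAt.comp_hasDerivAt
    (l := fun p : (Fin s → ℂ) × (Fin l → ℂ) => Φ p.1 p.2) (f := fun ε : ℂ => (u, ε • v)) 0 ?_ h1
  simpa using hΦ.hasFDerivAt

/-- The velocity of a deformation pulled back along a change of bases with vanishing velocity is
the derivative of the undeformed germ along the velocity of the coordinate changes. -/
theorem eventually_hasDerivAt_pullback {s m l : ℕ} {F : (Fin s → ℂ) → (Fin m → ℂ) → ℂ}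
    {M : (Fin s → ℂ) → ℂ}
    (hF : AnalyticAt ℂ (fun p : (Fin s → ℂ) × (Fin m → ℂ) => F p.1 p.2) 0)
    (hM : ∀ᶠ u in 𝓝 (0 : Fin s → ℂ), F u 0 = M u)
    {Φ : (Fin s → ℂ) → (Fin l → ℂ) → (Fin s → ℂ)} {ψ : (Fin l → ℂ) → (Fin m → ℂ)}
    (hΦ : IsCoordinateChange Φ) (hψ : IsBaseChange ψ) {v : Fin l → ℂ}
    (hv : fderiv ℂ ψ 0 v = 0) :
    ∀ᶠ u in 𝓝 (0 : Fin s → ℂ), F (Φ u 0) (ψ 0) = M u ∧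
      HasDerivAt (fun ε : ℂ => F (Φ u (ε • v)) (ψ (ε • v))) (fderiv ℂ M u (velocity Φ v u)) 0 := by
  filter_upwards [eventually_prodMk_zero hF.eventually_analyticAt,
    eventually_prodMk_zero hΦ.1.eventually_analyticAt, hΦ.2, hM.eventually_nhds] with u h1 h2 h3 h4
  refine ⟨by rw [h3, hψ.2, h4.self_of_nhds], ?_⟩
  have e1 := hasDerivAt_velocity h2.differentiableAt v
  -- This is where `dψ v = 0` enters: to first order the parameter of `F` stays at zero, so only the
  -- motion of the source point contributes.
  have e2 : HasDerivAt (fun ε : ℂ => ψ (ε • v)) 0 0 := by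
    rw [← hv]
    refine HasFDerivAt.comp_hasDerivAt (l := ψ) (f := fun ε : ℂ => ε • v) 0 ?_
      (by simpa using (hasDerivAt_id (0 : ℂ)).smul_const v)
    simpa using hψ.1.differentiableAt.hasFDerivAt
  have e3 : HasFDerivAt (fun p : (Fin s → ℂ) × (Fin m → ℂ) => F p.1 p.2)
      (fderiv ℂ (fun p : (Fin s → ℂ) × (Fin m → ℂ) => F p.1 p.2) (u, 0))
      (Φ u ((0 : ℂ) • v), ψ ((0 : ℂ) • v)) := by
    simpa [h3, hψ.2] using h1.differentiableAt.hasFDerivAt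
  have e4 := HasFDerivAt.comp_hasDerivAt
    (l := fun p : (Fin s → ℂ) × (Fin m → ℂ) => F p.1 p.2)
    (f := fun ε : ℂ => (Φ u (ε • v), ψ (ε • v))) 0 e3 (e1.prodMk e2)
  have e5 : HasFDerivAt (fun u' : Fin s → ℂ => F u' 0)
      ((fderiv ℂ (fun p : (Fin s → ℂ) × (Fin m → ℂ) => F p.1 p.2) (u, 0)).comp
        (ContinuousLinearMap.inl ℂ _ _)) u :=
    HasFDerivAt.comp (g := fun p : (Fin s → ℂ) × (Fin m → ℂ) => F p.1 p.2)
      (f := fun u' : Fin s → ℂ => (u', (0 : Fin m → ℂ))) u h1.differentiableAt.hasFDerivAt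
      (hasFDerivAt_prodMk_left u 0)
  have e6 : fderiv ℂ M u = (fderiv ℂ (fun p : (Fin s → ℂ) × (Fin m → ℂ) => F p.1 p.2) (u, 0)).comp
        (ContinuousLinearMap.inl ℂ _ _) :=
    (e5.congr_of_eventuallyEq (h4.mono fun x hx => hx.symm)).fderiv
  rw [e6]
  exact e4

/-- The deformation `G` is infinitesimally trivial, in the direction `v`, for `SL`-equivalence. -/
def IsSLTrivialAlong {s n m : ℕ} (M : (Fin s → ℂ) → Matrix (Fin n) (Fin n) ℂ)
    (G : (Fin s → ℂ) → (Fin m → ℂ) → Matrix (Fin n) (Fin n) ℂ) (v : Fin m → ℂ) : Prop :=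
  ∃ (ξ : Fin s → (Fin s → ℂ) → ℂ) (a : Fin n → Fin n → (Fin s → ℂ) → ℂ),
    (∀ j, AnalyticAt ℂ (ξ j) 0) ∧ (∀ i j, AnalyticAt ℂ (a i j) 0) ∧ ∀ᶠ u in 𝓝 0,
    ∀ i j, HasDerivAt (fun ε : ℂ => G u (ε • v) i j)
      (fderiv ℂ (fun y => M y i j) u (fun j => ξ j u) +
        ∑ k, (a k i u * M u k j + M u i k * a k j u)) 0

/-- The deformation `G` is infinitesimally trivial, in the direction `v`, for right equivalence. -/
def IsRTrivialAlong {p m : ℕ} (f : (Fin p → ℂ) → ℂ) (G : (Fin p → ℂ) → (Fin m → ℂ) → ℂ)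
    (v : Fin m → ℂ) : Prop :=
  ∃ ξ : Fin p → (Fin p → ℂ) → ℂ, (∀ j, AnalyticAt ℂ (ξ j) 0) ∧ ∀ᶠ x in 𝓝 0,
    HasDerivAt (fun ε : ℂ => G x (ε • v)) (fderiv ℂ f x fun j => ξ j x) 0

/-- The deformation `G` is infinitesimally trivial, in the direction `v`, for contact
equivalence. -/
def IsKTrivialAlong {p q m : ℕ} (g : (Fin p → ℂ) → (Fin q → ℂ))
    (G : (Fin p → ℂ) → (Fin m → ℂ) → (Fin q → ℂ)) (v : Fin m → ℂ) : Prop :=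
  ∃ (ξ : Fin p → (Fin p → ℂ) → ℂ) (b : Fin q → Fin q → (Fin p → ℂ) → ℂ),
    (∀ j, AnalyticAt ℂ (ξ j) 0) ∧ (∀ i j, AnalyticAt ℂ (b i j) 0) ∧ ∀ᶠ x in 𝓝 0, ∀ i,
    HasDerivAt (fun ε : ℂ => G x (ε • v) i)
      (fderiv ℂ (fun y => g y i) x (fun j => ξ j x) + ∑ j, b i j x * g x j) 0

/-- Differentiating the induced family along `v` leaves only the velocity of the coordinate changes,
since the change of bases has velocity zero. -/
theorem exists_tangent_of_ROddInduced {p m l : ℕ} {f : (Fin p → ℂ) → ℂ}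
    {F : (Fin p → ℂ) → (Fin m → ℂ) → ℂ} (hF : IsOddDeformation f F)
    {G : (Fin p → ℂ) → (Fin l → ℂ) → ℂ} {Φ : (Fin p → ℂ) → (Fin l → ℂ) → (Fin p → ℂ)}
    {ψ : (Fin l → ℂ) → (Fin m → ℂ)} (hΦ : IsCoordinateChange Φ) (hψ : IsBaseChange ψ)
    (hG : ∀ᶠ z in 𝓝 (0 : (Fin p → ℂ) × (Fin l → ℂ)), G z.1 z.2 = F (Φ z.1 z.2) (ψ z.2))
    {v : Fin l → ℂ} (hv : fderiv ℂ ψ 0 v = 0) :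
    IsRTrivialAlong f G v := by
  refine ⟨fun j x => velocity Φ v x j, fun j => ?_, ?_⟩
  · exact (analyticAt_pi_iff.1 (analyticAt_velocity hΦ.1 v)) j
  · filter_upwards [eventually_hasDerivAt_pullback hF.1 hF.2.2 hΦ hψ hv,
      eventually_prodMk_zero hG.eventually_nhds] with x h1 h2
    refine h1.2.congr_of_eventuallyEq ?_
    have : Tendsto (fun ε : ℂ => (x, ε • v)) (𝓝 0) (𝓝 (x, 0)) :=
      Continuous.tendsto' (by fun_prop) _ _ (by simp)
    exact this.eventually h2

/-- As for right equivalence, with the extra term from the velocity of `B`; the matrix itself is the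
identity at the zero parameter. -/
theorem exists_tangent_of_KOddInduced {p q m l : ℕ} {g : (Fin p → ℂ) → (Fin q → ℂ)}
    {F : (Fin p → ℂ) → (Fin m → ℂ) → (Fin q → ℂ)} (hF : IsEvenDeformation g F)
    {G : (Fin p → ℂ) → (Fin l → ℂ) → (Fin q → ℂ)}
    {Φ : (Fin p → ℂ) → (Fin l → ℂ) → (Fin p → ℂ)} {ψ : (Fin l → ℂ) → (Fin m → ℂ)}
    {B : (Fin p → ℂ) → (Fin l → ℂ) → Matrix (Fin q) (Fin q) ℂ}
    (hΦ : IsCoordinateChange Φ) (hψ : IsBaseChange ψ) (hB : IsMatrixChange B)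
    (hG : ∀ᶠ z in 𝓝 (0 : (Fin p → ℂ) × (Fin l → ℂ)),
      G z.1 z.2 = (B z.1 z.2).mulVec (F (Φ z.1 z.2) (ψ z.2)))
    {v : Fin l → ℂ} (hv : fderiv ℂ ψ 0 v = 0) :
    IsKTrivialAlong g G v := by
  refine ⟨fun j x => velocity Φ v x j, fun i j => velocity (fun x t => B x t i j) v, fun j => ?_,
    fun i j => analyticAt_velocity (hB.1 i j) v, ?_⟩
  · exact (analyticAt_pi_iff.1 (analyticAt_velocity hΦ.1 v)) j
  · have hFi : ∀ i, ∀ᶠ x in 𝓝 (0 : Fin p → ℂ), F (Φ x 0) (ψ 0) i = g x i ∧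
        HasDerivAt (fun ε : ℂ => F (Φ x (ε • v)) (ψ (ε • v)) i)
          (fderiv ℂ (fun y => g y i) x (velocity Φ v x)) 0 := fun i =>
      eventually_hasDerivAt_pullback (F := fun x t => F x t i) (M := fun x => g x i)
        (analyticAt_pi_iff.1 hF.1 i) (hF.2.2.mono fun x hx => by rw [hx]) hΦ hψ hv
    have hBi : ∀ᶠ x in 𝓝 (0 : Fin p → ℂ), ∀ i j, HasDerivAt (fun ε : ℂ => B x (ε • v) i j)
        (velocity (fun x t => B x t i j) v x) 0 := by
      simp only [eventually_all]
      intro i j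
      filter_upwards [eventually_prodMk_zero (hB.1 i j).eventually_analyticAt] with x hx
      exact hasDerivAt_velocity (Φ := fun x t => B x t i j) hx.differentiableAt v
    filter_upwards [eventually_all.2 hFi, hBi, hB.2, eventually_prodMk_zero hG.eventually_nhds]
      with x h1 h2 h3 h4 i
    have h5 : HasDerivAt (fun ε : ℂ => ∑ j, B x (ε • v) i j * F (Φ x (ε • v)) (ψ (ε • v)) j)
        (∑ j, (velocity (fun x t => B x t i j) v x * F (Φ x ((0 : ℂ) • v)) (ψ ((0 : ℂ) • v)) j +
          B x ((0 : ℂ) • v) i j * fderiv ℂ (fun y => g y j) x (velocity Φ v x))) 0 :=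
      HasDerivAt.fun_sum fun j _ => (h2 i j).mul (h1 j).2
    have h6 : ∑ j, (velocity (fun x t => B x t i j) v x *
        F (Φ x ((0 : ℂ) • v)) (ψ ((0 : ℂ) • v)) j +
          B x ((0 : ℂ) • v) i j * fderiv ℂ (fun y => g y j) x (velocity Φ v x)) =
        fderiv ℂ (fun y => g y i) x (velocity Φ v x) +
          ∑ j, velocity (fun x t => B x t i j) v x * g x j := by
      simp only [zero_smul, h3, Finset.sum_add_distrib, (h1 _).1, Matrix.one_apply, ite_mul,
        one_mul, zero_mul, Finset.sum_ite_eq, Finset.mem_univ, if_true]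
      rw [add_comm]
    rw [h6] at h5
    refine h5.congr_of_eventuallyEq ?_
    have : Tendsto (fun ε : ℂ => (x, ε • v)) (𝓝 0) (𝓝 (x, 0)) :=
      Continuous.tendsto' (by fun_prop) _ _ (by simp)
    filter_upwards [this.eventually h4] with ε hε
    rw [hε]
    rfl

/-- The product rule for `Aᵀ F A` at a parameter where `A` is the identity. The velocity of `A` is
kept as an arbitrary matrix, with no trace condition. -/
theorem exists_tangent_of_SLInduced {s n m l : ℕ} {M : (Fin s → ℂ) → Matrix (Fin n) (Fin n) ℂ}
    {F : (Fin s → ℂ) → (Fin m → ℂ) → Matrix (Fin n) (Fin n) ℂ} (hF : IsSymmDeformation M F)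
    {G : (Fin s → ℂ) → (Fin l → ℂ) → Matrix (Fin n) (Fin n) ℂ}
    {Φ : (Fin s → ℂ) → (Fin l → ℂ) → (Fin s → ℂ)} {ψ : (Fin l → ℂ) → (Fin m → ℂ)}
    {A : (Fin s → ℂ) → (Fin l → ℂ) → Matrix (Fin n) (Fin n) ℂ}
    (hΦ : IsCoordinateChange Φ) (hψ : IsBaseChange ψ) (hA : IsMatrixChange A)
    (hG : ∀ᶠ p in 𝓝 (0 : (Fin s → ℂ) × (Fin l → ℂ)),
      G p.1 p.2 = (A p.1 p.2).transpose * F (Φ p.1 p.2) (ψ p.2) * A p.1 p.2)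
    {v : Fin l → ℂ} (hv : fderiv ℂ ψ 0 v = 0) :
    IsSLTrivialAlong M G v := by
  refine ⟨fun j x => velocity Φ v x j, fun i j => velocity (fun x t => A x t i j) v, fun j => ?_,
    fun i j => analyticAt_velocity (hA.1 i j) v, ?_⟩
  · exact (analyticAt_pi_iff.1 (analyticAt_velocity hΦ.1 v)) j
  · have hFi : ∀ i j, ∀ᶠ x in 𝓝 (0 : Fin s → ℂ), F (Φ x 0) (ψ 0) i j = M x i j ∧
        HasDerivAt (fun ε : ℂ => F (Φ x (ε • v)) (ψ (ε • v)) i j)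
          (fderiv ℂ (fun y => M y i j) x (velocity Φ v x)) 0 := fun i j =>
      eventually_hasDerivAt_pullback (F := fun x t => F x t i j) (M := fun x => M x i j)
        (hF.1 i j) (hF.2.2.mono fun x hx => by rw [hx]) hΦ hψ hv
    have hAi : ∀ᶠ x in 𝓝 (0 : Fin s → ℂ), ∀ i j, HasDerivAt (fun ε : ℂ => A x (ε • v) i j)
        (velocity (fun x t => A x t i j) v x) 0 := by
      simp only [eventually_all]
      intro i j
      filter_upwards [eventually_prodMk_zero (hA.1 i j).eventually_analyticAt] with x hx
      exact hasDerivAt_velocity (Φ := fun x t => A x t i j) hx.differentiableAt v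
    filter_upwards [eventually_all.2 fun i => eventually_all.2 (hFi i), hAi, hA.2,
      eventually_prodMk_zero hG.eventually_nhds] with x h1 h2 h3 h4
    have hlim : Tendsto (fun ε : ℂ => (x, ε • v)) (𝓝 0) (𝓝 (x, 0)) :=
      Continuous.tendsto' (by fun_prop) _ _ (by simp)
    have hA' : HasMatrixDerivAt (fun ε : ℂ => A x (ε • v))
        (Matrix.of fun i j => velocity (fun x t => A x t i j) v x) 0 := h2
    have hF' : HasMatrixDerivAt (fun ε : ℂ => F (Φ x (ε • v)) (ψ (ε • v)))
        (matrixFDeriv M x (velocity Φ v x)) 0 := fun i j => (h1 i j).2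
    have hF0 : F (Φ x 0) (ψ 0) = M x := by
      ext i j
      exact (h1 i j).1
    have h8 := ((hA'.transpose.mul hF').mul hA').congr (δ := fun ε => G x (ε • v))
        (hlim.eventually h4)
    intro i j
    refine (h8 i j).congr_deriv ?_
    simp only [zero_smul, h3, hF0, Matrix.transpose_one, Matrix.one_mul, Matrix.mul_one,
      Matrix.add_apply, Matrix.mul_apply, Finset.sum_add_distrib, Matrix.transpose_apply,
      Matrix.of_apply, matrixFDeriv]
    ring

end

noncomputable section

/-! ## Independence of the monomial deformations modulo the tangent spaces -/

open AnalyticGerm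

theorem AnalyticGerm.axis_eval₂ {n : ℕ} (i : Fin n) (p : Polynomial ℂ) :
    axis i (p.eval₂ const (coord i)) = p.eval₂ const var := by
  rw [Polynomial.hom_eval₂, axis_coord_self]
  rfl

theorem AnalyticGerm.partialD_eval₂_of_ne {n : ℕ} {i j : Fin n} (h : j ≠ i)
    (p : Polynomial ℂ) : partialD i (p.eval₂ const (coord j)) = 0 := by
  induction p using Polynomial.induction_on' with
  | add p q hp hq => rw [Polynomial.eval₂_add, map_add, hp, hq, add_zero]
  | monomial n a =>
    rw [Polynomial.eval₂_monomial, Derivation.leibniz, Derivation.leibniz_pow,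
      partialD_coord_of_ne h, pd_const]
    simp

/-- Serves `II4` with `m = 1` and `II6` with `m = 2`. The two relations are what remains of the
entries `(0,1)` and `(0,2)` after the vector field has been eliminated; on the `w`-axis both
right-hand sides turn out to be divisible by `w^(m+1)`. -/
theorem matrix_independence_of_pow {m : ℕ} {P Q : Polynomial ℂ}
    {a : Fin 3 → Fin 3 → (Fin 4 → ℂ) → ℂ} (ha : ∀ i j, AnalyticAt ℂ (a i j) 0)
    (hP : ∀ᶠ u : Fin 4 → ℂ in 𝓝 0, P.eval (u 3) = (a 0 0 u + a 1 1 u) * u 3 ^ (m + 1) +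
      a 1 0 u * u 1 + a 2 0 u * u 2 + u 0 * a 0 1 u + u 1 * a 2 1 u -
      2 * ((m + 1 : ℕ) : ℂ) * u 3 ^ m * (a 0 2 u * u 1 + a 1 2 u * u 2 + a 2 2 u * u 3))
    (hQ : ∀ᶠ u : Fin 4 → ℂ in 𝓝 0, Q.eval (u 3) = a 0 0 u * u 1 + a 1 0 u * u 2 +
      a 2 0 u * u 3 + u 0 * a 0 2 u + u 3 ^ (m + 1) * a 1 2 u + u 1 * a 2 2 u -
      2 * a 0 1 u * u 3 ^ (m + 1) - 2 * a 1 1 u * u 1 - 2 * a 2 1 u * u 2) {i : ℕ}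
    (hi : i < m + 1) : P.coeff i = 0 ∧ Q.coeff i = 0 := by
  let A : Fin 3 → Fin 3 → AnalyticGerm (Fin 4 → ℂ) := fun i j => of (a i j) (ha i j)
  have eP : P.eval₂ const (coord 3) = (A 0 0 + A 1 1) * coord 3 ^ (m + 1) +
      A 1 0 * coord 1 + A 2 0 * coord 2 + coord 0 * A 0 1 + coord 1 * A 2 1 -
      const (2 * ((m + 1 : ℕ) : ℂ)) * coord 3 ^ m *
        (A 0 2 * coord 1 + A 1 2 * coord 2 + A 2 2 * coord 3) := by
    rw [coord, eval₂_const_lin]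
    exact Subtype.ext (Germ.coe_eq.2 hP)
  have eQ : Q.eval₂ const (coord 3) = A 0 0 * coord 1 + A 1 0 * coord 2 +
      A 2 0 * coord 3 + coord 0 * A 0 2 + coord 3 ^ (m + 1) * A 1 2 + coord 1 * A 2 2 -
      const 2 * A 0 1 * coord 3 ^ (m + 1) - const 2 * A 1 1 * coord 1 -
      const 2 * A 2 1 * coord 2 := by
    rw [coord, eval₂_const_lin]
    exact Subtype.ext (Germ.coe_eq.2 hQ)
  have e1 := congrArg (axis 3) eP
  have e2 := congrArg (axis 3) eQ
  -- On the `w`-axis the only term of the second relation not visibly divisible by `w^(m+1)` is `a 2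
  -- 0 · w`. The `z`-derivative of the first relation shows that `w^m` divides `a 2 0` there.
  have e3 := congrArg (fun g => axis 3 (partialD 2 g)) eP
  rw [axis_eval₂] at e1 e2
  simp only [partialD_eval₂_of_ne (show (3 : Fin 4) ≠ 2 by decide)] at e3
  simp [axis_coord_of_ne, partialD_coord_of_ne] at e1 e2 e3
  refine ⟨coeff_eq_zero_of_eval₂_eq (m := m + 1) (h := axis 3 (A 0 0) + axis 3 (A 1 1) -
    const 2 * ((m : AnalyticGerm ℂ) + 1) * axis 3 (A 2 2)) (by rw [e1]; ring) hi,
    coeff_eq_zero_of_eval₂_eq (m := m + 1) (h := const 2 * ((m : AnalyticGerm ℂ) + 1) *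
      (axis 3 (A 1 2) + var * axis 3 (partialD 2 (A 2 2))) -
      var * (axis 3 (partialD 2 (A 0 0)) + axis 3 (partialD 2 (A 1 1))) + axis 3 (A 1 2) -
      const 2 * axis 3 (A 0 1)) ?_ hi⟩
  rw [e2]
  linear_combination -var * e3

theorem matrix_independence_of_sq {v : Fin 5 → ℂ}
    {a : Fin 3 → Fin 3 → (Fin 4 → ℂ) → ℂ} (ha : ∀ i j, AnalyticAt ℂ (a i j) 0)
    (hP : ∀ᶠ u : Fin 4 → ℂ in 𝓝 0, v 2 * u 3 ^ 2 + v 1 * u 3 + v 0 =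
      a 1 0 u * u 1 + a 2 0 u * u 2 + u 0 * a 0 1 u + (u 1 + u 3 ^ 2) * a 2 1 u)
    (hQ : ∀ᶠ u : Fin 4 → ℂ in 𝓝 0, v 4 * u 3 + v 3 = (a 0 0 u + a 2 2 u) * (u 1 + u 3 ^ 2) +
      a 1 0 u * u 2 + a 2 0 u * u 3 + u 0 * a 0 2 u - 2 * a 1 1 u * u 1 - 2 * a 2 1 u * u 2 -
      4 * u 3 * (a 0 2 u * (u 1 + u 3 ^ 2) + a 1 2 u * u 2 + a 2 2 u * u 3)) : v = 0 := by
  let A : Fin 3 → Fin 3 → AnalyticGerm (Fin 4 → ℂ) := fun i j => of (a i j) (ha i j)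
  have eP : const (v 2) * coord 3 ^ 2 + const (v 1) * coord 3 + const (v 0) =
      A 1 0 * coord 1 + A 2 0 * coord 2 + coord 0 * A 0 1 + (coord 1 + coord 3 ^ 2) * A 2 1 :=
    Subtype.ext (Germ.coe_eq.2 hP)
  have eQ : const (v 4) * coord 3 + const (v 3) = (A 0 0 + A 2 2) * (coord 1 + coord 3 ^ 2) +
      A 1 0 * coord 2 + A 2 0 * coord 3 + coord 0 * A 0 2 - const 2 * A 1 1 * coord 1 -
      const 2 * A 2 1 * coord 2 - const 4 * coord 3 *
        (A 0 2 * (coord 1 + coord 3 ^ 2) + A 1 2 * coord 2 + A 2 2 * coord 3) :=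
    Subtype.ext (Germ.coe_eq.2 hQ)
  have e1 := congrArg (axis 3) eP
  have e2 := congrArg (axis 3) eQ
  have e3 := congrArg (fun g => axis 3 (partialD 2 g)) eP
  -- At the origin these two derivatives read `a 1 0 + a 2 1 = 0` and `a 1 0 - 2 a 2 1 = 0`, so `a 2
  -- 1` vanishes there. The first relation on the `w`-axis identifies `v 2` with that value, while
  -- the other four coordinates are killed by divisibility by `w²`.
  have e4 := congrArg (fun g => value (partialD 1 g)) eP
  have e5 := congrArg (fun g => value (partialD 2 g)) eQ
  simp [axis_coord_of_ne, partialD_coord_of_ne] at e1 e2 e3 e4 e5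
  have hA : value (A 2 1) = 0 := by linear_combination (1 / 3 : ℂ) * e5 - (1 / 3 : ℂ) * e4
  have h1 : ∀ i < 2, (Polynomial.C (v 2) * Polynomial.X ^ 2 + Polynomial.C (v 1) * Polynomial.X +
      Polynomial.C (v 0)).coeff i = 0 := fun i hi =>
    coeff_eq_zero_of_eval₂_eq (m := 2) (h := axis 3 (A 2 1)) (by simp [e1]) hi
  have h2 : ∀ i < 2, (Polynomial.C (v 4) * Polynomial.X + Polynomial.C (v 3)).coeff i = 0 :=
    fun i hi => coeff_eq_zero_of_eval₂_eq (m := 2) (h := axis 3 (A 0 0) + axis 3 (A 2 2) -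
      var * axis 3 (partialD 2 (A 2 1)) - const 4 * (axis 3 (A 0 2) * var + axis 3 (A 2 2)))
      (by simp; linear_combination e2 - var * e3) hi
  have h10 := h1 0 (by norm_num)
  have h11 := h1 1 (by norm_num)
  have h20 := h2 0 (by norm_num)
  have h21 := h2 1 (by norm_num)
  simp [Polynomial.coeff_X, Polynomial.coeff_C, Polynomial.coeff_X_pow] at h10 h11 h20 h21
  have h3 : const (v 2) = axis 3 (A 2 1) := by
    refine var_pow_mul_cancel (n := 2) ?_
    rw [h10, h11] at e1
    simp at e1
    rw [← e1, mul_comm]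
  have h4 : v 2 = 0 := by simpa [hA] using congrArg value h3
  ext i
  fin_cases i <;> assumption

/-- The constant is read off at the origin, where every term on the right vanishes; on the `x`-axis
the second relation makes `P` divisible by `x^k`. -/
theorem matrix_independence_of_series {k : ℕ} (hk : 1 ≤ k) {P : Polynomial ℂ} {c : ℂ}
    {a : Fin 3 → Fin 3 → (Fin 4 → ℂ) → ℂ} (ha : ∀ i j, AnalyticAt ℂ (a i j) 0)
    (hc : ∀ᶠ u : Fin 4 → ℂ in 𝓝 0, c = a 1 0 u * (u 1 + u 0 ^ k) + a 2 0 u * u 3 +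
      u 0 * a 0 1 u + u 2 * a 2 1 u)
    (hP : ∀ᶠ u : Fin 4 → ℂ in 𝓝 0, P.eval (u 0) = 2 * (a 1 1 u * (u 1 + u 0 ^ k) +
      a 2 1 u * u 3 - a 0 2 u * u 2 - a 1 2 u * u 3 - a 2 2 u * u 1 -
      k * u 0 ^ (k - 1) * (a 0 0 u * u 0 + a 2 0 u * u 2))) :
    c = 0 ∧ ∀ i < k, P.coeff i = 0 := by
  obtain ⟨k, rfl⟩ : ∃ l, k = l + 1 := ⟨k - 1, by omega⟩
  refine ⟨by simpa using hc.self_of_nhds, fun i hi => ?_⟩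
  let A : Fin 3 → Fin 3 → AnalyticGerm (Fin 4 → ℂ) := fun i j => of (a i j) (ha i j)
  have eP : P.eval₂ const (coord 0) = const 2 * (A 1 1 * (coord 1 + coord 0 ^ (k + 1)) +
      A 2 1 * coord 3 - A 0 2 * coord 2 - A 1 2 * coord 3 - A 2 2 * coord 1 -
      const ((k + 1 : ℕ) : ℂ) * coord 0 ^ k * (A 0 0 * coord 0 + A 2 0 * coord 2)) := by
    rw [coord, eval₂_const_lin]
    exact Subtype.ext (Germ.coe_eq.2 hP)
  have e1 := congrArg (axis 0) eP
  rw [axis_eval₂] at e1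
  simp [axis_coord_of_ne] at e1
  exact coeff_eq_zero_of_eval₂_eq (m := k + 1) (h := const 2 * (axis 0 (A 1 1) -
    ((k : AnalyticGerm ℂ) + 1) * axis 0 (A 0 0))) (by rw [e1]; ring) hi

/-- Serves `II4` with `m = 4` and `II6` with `m = 6`. On the axis `b = 0` the factor `b²` kills the
first term even after one `b`-derivative, so both `P` and `Q` become multiples of `c^m`. -/
theorem odd_independence_of_pow {m : ℕ} {P Q : Polynomial ℂ} {ξ : Fin 2 → (Fin 2 → ℂ) → ℂ}
    (hξ : ∀ j, AnalyticAt ℂ (ξ j) 0)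
    (h : ∀ᶠ x : Fin 2 → ℂ in 𝓝 0, P.eval (x 1) + x 0 * Q.eval (x 1) =
      3 * x 0 ^ 2 * ξ 0 x + ((m + 1 : ℕ) : ℂ) * x 1 ^ m * ξ 1 x) {i : ℕ} (hi : i < m) :
    P.coeff i = 0 ∧ Q.coeff i = 0 := by
  let Z : Fin 2 → AnalyticGerm (Fin 2 → ℂ) := fun j => of (ξ j) (hξ j)
  have e : P.eval₂ const (coord 1) + coord 0 * Q.eval₂ const (coord 1) =
      const 3 * coord 0 ^ 2 * Z 0 + const ((m + 1 : ℕ) : ℂ) * coord 1 ^ m * Z 1 := by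
    rw [coord, eval₂_const_lin, eval₂_const_lin]
    exact Subtype.ext (Germ.coe_eq.2 h)
  have e1 := congrArg (axis 1) e
  have e2 := congrArg (fun g => axis 1 (partialD 0 g)) e
  simp [axis_coord_of_ne, partialD_coord_of_ne, partialD_eval₂_of_ne, axis_eval₂] at e1 e2
  exact ⟨coeff_eq_zero_of_eval₂_eq (m := m) (h := (m + 1) * axis 1 (Z 1))
      (by rw [e1]; ring) hi,
    coeff_eq_zero_of_eval₂_eq (m := m) (h := (m + 1) * axis 1 (partialD 0 (Z 1)))
      (by rw [e2]; ring) hi⟩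

theorem odd_independence_of_sub {v : Fin 5 → ℂ} {ξ : Fin 2 → (Fin 2 → ℂ) → ℂ}
    (hξ : ∀ j, AnalyticAt ℂ (ξ j) 0)
    (h : ∀ᶠ x : Fin 2 → ℂ in 𝓝 0, v 0 * x 1 + v 1 * x 1 ^ 3 + v 2 * x 1 ^ 5 +
      x 0 * (v 3 + v 4 * x 1 ^ 2) =
        (3 * x 0 ^ 2 - x 1 ^ 4) * ξ 0 x - 4 * x 0 * x 1 ^ 3 * ξ 1 x) : v = 0 := by
  let Z : Fin 2 → AnalyticGerm (Fin 2 → ℂ) := fun j => of (ξ j) (hξ j)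
  have e : const (v 0) * coord 1 + const (v 1) * coord 1 ^ 3 + const (v 2) * coord 1 ^ 5 +
      coord 0 * (const (v 3) + const (v 4) * coord 1 ^ 2) =
        (const 3 * coord 0 ^ 2 - coord 1 ^ 4) * Z 0 - const 4 * coord 0 * coord 1 ^ 3 * Z 1 :=
    Subtype.ext (Germ.coe_eq.2 h)
  have e1 := congrArg (axis 1) e
  have e2 := congrArg (fun g => axis 1 (partialD 0 g)) e
  -- The first two relations give `v 0 = v 1 = 0` and `v 3 = v 4 = 0`, and leave `ξ 0 = -v 2 · c` on
  -- the axis `b = 0`. The second derivative makes `ξ 0` divisible by `c³` there, which forces `v 2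
  -- = 0`.
  have e3 := congrArg (fun g => axis 1 (partialD 0 (partialD 0 g))) e
  simp [axis_coord_of_ne, partialD_coord_of_ne, map_ofNat (axis (1 : Fin 2)) 2] at e1 e2 e3
  have h1 : ∀ i < 4, (Polynomial.C (v 0) * Polynomial.X + Polynomial.C (v 1) * Polynomial.X ^ 3 +
      Polynomial.C (v 2) * Polynomial.X ^ 5).coeff i = 0 := fun i hi =>
    coeff_eq_zero_of_eval₂_eq (m := 4) (h := -axis 1 (Z 0)) (by simp [e1]) hi
  have h2 : ∀ i < 3, (Polynomial.C (v 3) + Polynomial.C (v 4) * Polynomial.X ^ 2).coeff i = 0 :=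
    fun i hi => coeff_eq_zero_of_eval₂_eq (m := 3) (h := -(var * axis 1 (partialD 0 (Z 0))) -
      const 4 * axis 1 (Z 1)) (by simp; linear_combination e2) hi
  have h10 := h1 1 (by norm_num)
  have h11 := h1 3 (by norm_num)
  have h20 := h2 0 (by norm_num)
  have h21 := h2 2 (by norm_num)
  simp [Polynomial.coeff_C, Polynomial.coeff_X_pow] at h10 h11 h20 h21
  have h3 : const (v 2) * var = -axis 1 (Z 0) := by
    refine var_pow_mul_cancel (n := 4) ?_
    rw [h10, h11] at e1
    simp at e1
    linear_combination e1
  have h4 : const (v 2) = var ^ 2 *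
      (const (-1 / 6) * (var * axis 1 (partialD 0 (partialD 0 (Z 0))) +
      const 4 * 2 * axis 1 (partialD 0 (Z 1)))) := by
    refine var_mul_cancel ?_
    have h6 : const (-1 / 6) * (const 3 * 2) = (-1 : AnalyticGerm ℂ) := by
      rw [show (2 : AnalyticGerm ℂ) = const 2 from (map_ofNat const 2).symm, ← map_mul, ← map_mul,
        ← map_one const, ← map_neg]
      norm_num
    linear_combination h3 - const (-1 / 6) * e3 - axis 1 (Z 0) * h6
  have h5 : v 2 = 0 := by simpa using congrArg value h4
  ext i
  fin_cases i <;> assumption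

/-- The value at the origin gives `c`, and on the `a`-axis `P` becomes a multiple of `a^(2k-1)`; the
largest exponent among the listed monomials is `2k - 2`. -/
theorem curve_independence_of_series {k : ℕ} (hk : 1 ≤ k) {P : Polynomial ℂ} {c : ℂ}
    {ξ : Fin 3 → (Fin 3 → ℂ) → ℂ} {b : Fin 2 → Fin 2 → (Fin 3 → ℂ) → ℂ}
    (hξ : ∀ j, AnalyticAt ℂ (ξ j) 0) (hb : ∀ i j, AnalyticAt ℂ (b i j) 0)
    (hP : ∀ᶠ x : Fin 3 → ℂ in 𝓝 0, P.eval (x 0) = 2 * k * x 0 ^ (2 * k - 1) * ξ 0 x +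
      2 * x 2 * ξ 1 x + (2 * x 2 + 2 * x 1) * ξ 2 x +
      b 0 0 x * (x 2 ^ 2 + 2 * x 1 * x 2 + x 0 ^ (2 * k)) + b 0 1 x * (x 0 * x 1))
    (hc : ∀ᶠ x : Fin 3 → ℂ in 𝓝 0, -c = x 1 * ξ 0 x + x 0 * ξ 1 x +
      b 1 0 x * (x 2 ^ 2 + 2 * x 1 * x 2 + x 0 ^ (2 * k)) + b 1 1 x * (x 0 * x 1)) :
    c = 0 ∧ ∀ i < 2 * k - 1, P.coeff i = 0 := by
  refine ⟨by simpa [show k ≠ 0 by omega] using hc.self_of_nhds, fun i hi => ?_⟩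
  let Z : Fin 3 → AnalyticGerm (Fin 3 → ℂ) := fun j => of (ξ j) (hξ j)
  let B : Fin 2 → Fin 2 → AnalyticGerm (Fin 3 → ℂ) := fun i j => of (b i j) (hb i j)
  have e : P.eval₂ const (coord 0) = const (2 * k) * coord 0 ^ (2 * k - 1) * Z 0 +
      const 2 * coord 2 * Z 1 + (const 2 * coord 2 + const 2 * coord 1) * Z 2 +
      B 0 0 * (coord 2 ^ 2 + const 2 * coord 1 * coord 2 + coord 0 ^ (2 * k)) +
      B 0 1 * (coord 0 * coord 1) := by
    rw [coord, eval₂_const_lin]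
    exact Subtype.ext (Germ.coe_eq.2 hP)
  have e1 := congrArg (axis 0) e
  rw [axis_eval₂] at e1
  simp [axis_coord_of_ne] at e1
  refine coeff_eq_zero_of_eval₂_eq (m := 2 * k - 1)
    (h := const 2 * (k : AnalyticGerm ℂ) * axis 0 (Z 0) +
    axis 0 (B 0 0) * var) ?_ hi
  have : var ^ (2 * k) = var ^ (2 * k - 1) * var := by
    rw [← pow_succ]
    congr 1
    omega
  rw [e1, this]
  ring

theorem curve_independence_of_pow {m : ℕ} {P Q : Polynomial ℂ}
    {ξ : Fin 3 → (Fin 3 → ℂ) → ℂ} {b : Fin 2 → Fin 2 → (Fin 3 → ℂ) → ℂ}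
    (hξ : ∀ j, AnalyticAt ℂ (ξ j) 0) (hb : ∀ i j, AnalyticAt ℂ (b i j) 0)
    (hQ : ∀ᶠ x : Fin 3 → ℂ in 𝓝 0, Q.eval (x 2) = -x 2 * ξ 0 x + 2 * x 1 * ξ 1 x - x 0 * ξ 2 x +
      b 0 0 x * (x 1 ^ 2 - x 0 * x 2) + b 0 1 x * (x 0 * x 1 - x 2 ^ (m + 1)))
    (hP : ∀ᶠ x : Fin 3 → ℂ in 𝓝 0, -P.eval (x 2) = x 1 * ξ 0 x + x 0 * ξ 1 x -
      ((m + 1 : ℕ) : ℂ) * x 2 ^ m * ξ 2 x +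
      b 1 0 x * (x 1 ^ 2 - x 0 * x 2) + b 1 1 x * (x 0 * x 1 - x 2 ^ (m + 1))) {i : ℕ}
    (hi : i < m) : P.coeff i = 0 ∧ Q.coeff i = 0 := by
  let Z : Fin 3 → AnalyticGerm (Fin 3 → ℂ) := fun j => of (ξ j) (hξ j)
  let B : Fin 2 → Fin 2 → AnalyticGerm (Fin 3 → ℂ) := fun i j => of (b i j) (hb i j)
  have eQ : Q.eval₂ const (coord 2) = -coord 2 * Z 0 + const 2 * coord 1 * Z 1 - coord 0 * Z 2 +
      B 0 0 * (coord 1 ^ 2 - coord 0 * coord 2) +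
      B 0 1 * (coord 0 * coord 1 - coord 2 ^ (m + 1)) := by
    rw [coord, eval₂_const_lin]
    exact Subtype.ext (Germ.coe_eq.2 hQ)
  have eP : -P.eval₂ const (coord 2) = coord 1 * Z 0 + coord 0 * Z 1 -
      const ((m + 1 : ℕ) : ℂ) * coord 2 ^ m * Z 2 +
      B 1 0 * (coord 1 ^ 2 - coord 0 * coord 2) +
      B 1 1 * (coord 0 * coord 1 - coord 2 ^ (m + 1)) := by
    rw [coord, eval₂_const_lin]
    exact Subtype.ext (Germ.coe_eq.2 hP)
  have e1 := congrArg (axis 2) eP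
  have e2 := congrArg (axis 2) eQ
  -- The `b`-derivative of the second component shows that `c^m` divides `ξ 0` on the `c`-axis,
  -- which takes care of the term `-c ξ 0` in the first component.
  have e3 := congrArg (fun g => axis 2 (partialD 1 g)) eP
  simp [axis_coord_of_ne, partialD_coord_of_ne, partialD_eval₂_of_ne, axis_eval₂] at e1 e2 e3
  exact ⟨coeff_eq_zero_of_eval₂_eq (m := m) (h := (m + 1) * axis 2 (Z 2) +
      axis 2 (B 1 1) * var) (by linear_combination -e1) hi,
    coeff_eq_zero_of_eval₂_eq (m := m) (h := -(var * ((m + 1) * axis 2 (partialD 1 (Z 2)) +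
      var * axis 2 (partialD 1 (B 1 1)))) - axis 2 (B 0 1) * var)
      (by linear_combination e2 + var * e3) hi⟩

theorem curve_independence_of_sq {v : Fin 5 → ℂ}
    {ξ : Fin 3 → (Fin 3 → ℂ) → ℂ} {b : Fin 2 → Fin 2 → (Fin 3 → ℂ) → ℂ}
    (hξ : ∀ j, AnalyticAt ℂ (ξ j) 0) (hb : ∀ i j, AnalyticAt ℂ (b i j) 0)
    (hQ : ∀ᶠ x : Fin 3 → ℂ in 𝓝 0, v 4 * x 2 ^ 2 + v 3 = -x 2 * ξ 0 x + 2 * x 1 * ξ 1 x +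
      (-x 0 + 4 * x 2 ^ 3) * ξ 2 x +
      b 0 0 x * (x 1 ^ 2 - x 0 * x 2 + x 2 ^ 4) + b 0 1 x * (x 0 * x 1))
    (hP : ∀ᶠ x : Fin 3 → ℂ in 𝓝 0, -(v 2 * x 2 ^ 4 + v 1 * x 2 ^ 2 + v 0) = x 1 * ξ 0 x +
      x 0 * ξ 1 x + b 1 0 x * (x 1 ^ 2 - x 0 * x 2 + x 2 ^ 4) + b 1 1 x * (x 0 * x 1)) :
    v = 0 := by
  let Z : Fin 3 → AnalyticGerm (Fin 3 → ℂ) := fun j => of (ξ j) (hξ j)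
  let B : Fin 2 → Fin 2 → AnalyticGerm (Fin 3 → ℂ) := fun i j => of (b i j) (hb i j)
  have eQ : const (v 4) * coord 2 ^ 2 + const (v 3) = -coord 2 * Z 0 + const 2 * coord 1 * Z 1 +
      (-coord 0 + const 4 * coord 2 ^ 3) * Z 2 +
      B 0 0 * (coord 1 ^ 2 - coord 0 * coord 2 + coord 2 ^ 4) + B 0 1 * (coord 0 * coord 1) :=
    Subtype.ext (Germ.coe_eq.2 hQ)
  have eP : -(const (v 2) * coord 2 ^ 4 + const (v 1) * coord 2 ^ 2 + const (v 0)) =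
      coord 1 * Z 0 + coord 0 * Z 1 +
      B 1 0 * (coord 1 ^ 2 - coord 0 * coord 2 + coord 2 ^ 4) + B 1 1 * (coord 0 * coord 1) :=
    Subtype.ext (Germ.coe_eq.2 hP)
  have e1 := congrArg (axis 2) eP
  have e2 := congrArg (axis 2) eQ
  have e3 := congrArg (fun g => axis 2 (partialD 1 g)) eP
  -- On the `c`-axis `v 2 = -b 1 0`. Eliminating `ξ 1` and `∂ξ 0 / ∂b` from these three relations
  -- leaves `6 c · b 1 0` equal to a multiple of `c²`, so `b 1 0` vanishes at the origin.
  have e4 := congrArg (fun g => axis 2 (partialD 0 g)) eP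
  have e5 := congrArg (fun g => axis 2 (partialD 1 g)) eQ
  have e6 := congrArg (fun g => axis 2 (partialD 1 (partialD 1 g))) eP
  simp [axis_coord_of_ne, partialD_coord_of_ne, map_ofNat (axis (2 : Fin 3)) 2] at e1 e2 e3 e4 e5 e6
  have h1 : ∀ i < 4, (Polynomial.C (v 2) * Polynomial.X ^ 4 +
      Polynomial.C (v 1) * Polynomial.X ^ 2 + Polynomial.C (v 0)).coeff i = 0 := fun i hi =>
    coeff_eq_zero_of_eval₂_eq (m := 4) (h := -axis 2 (B 1 0))
      (by simp; linear_combination -e1) hi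
  have h2 : ∀ i < 3, (Polynomial.C (v 4) * Polynomial.X ^ 2 + Polynomial.C (v 3)).coeff i = 0 :=
    fun i hi => coeff_eq_zero_of_eval₂_eq (m := 3) (h := var ^ 2 * axis 2 (partialD 1 (B 1 0)) +
      const 4 * axis 2 (Z 2) + axis 2 (B 0 0) * var) (by simp; linear_combination e2 + var * e3) hi
  have h10 := h1 0 (by norm_num)
  have h11 := h1 2 (by norm_num)
  have h20 := h2 0 (by norm_num)
  have h21 := h2 2 (by norm_num)
  simp [Polynomial.coeff_C, Polynomial.coeff_X_pow] at h10 h11 h20 h21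
  have h3 : const (v 2) = -axis 2 (B 1 0) := by
    refine var_pow_mul_cancel (n := 4) ?_
    rw [h10, h11] at e1
    simp at e1
    linear_combination -e1
  have hc2 : const 2 = (2 : AnalyticGerm ℂ) := map_ofNat const 2
  have h4 : 6 * axis 2 (B 1 0) = var * (2 * (var ^ 2 * axis 2 (partialD 0 (B 1 0))) * 2 -
      var ^ 3 * axis 2 (partialD 1 (partialD 1 (B 1 0))) -
      2 * const 4 * var * axis 2 (partialD 1 (Z 2)) -
      2 * var ^ 2 * axis 2 (partialD 1 (B 0 0))) := by
    refine var_mul_cancel ?_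
    rw [hc2] at e5
    linear_combination 4 * e4 - 2 * e5 - var * e6
  have h5 := congrArg value h4
  simp [map_ofNat (value (E := ℂ))] at h5
  have h6 : v 2 = 0 := by simpa [h5] using congrArg value h3
  ext i
  fin_cases i <;> assumption

end

/-! ### Independence of the parameter directions, row by row -/

noncomputable section

set_option linter.unusedSimpArgs false

open AnalyticGerm

/-- The listed deformations are affine in the parameters, so the velocity in the direction `v` is
the coefficient of `ε`. -/
theorem eq_of_hasDerivAt_of_affine {f : ℂ → ℂ} {c d d' : ℂ} (h : HasDerivAt f d' 0)
    (hf : ∀ ε, f ε = c + ε * d) : d = d' := by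
  obtain rfl : f = fun ε => c + ε * d := funext hf
  simpa using (((hasDerivAt_id (0 : ℂ)).mul_const d).const_add c).unique h

theorem fderiv_apply_coord {s : ℕ} (i : Fin s) (u v : Fin s → ℂ) :
    fderiv ℂ (fun y : Fin s → ℂ => y i) u v = v i := by
  rw [(hasFDerivAt_apply i u).fderiv]
  rfl

theorem matrixDef_II4_independent {v : Fin 4 → ℂ}
    (h : IsSLTrivialAlong (m := 4) TableRow.II4.matrix TableRow.II4.matrixDef v) : v = 0 := by
  obtain ⟨ξ, a, -, ha, h⟩ := h
  have hP : ∀ᶠ u : Fin 4 → ℂ in 𝓝 0, (Polynomial.C (v 1) * Polynomial.X +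
      Polynomial.C (v 0)).eval (u 3) =
      (a 0 0 u + a 1 1 u) * u 3 ^ (1 + 1) +
      a 1 0 u * u 1 + a 2 0 u * u 2 + u 0 * a 0 1 u + u 1 * a 2 1 u -
      2 * ((1 + 1 : ℕ) : ℂ) * u 3 ^ 1 * (a 0 2 u * u 1 + a 1 2 u * u 2 + a 2 2 u * u 3) := by
    filter_upwards [h] with u hu
    have h01 := eq_of_hasDerivAt_of_affine (c := u 3 ^ 2) (d := v 1 * u 3 + v 0) (hu 0 1)
      (fun ε => by simp [TableRow.matrixDef]; ring)
    have h22 := eq_of_hasDerivAt_of_affine (c := u 3) (d := 0) (hu 2 2)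
      (fun ε => by simp [TableRow.matrixDef])
    simp (disch := fun_prop) [TableRow.matrix, Fin.sum_univ_three, fderiv_apply_coord,
      fderiv_fun_pow, fderiv_fun_add, fderiv_fun_sub, fderiv_fun_mul]
      at h01 h22
    simp
    -- The vector field enters the entry `w²` through `2w ξ 3`, and the entry `w` provides `ξ 3`;
    -- the combination removes it.
    linear_combination h01 - 2 * u 3 * h22
  have hQ : ∀ᶠ u : Fin 4 → ℂ in 𝓝 0, (Polynomial.C (v 3) * Polynomial.X +
      Polynomial.C (v 2)).eval (u 3) =
      a 0 0 u * u 1 + a 1 0 u * u 2 +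
      a 2 0 u * u 3 + u 0 * a 0 2 u + u 3 ^ (1 + 1) * a 1 2 u + u 1 * a 2 2 u -
      2 * a 0 1 u * u 3 ^ (1 + 1) - 2 * a 1 1 u * u 1 - 2 * a 2 1 u * u 2 := by
    filter_upwards [h] with u hu
    have h02 := eq_of_hasDerivAt_of_affine (c := u 1) (d := v 3 * u 3 + v 2) (hu 0 2)
      (fun ε => by simp [TableRow.matrixDef]; ring)
    have h11 := eq_of_hasDerivAt_of_affine (c := u 1) (d := 0) (hu 1 1)
      (fun ε => by simp [TableRow.matrixDef])
    simp (disch := fun_prop) [TableRow.matrix, Fin.sum_univ_three, fderiv_apply_coord,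
      fderiv_fun_pow, fderiv_fun_add, fderiv_fun_sub, fderiv_fun_mul]
      at h02 h11
    simp
    linear_combination h02 - h11
  have key := fun (i : ℕ) (hi : i < 2) => matrix_independence_of_pow ha hP hQ hi
  have k0 := key 0 (by norm_num)
  have k1 := key 1 (by norm_num)
  simp [Polynomial.coeff_X, Polynomial.coeff_C, Polynomial.coeff_X_pow] at k0 k1
  ext i
  fin_cases i <;> simp_all

theorem matrixDef_II6_independent {v : Fin 6 → ℂ}
    (h : IsSLTrivialAlong (m := 6) TableRow.II6.matrix TableRow.II6.matrixDef v) : v = 0 := by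
  obtain ⟨ξ, a, -, ha, h⟩ := h
  have hP : ∀ᶠ u : Fin 4 → ℂ in 𝓝 0, (Polynomial.C (v 2) * Polynomial.X ^ 2 +
      Polynomial.C (v 1) * Polynomial.X +
      Polynomial.C (v 0)).eval (u 3) =
      (a 0 0 u + a 1 1 u) * u 3 ^ (2 + 1) +
      a 1 0 u * u 1 + a 2 0 u * u 2 + u 0 * a 0 1 u + u 1 * a 2 1 u -
      2 * ((2 + 1 : ℕ) : ℂ) * u 3 ^ 2 * (a 0 2 u * u 1 + a 1 2 u * u 2 + a 2 2 u * u 3) := by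
    filter_upwards [h] with u hu
    have h01 := eq_of_hasDerivAt_of_affine (c := u 3 ^ 3) (d := v 2 * u 3 ^ 2 + v 1 * u 3 + v 0)
      (hu 0 1)
      (fun ε => by simp [TableRow.matrixDef]; ring)
    have h22 := eq_of_hasDerivAt_of_affine (c := u 3) (d := 0) (hu 2 2)
      (fun ε => by simp [TableRow.matrixDef])
    simp (disch := fun_prop) [TableRow.matrix, Fin.sum_univ_three, fderiv_apply_coord,
      fderiv_fun_pow, fderiv_fun_add, fderiv_fun_sub, fderiv_fun_mul]
      at h01 h22
    simp
    linear_combination h01 - 3 * u 3 ^ 2 * h22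
  have hQ : ∀ᶠ u : Fin 4 → ℂ in 𝓝 0, (Polynomial.C (v 5) * Polynomial.X ^ 2 +
      Polynomial.C (v 4) * Polynomial.X +
      Polynomial.C (v 3)).eval (u 3) =
      a 0 0 u * u 1 + a 1 0 u * u 2 +
      a 2 0 u * u 3 + u 0 * a 0 2 u + u 3 ^ (2 + 1) * a 1 2 u + u 1 * a 2 2 u -
      2 * a 0 1 u * u 3 ^ (2 + 1) - 2 * a 1 1 u * u 1 - 2 * a 2 1 u * u 2 := by
    filter_upwards [h] with u hu
    have h02 := eq_of_hasDerivAt_of_affine (c := u 1) (d := v 5 * u 3 ^ 2 + v 4 * u 3 + v 3) (hu 0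
      2)
      (fun ε => by simp [TableRow.matrixDef]; ring)
    have h11 := eq_of_hasDerivAt_of_affine (c := u 1) (d := 0) (hu 1 1)
      (fun ε => by simp [TableRow.matrixDef])
    simp (disch := fun_prop) [TableRow.matrix, Fin.sum_univ_three, fderiv_apply_coord,
      fderiv_fun_pow, fderiv_fun_add, fderiv_fun_sub, fderiv_fun_mul]
      at h02 h11
    simp
    linear_combination h02 - h11
  have key := fun (i : ℕ) (hi : i < 3) => matrix_independence_of_pow ha hP hQ hi
  have k0 := key 0 (by norm_num)
  have k1 := key 1 (by norm_num)
  have k2 := key 2 (by norm_num)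
  simp [Polynomial.coeff_X, Polynomial.coeff_C, Polynomial.coeff_X_pow] at k0 k1 k2
  ext i
  fin_cases i <;> simp_all

theorem matrixDef_II5_independent {v : Fin 5 → ℂ}
    (h : IsSLTrivialAlong (m := 5) TableRow.II5.matrix TableRow.II5.matrixDef v) : v = 0 := by
  obtain ⟨ξ, a, -, ha, h⟩ := h
  refine matrix_independence_of_sq ha ?_ ?_
  · filter_upwards [h] with u hu
    have h01 := eq_of_hasDerivAt_of_affine (c := 0) (d := v 2 * u 3 ^ 2 + v 1 * u 3 + v 0) (hu 0 1)
      (fun ε => by simp [TableRow.matrixDef]; ring)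
    simp (disch := fun_prop) [TableRow.matrix, Fin.sum_univ_three, fderiv_apply_coord,
      fderiv_fun_pow, fderiv_fun_add, fderiv_fun_sub, fderiv_fun_mul]
      at h01
    linear_combination h01
  · filter_upwards [h] with u hu
    have h02 := eq_of_hasDerivAt_of_affine (c := u 1 + u 3 ^ 2) (d := v 4 * u 3 + v 3) (hu 0 2)
      (fun ε => by simp [TableRow.matrixDef]; ring)
    have h11 := eq_of_hasDerivAt_of_affine (c := u 1) (d := 0) (hu 1 1)
      (fun ε => by simp [TableRow.matrixDef])
    have h22 := eq_of_hasDerivAt_of_affine (c := u 3) (d := 0) (hu 2 2)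
      (fun ε => by simp [TableRow.matrixDef])
    simp (disch := fun_prop) [TableRow.matrix, Fin.sum_univ_three, fderiv_apply_coord,
      fderiv_fun_pow, fderiv_fun_add, fderiv_fun_sub, fderiv_fun_mul]
      at h02 h11 h22
    -- The entry `y + w²` moves by `ξ 1 + 2w ξ 3`; the diagonal entries `y` and `w` remove both
    -- summands.
    linear_combination h02 - h11 - 2 * u 3 * h22

/-- Common end of the three arguments for the series `I`, whose exponents are `i`, `2i + 1` and
`2i`. -/
theorem eq_zero_of_coeff_sum_eq_zero {k : ℕ} {v : Fin (k + 1) → ℂ} {e : ℕ → ℕ}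
    (he : Function.Injective e) (hlast : v (Fin.last k) = 0)
    (h : ∀ i < k, (∑ j : Fin k, Polynomial.C (v j.castSucc) * Polynomial.X ^ e j).coeff (e i) = 0) :
    v = 0 := by
  ext i
  refine Fin.lastCases hlast (fun i => ?_) i
  have := h i i.2
  simpa [Polynomial.finsetSum_coeff, Polynomial.coeff_X_pow, he.eq_iff, Fin.val_inj] using this

theorem matrixDef_I_independent {k : ℕ} (hk : 1 ≤ k) {v : Fin (k + 1) → ℂ}
    (h : IsSLTrivialAlong (m := k + 1) (TableRow.I k hk).matrix (TableRow.I k hk).matrixDef v) : v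
      = 0 := by
  obtain ⟨ξ, a, -, ha, h⟩ := h
  have hc : ∀ᶠ u : Fin 4 → ℂ in 𝓝 0, v (Fin.last k) = a 1 0 u * (u 1 + u 0 ^ k) + a 2 0 u * u 3 +
      u 0 * a 0 1 u + u 2 * a 2 1 u := by
    filter_upwards [h] with u hu
    have h01 := eq_of_hasDerivAt_of_affine (c := 0) (d := v (Fin.last k)) (hu 0 1)
      (fun ε => by simp [TableRow.matrixDef])
    simp [TableRow.matrix, Fin.sum_univ_three] at h01
    linear_combination h01
  have hP : ∀ᶠ u : Fin 4 → ℂ in 𝓝 0,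
      (∑ i : Fin k, Polynomial.C (v i.castSucc) * Polynomial.X ^ (i : ℕ)).eval (u 0) =
      2 * (a 1 1 u * (u 1 + u 0 ^ k) +
      a 2 1 u * u 3 - a 0 2 u * u 2 - a 1 2 u * u 3 - a 2 2 u * u 1 -
      k * u 0 ^ (k - 1) * (a 0 0 u * u 0 + a 2 0 u * u 2)) := by
    filter_upwards [h] with u hu
    have h00 := eq_of_hasDerivAt_of_affine (c := u 0) (d := 0) (hu 0 0)
      (fun ε => by simp [TableRow.matrixDef])
    have h22 := eq_of_hasDerivAt_of_affine (c := u 1) (d := 0) (hu 2 2)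
      (fun ε => by simp [TableRow.matrixDef])
    have h11 := eq_of_hasDerivAt_of_affine (c := u 1 + u 0 ^ k)
      (d := ∑ i : Fin k, v i.castSucc * u 0 ^ (i : ℕ)) (hu 1 1)
      (fun ε => by simp [TableRow.matrixDef, Finset.mul_sum, mul_assoc])
    simp (disch := fun_prop) [TableRow.matrix, Fin.sum_univ_three, fderiv_apply_coord,
      fderiv_fun_pow, fderiv_fun_add, fderiv_fun_sub, fderiv_fun_mul] at h00 h11 h22
    simp only [Polynomial.eval_finsetSum, Polynomial.eval_mul, Polynomial.eval_C,
      Polynomial.eval_pow, Polynomial.eval_X]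
    -- Removes `ξ 1` by the entry `y`, and `k x^(k-1) ξ 0`, the variation of `x^k`, by the entry
    -- `x`.
    linear_combination h11 - h22 - k * u 0 ^ (k - 1) * h00
  obtain ⟨h1, h2⟩ := matrix_independence_of_series hk ha hc hP
  exact eq_zero_of_coeff_sum_eq_zero (e := fun i => i) Function.injective_id h1 h2

theorem TableRow.matrixDef_independent (r : TableRow) {v : Fin r.tau → ℂ}
    (h : IsSLTrivialAlong r.matrix r.matrixDef v) : v = 0 := by
  cases r with
  | I k hk => exact matrixDef_I_independent hk h
  | II4 => exact matrixDef_II4_independent h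
  | II5 => exact matrixDef_II5_independent h
  | II6 => exact matrixDef_II6_independent h

theorem oddDef_II4_independent {v : Fin 4 → ℂ}
    (h : IsRTrivialAlong (m := 4) (fun x => x 0 ^ 3 + x 1 ^ 5) TableRow.II4.oddDef v) : v = 0 := by
  obtain ⟨ξ, hξ, h⟩ := h
  have hP : ∀ᶠ x : Fin 2 → ℂ in 𝓝 0, (Polynomial.C (v 0) * Polynomial.X +
      Polynomial.C (v 1) * Polynomial.X ^ 3).eval (x 1) +
      x 0 * (Polynomial.C (v 3) * Polynomial.X ^ 2 +
      Polynomial.C (v 2)).eval (x 1) =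
      3 * x 0 ^ 2 * ξ 0 x + ((4 + 1 : ℕ) : ℂ) * x 1 ^ 4 * ξ 1 x := by
    filter_upwards [h] with x hx
    have h0 := eq_of_hasDerivAt_of_affine (c := x 0 ^ 3 + x 1 ^ 5) (d := v 0 * x 1 + v 1 * x 1 ^ 3
      + x 0 * (v 3 * x 1 ^ 2 + v 2)) hx
      (fun ε => by simp [TableRow.oddDef]; ring)
    simp (disch := fun_prop) [TableRow.oddFun, fderiv_apply_coord, fderiv_fun_pow, fderiv_fun_add,
      fderiv_fun_sub, fderiv_fun_mul] at h0
    simp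
    linear_combination h0
  have key := fun (i : ℕ) (hi : i < 4) => odd_independence_of_pow hξ hP hi
  have k0 := key 0 (by norm_num)
  have k1 := key 1 (by norm_num)
  have k2 := key 2 (by norm_num)
  have k3 := key 3 (by norm_num)
  simp [Polynomial.coeff_X, Polynomial.coeff_C, Polynomial.coeff_X_pow] at k0 k1 k2 k3
  ext i
  fin_cases i <;> simp_all

theorem oddDef_II6_independent {v : Fin 6 → ℂ}
    (h : IsRTrivialAlong (m := 6) (fun x => x 0 ^ 3 + x 1 ^ 7) TableRow.II6.oddDef v) : v = 0 := by
  obtain ⟨ξ, hξ, h⟩ := h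
  have hP : ∀ᶠ x : Fin 2 → ℂ in 𝓝 0, (Polynomial.C (v 0) * Polynomial.X +
      Polynomial.C (v 1) * Polynomial.X ^ 3 +
      Polynomial.C (v 2) * Polynomial.X ^ 5).eval (x 1) +
      x 0 * (Polynomial.C (v 5) * Polynomial.X ^ 4 +
      Polynomial.C (v 4) * Polynomial.X ^ 2 +
      Polynomial.C (v 3)).eval (x 1) =
      3 * x 0 ^ 2 * ξ 0 x + ((6 + 1 : ℕ) : ℂ) * x 1 ^ 6 * ξ 1 x := by
    filter_upwards [h] with x hx
    have h0 := eq_of_hasDerivAt_of_affine (c := x 0 ^ 3 + x 1 ^ 7) (d := v 0 * x 1 + v 1 * x 1 ^ 3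
      + v 2 * x 1 ^ 5 + x 0 * (v 5 * x 1 ^ 4 + v 4 * x 1 ^ 2 + v 3)) hx
      (fun ε => by simp [TableRow.oddDef]; ring)
    simp (disch := fun_prop) [TableRow.oddFun, fderiv_apply_coord, fderiv_fun_pow, fderiv_fun_add,
      fderiv_fun_sub, fderiv_fun_mul] at h0
    simp
    linear_combination h0
  have key := fun (i : ℕ) (hi : i < 6) => odd_independence_of_pow hξ hP hi
  have k0 := key 0 (by norm_num)
  have k1 := key 1 (by norm_num)
  have k2 := key 2 (by norm_num)
  have k3 := key 3 (by norm_num)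
  have k4 := key 4 (by norm_num)
  have k5 := key 5 (by norm_num)
  simp [Polynomial.coeff_X, Polynomial.coeff_C, Polynomial.coeff_X_pow] at k0 k1 k2 k3 k4 k5
  ext i
  fin_cases i <;> simp_all

theorem oddDef_II5_independent {v : Fin 5 → ℂ}
    (h : IsRTrivialAlong (m := 5) (fun x => x 0 ^ 3 - x 0 * x 1 ^ 4) TableRow.II5.oddDef v) : v =
      0 := by
  obtain ⟨ξ, hξ, h⟩ := h
  refine odd_independence_of_sub hξ ?_
  filter_upwards [h] with x hx
  have h0 := eq_of_hasDerivAt_of_affine (c := x 0 ^ 3 - x 0 * x 1 ^ 4) (d := v 0 * x 1 + v 1 * x 1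
    ^ 3 + v 2 * x 1 ^ 5 + x 0 * (v 3 + v 4 * x 1 ^ 2)) hx
    (fun ε => by simp [TableRow.oddDef]; ring)
  simp (disch := fun_prop) [TableRow.oddFun, fderiv_apply_coord, fderiv_fun_pow, fderiv_fun_add,
    fderiv_fun_sub, fderiv_fun_mul] at h0
  linear_combination h0

/-- The `c`-derivative at the origin isolates the constant, and on the `a`-axis only a multiple of
`a^(2k)` remains. -/
theorem odd_independence_of_series {k : ℕ} (hk : 1 ≤ k) {P : Polynomial ℂ} {c : ℂ}
    {ξ : Fin 2 → (Fin 2 → ℂ) → ℂ} (hξ : ∀ j, AnalyticAt ℂ (ξ j) 0)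
    (h : ∀ᶠ x : Fin 2 → ℂ in 𝓝 0, P.eval (x 0) + c * x 1 =
      (x 1 ^ 2 + ((2 * k + 1 : ℕ) : ℂ) * x 0 ^ (2 * k)) * ξ 0 x + 2 * x 0 * x 1 * ξ 1 x) :
    c = 0 ∧ ∀ i < 2 * k, P.coeff i = 0 := by
  let Z : Fin 2 → AnalyticGerm (Fin 2 → ℂ) := fun j => of (ξ j) (hξ j)
  have e : P.eval₂ const (coord 0) + const c * coord 1 =
      (coord 1 ^ 2 + const ((2 * k + 1 : ℕ) : ℂ) * coord 0 ^ (2 * k)) * Z 0 +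
        const 2 * coord 0 * coord 1 * Z 1 := by
    rw [coord, eval₂_const_lin]
    exact Subtype.ext (Germ.coe_eq.2 h)
  have e1 := congrArg (axis 0) e
  have e2 := congrArg (fun g => value (partialD 1 g)) e
  simp only [map_add, partialD_eval₂_of_ne (show (0 : Fin 2) ≠ 1 by decide)] at e2
  simp only [map_add, axis_eval₂] at e1
  have hk' : k ≠ 0 := by omega
  simp [axis_coord_of_ne, partialD_coord_of_ne, hk'] at e1 e2
  exact ⟨e2, fun i hi => coeff_eq_zero_of_eval₂_eq (m := 2 * k)
    (h := (const 2 * (k : AnalyticGerm ℂ) + 1) * axis 0 (Z 0)) (by rw [e1]; ring) hi⟩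

theorem oddDef_I_independent {k : ℕ} (hk : 1 ≤ k) {v : Fin (k + 1) → ℂ}
    (h : IsRTrivialAlong (m := k + 1)
      (fun x => x 0 * x 1 ^ 2 + x 0 ^ (2 * k + 1)) (TableRow.I k hk).oddDef v) : v = 0 := by
  obtain ⟨ξ, hξ, h⟩ := h
  obtain ⟨h1, h2⟩ := odd_independence_of_series hk hξ (c := v (Fin.last k))
    (P := ∑ i : Fin k, Polynomial.C (v i.castSucc) * Polynomial.X ^ (2 * (i : ℕ) + 1)) (by
    filter_upwards [h] with x hx
    have h0 := eq_of_hasDerivAt_of_affine (c := x 0 * x 1 ^ 2 + x 0 ^ (2 * k + 1))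
      (d := ∑ i : Fin k, v i.castSucc * x 0 ^ (2 * (i : ℕ) + 1) + v (Fin.last k) * x 1) hx
      (fun ε => by simp [TableRow.oddDef, Finset.mul_sum, mul_add, mul_assoc]; ring)
    simp (disch := fun_prop) [TableRow.oddFun, fderiv_apply_coord, fderiv_fun_pow, fderiv_fun_add,
      fderiv_fun_sub, fderiv_fun_mul] at h0
    simp only [Polynomial.eval_finsetSum, Polynomial.eval_mul, Polynomial.eval_C,
      Polynomial.eval_pow, Polynomial.eval_X]
    push_cast
    linear_combination h0)
  exact eq_zero_of_coeff_sum_eq_zero (e := fun i => 2 * i + 1) (fun i j h => by simpa using h) h1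
    fun i hi => h2 _ (by omega)

theorem TableRow.oddDef_independent (r : TableRow) {v : Fin r.tau → ℂ}
    (h : IsRTrivialAlong r.oddFun r.oddDef v) : v = 0 := by
  cases r with
  | I k hk => exact oddDef_I_independent hk h
  | II4 => exact oddDef_II4_independent h
  | II5 => exact oddDef_II5_independent h
  | II6 => exact oddDef_II6_independent h

theorem curveDef_II4_independent {v : Fin 4 → ℂ}
    (h : IsKTrivialAlong (m := 4) TableRow.II4.curve TableRow.II4.curveDef v) : v = 0 := by
  obtain ⟨ξ, b, hξ, hb, h⟩ := h
  have hQ : ∀ᶠ x : Fin 3 → ℂ in 𝓝 0, (Polynomial.C (v 3) * Polynomial.X ^ 2 +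
      Polynomial.C (v 2)).eval (x 2) =
      -x 2 * ξ 0 x + 2 * x 1 * ξ 1 x - x 0 * ξ 2 x +
      b 0 0 x * (x 1 ^ 2 - x 0 * x 2) + b 0 1 x * (x 0 * x 1 - x 2 ^ (3 + 1)) := by
    filter_upwards [h] with x hx
    have h0 := eq_of_hasDerivAt_of_affine (c := x 1 ^ 2 - x 0 * x 2) (d := v 3 * x 2 ^ 2 + v 2)
      (hx 0)
      (fun ε => by simp [TableRow.curveDef]; ring)
    simp (disch := fun_prop) [TableRow.curve, Fin.sum_univ_two, fderiv_apply_coord,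
      fderiv_fun_pow, fderiv_fun_add, fderiv_fun_sub, fderiv_fun_mul] at h0
    simp
    linear_combination h0
  have hP : ∀ᶠ x : Fin 3 → ℂ in 𝓝 0, -(Polynomial.C (v 1) * Polynomial.X ^ 2 +
      Polynomial.C (v 0)).eval (x 2) =
      x 1 * ξ 0 x + x 0 * ξ 1 x - ((3 + 1 : ℕ) : ℂ) * x 2 ^ 3 * ξ 2 x +
      b 1 0 x * (x 1 ^ 2 - x 0 * x 2) + b 1 1 x * (x 0 * x 1 - x 2 ^ (3 + 1)) := by
    filter_upwards [h] with x hx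
    have h0 := eq_of_hasDerivAt_of_affine (c := x 0 * x 1 - x 2 ^ 4) (d := -(v 1 * x 2 ^ 2 + v 0))
      (hx 1)
      (fun ε => by simp [TableRow.curveDef]; ring)
    simp (disch := fun_prop) [TableRow.curve, Fin.sum_univ_two, fderiv_apply_coord,
      fderiv_fun_pow, fderiv_fun_add, fderiv_fun_sub, fderiv_fun_mul] at h0
    simp
    linear_combination h0
  have key := fun (i : ℕ) (hi : i < 3) => curve_independence_of_pow hξ hb hQ hP hi
  have k0 := key 0 (by norm_num)
  have k1 := key 1 (by norm_num)
  have k2 := key 2 (by norm_num)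
  simp [Polynomial.coeff_X, Polynomial.coeff_C, Polynomial.coeff_X_pow] at k0 k1 k2
  ext i
  fin_cases i <;> simp_all

theorem curveDef_II6_independent {v : Fin 6 → ℂ}
    (h : IsKTrivialAlong (m := 6) TableRow.II6.curve TableRow.II6.curveDef v) : v = 0 := by
  obtain ⟨ξ, b, hξ, hb, h⟩ := h
  have hQ : ∀ᶠ x : Fin 3 → ℂ in 𝓝 0, (Polynomial.C (v 5) * Polynomial.X ^ 4 +
      Polynomial.C (v 4) * Polynomial.X ^ 2 +
      Polynomial.C (v 3)).eval (x 2) =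
      -x 2 * ξ 0 x + 2 * x 1 * ξ 1 x - x 0 * ξ 2 x +
      b 0 0 x * (x 1 ^ 2 - x 0 * x 2) + b 0 1 x * (x 0 * x 1 - x 2 ^ (5 + 1)) := by
    filter_upwards [h] with x hx
    have h0 := eq_of_hasDerivAt_of_affine (c := x 1 ^ 2 - x 0 * x 2) (d := v 5 * x 2 ^ 4 + v 4 * x
      2 ^ 2 + v 3) (hx 0)
      (fun ε => by simp [TableRow.curveDef]; ring)
    simp (disch := fun_prop) [TableRow.curve, Fin.sum_univ_two, fderiv_apply_coord,
      fderiv_fun_pow, fderiv_fun_add, fderiv_fun_sub, fderiv_fun_mul] at h0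
    simp
    linear_combination h0
  have hP : ∀ᶠ x : Fin 3 → ℂ in 𝓝 0, -(Polynomial.C (v 2) * Polynomial.X ^ 4 +
      Polynomial.C (v 1) * Polynomial.X ^ 2 +
      Polynomial.C (v 0)).eval (x 2) =
      x 1 * ξ 0 x + x 0 * ξ 1 x - ((5 + 1 : ℕ) : ℂ) * x 2 ^ 5 * ξ 2 x +
      b 1 0 x * (x 1 ^ 2 - x 0 * x 2) + b 1 1 x * (x 0 * x 1 - x 2 ^ (5 + 1)) := by
    filter_upwards [h] with x hx
    have h0 := eq_of_hasDerivAt_of_affine (c := x 0 * x 1 - x 2 ^ 6) (d := -(v 2 * x 2 ^ 4 + v 1 *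
      x 2 ^ 2 + v 0)) (hx 1)
      (fun ε => by simp [TableRow.curveDef]; ring)
    simp (disch := fun_prop) [TableRow.curve, Fin.sum_univ_two, fderiv_apply_coord,
      fderiv_fun_pow, fderiv_fun_add, fderiv_fun_sub, fderiv_fun_mul] at h0
    simp
    linear_combination h0
  have key := fun (i : ℕ) (hi : i < 5) => curve_independence_of_pow hξ hb hQ hP hi
  have k0 := key 0 (by norm_num)
  have k1 := key 1 (by norm_num)
  have k2 := key 2 (by norm_num)
  have k3 := key 3 (by norm_num)
  have k4 := key 4 (by norm_num)
  simp [Polynomial.coeff_X, Polynomial.coeff_C, Polynomial.coeff_X_pow] at k0 k1 k2 k3 k4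
  ext i
  fin_cases i <;> simp_all

theorem curveDef_II5_independent {v : Fin 5 → ℂ}
    (h : IsKTrivialAlong (m := 5) TableRow.II5.curve TableRow.II5.curveDef v) : v = 0 := by
  obtain ⟨ξ, b, hξ, hb, h⟩ := h
  refine curve_independence_of_sq hξ hb ?_ ?_
  · filter_upwards [h] with x hx
    have h0 := eq_of_hasDerivAt_of_affine (c := x 1 ^ 2 - x 0 * x 2 + x 2 ^ 4) (d := v 4 * x 2 ^ 2
      + v 3) (hx 0)
      (fun ε => by simp [TableRow.curveDef]; ring)
    simp (disch := fun_prop) [TableRow.curve, Fin.sum_univ_two, fderiv_apply_coord,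
      fderiv_fun_pow, fderiv_fun_add, fderiv_fun_sub, fderiv_fun_mul] at h0
    linear_combination h0
  · filter_upwards [h] with x hx
    have h0 := eq_of_hasDerivAt_of_affine (c := x 0 * x 1) (d := -(v 2 * x 2 ^ 4 + v 1 * x 2 ^ 2 +
      v 0)) (hx 1)
      (fun ε => by simp [TableRow.curveDef]; ring)
    simp (disch := fun_prop) [TableRow.curve, Fin.sum_univ_two, fderiv_apply_coord,
      fderiv_fun_pow, fderiv_fun_add, fderiv_fun_sub, fderiv_fun_mul] at h0
    linear_combination h0

theorem curveDef_I_independent {k : ℕ} (hk : 1 ≤ k) {v : Fin (k + 1) → ℂ}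
    (h : IsKTrivialAlong (m := k + 1) (TableRow.I k hk).curve (TableRow.I k hk).curveDef v) : v =
      0 := by
  obtain ⟨ξ, b, hξ, hb, h⟩ := h
  obtain ⟨h1, h2⟩ := curve_independence_of_series hk hξ hb (c := v (Fin.last k))
    (P := ∑ i : Fin k, Polynomial.C (v i.castSucc) * Polynomial.X ^ (2 * (i : ℕ))) (by
    filter_upwards [h] with x hx
    have h0 := eq_of_hasDerivAt_of_affine (c := x 2 ^ 2 + 2 * x 1 * x 2 + x 0 ^ (2 * k))
      (d := ∑ i : Fin k, v i.castSucc * x 0 ^ (2 * (i : ℕ))) (hx 0)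
      (fun ε => by simp [TableRow.curveDef, Finset.mul_sum, mul_assoc])
    simp (disch := fun_prop) [TableRow.curve, Fin.sum_univ_two, fderiv_apply_coord,
      fderiv_fun_pow, fderiv_fun_add, fderiv_fun_sub, fderiv_fun_mul] at h0
    simp only [Polynomial.eval_finsetSum, Polynomial.eval_mul, Polynomial.eval_C,
      Polynomial.eval_pow, Polynomial.eval_X]
    linear_combination h0) (by
    filter_upwards [h] with x hx
    have h0 := eq_of_hasDerivAt_of_affine (c := x 0 * x 1) (d := -v (Fin.last k)) (hx 1)
      (fun ε => by simp [TableRow.curveDef]; ring)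
    simp (disch := fun_prop) [TableRow.curve, Fin.sum_univ_two, fderiv_apply_coord,
      fderiv_fun_pow, fderiv_fun_add, fderiv_fun_sub, fderiv_fun_mul] at h0
    linear_combination h0)
  exact eq_zero_of_coeff_sum_eq_zero (e := fun i => 2 * i) (fun i j h => by simpa using h) h1
    fun i hi => h2 _ (by omega)

theorem TableRow.curveDef_independent (r : TableRow) {v : Fin r.tau → ℂ}
    (h : IsKTrivialAlong r.curve r.curveDef v) : v = 0 := by
  cases r with
  | I k hk => exact curveDef_I_independent hk h
  | II4 => exact curveDef_II4_independent h
  | II5 => exact curveDef_II5_independent h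
  | II6 => exact curveDef_II6_independent h

end

/-! ### Differentials of polynomial families and conormal covectors -/

noncomputable section

open Polynomial

@[fun_prop]
theorem differentiableAt_eval_comp {E : Type*} [NormedAddCommGroup E] [NormedSpace ℂ E]
    (p : ℂ[X]) {g : E → ℂ} {x : E} (hg : DifferentiableAt ℂ g x) :
    DifferentiableAt ℂ (fun y => p.eval (g y)) x :=
  p.differentiableAt.comp x hg

theorem fderiv_eval_comp {E : Type*} [NormedAddCommGroup E] [NormedSpace ℂ E]
    (p : ℂ[X]) {g : E → ℂ} {x : E} (hg : DifferentiableAt ℂ g x) (v : E) :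
    fderiv ℂ (fun y => p.eval (g y)) x v = p.derivative.eval (g x) * fderiv ℂ g x v := by
  have := (p.hasDerivAt (g x)).comp_hasFDerivAt x hg.hasFDerivAt
  rw [show (fun y => p.eval (g y)) = (fun z => p.eval z) ∘ g from rfl, this.fderiv]
  rfl

theorem not_surjective_iff_exists_conormal {V : Type*} [NormedAddCommGroup V] [NormedSpace ℂ V]
    {q : ℕ} (L : V →L[ℂ] (Fin q → ℂ)) :
    ¬ Function.Surjective L ↔ ∃ μ : Fin q → ℂ, μ ≠ 0 ∧ ∀ v, ∑ i, μ i * L v i = 0 := by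
  constructor
  · intro h
    obtain ⟨φ, hφ, hker⟩ := Submodule.exists_le_ker_of_lt_top (LinearMap.range L.toLinearMap)
      (lt_top_iff_ne_top.2 fun h' => h (LinearMap.range_eq_top.1 h'))
    have hφs : ∀ y, φ y = ∑ i, φ (Pi.single i 1) * y i := fun y => by
      conv_lhs => rw [← Finset.univ_sum_single y, map_sum]
      refine Finset.sum_congr rfl fun i _ => ?_
      rw [show Pi.single i (y i) = y i • (Pi.single i 1 : Fin q → ℂ) by
        rw [← Pi.single_smul, smul_eq_mul, mul_one], map_smul, smul_eq_mul, mul_comm]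
    refine ⟨fun i => φ (Pi.single i 1), fun h0 => hφ ?_, fun v => ?_⟩
    · ext y
      simp [fun i => congrFun h0 i]
    · rw [← hφs]
      exact hker ⟨v, rfl⟩
  · rintro ⟨μ, hμ, h⟩ hs
    refine hμ (funext fun i => ?_)
    obtain ⟨v, hv⟩ := hs (Pi.single i 1)
    simpa [hv, Pi.single_apply] using h v

theorem isSingularPoint_iff_conormal {p q : ℕ} {g : (Fin p → ℂ) → (Fin q → ℂ)} {x : Fin p → ℂ}
    (hg : ∀ i, DifferentiableAt ℂ (fun y => g y i) x) :
    IsSingularPoint g x ↔ g x = 0 ∧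
      ∃ μ : Fin q → ℂ, μ ≠ 0 ∧ ∀ v, ∑ i, μ i * fderiv ℂ (fun y => g y i) x v = 0 := by
  rw [IsSingularPoint, not_surjective_iff_exists_conormal, fderiv_pi hg]
  rfl

/-! ## The series `II` -/

/-- Data of a degenerate point for the normal forms of type `II` given by the polynomials `p` and
`q`. -/
def IsDegenerateII (p q : ℂ[X]) (c s : ℂ) : Prop :=
  p.eval (c ^ 2) = 2 * c ^ 2 * s ^ 3 ∧ q.eval (c ^ 2) = -3 * c ^ 2 * s ^ 2 ∧
    p.derivative.eval (c ^ 2) + s * q.derivative.eval (c ^ 2) + s ^ 3 = 0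

/-- With `c = 0` the first two conditions are the hypotheses, and the third is a monic cubic
equation for `s`. -/
theorem exists_isDegenerateII_of_zero {p q : ℂ[X]} (hp : p.eval 0 = 0) (hq : q.eval 0 = 0) :
    ∃ c s, IsDegenerateII p q c s := by
  obtain ⟨s, hs⟩ := IsAlgClosed.exists_root
    (X ^ 3 + (C (q.derivative.eval 0) * X + C (p.derivative.eval 0))) (by
      rw [degree_add_eq_left_of_degree_lt] <;> rw [degree_X_pow]
      · decide
      · exact degree_linear_lt.trans_le (by norm_num))
  refine ⟨0, s, by simpa using hp, by simpa using hq, ?_⟩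
  simp only [IsRoot, eval_add, eval_pow, eval_X, eval_mul, eval_C] at hs
  rw [zero_pow two_ne_zero]
  linear_combination hs

/-- In the eliminations the third condition appears multiplied by `w`. If `w = 0`, the given `s` is
discarded and another one is chosen; otherwise `w` is cancelled and `c` is a square root of it. -/
theorem exists_isDegenerateII_of_sq {p q : ℂ[X]} {w s : ℂ} (hp : p.eval w = 2 * w * s ^ 3)
    (hq : q.eval w = -3 * w * s ^ 2)
    (hs : w * (p.derivative.eval w + s * q.derivative.eval w + s ^ 3) = 0) :
    ∃ c s, IsDegenerateII p q c s := by
  by_cases hw : w = 0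
  · subst hw
    exact exists_isDegenerateII_of_zero (by simpa using hp) (by simpa using hq)
  obtain ⟨c, rfl⟩ := IsAlgClosed.exists_pow_nat_eq w two_pos
  exact ⟨c, s, hp, hq, (mul_eq_zero.1 hs).resolve_left hw⟩

def matrixII (p q : ℂ[X]) (u : Fin 4 → ℂ) : Matrix (Fin 3) (Fin 3) ℂ :=
  !![u 0, p.eval (u 3), u 1 + q.eval (u 3); p.eval (u 3), u 1, u 2; u 1 + q.eval (u 3), u 2, u 3]

theorem isSymm_matrixII (p q : ℂ[X]) (u : Fin 4 → ℂ) : (matrixII p q u).IsSymm := by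
  ext i j
  fin_cases i <;> fin_cases j <;> rfl

/-- Orthogonality to the four coordinate directions leaves `S 0 1` and `S 0 2` as the only free
entries of the conormal matrix. If `S 0 1 = 0`, the equation `M S = 0` forces `w = 0` and `p(0) =
q(0) = 0`; otherwise `s = S 0 2 / S 0 1` and the same equation expresses `y`, `z`, `p(w)` and `q(w)`
through `w` and `s`. -/
theorem exists_isDegenerateII_of_notTransversalAt {p q : ℂ[X]} {u : Fin 4 → ℂ}
    (h : NotTransversalAt (matrixII p q) u) : ∃ c s, IsDegenerateII p q c s := by
  obtain ⟨S, hS0, hS, hmul, hv⟩ :=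
    (notTransversalAt_iff (.of_forall fun x => isSymm_matrixII p q x)).1 h
  have e0 := hv ![1, 0, 0, 0]
  have e1 := hv ![0, 1, 0, 0]
  have e2 := hv ![0, 0, 1, 0]
  have e3 := hv ![0, 0, 0, 1]
  simp (disch := fun_prop) [matrixII, Fin.sum_univ_three, fderiv_apply_coord, fderiv_fun_add,
    fderiv_eval_comp, hS.apply 0 1, hS.apply 0 2, hS.apply 1 2] at e0 e1 e2 e3
  have m00 := congrFun (congrFun hmul 0) 0
  have m10 := congrFun (congrFun hmul 1) 0
  have m20 := congrFun (congrFun hmul 2) 0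
  have m01 := congrFun (congrFun hmul 0) 1
  have m11 := congrFun (congrFun hmul 1) 1
  have m21 := congrFun (congrFun hmul 2) 1
  have m22 := congrFun (congrFun hmul 2) 2
  simp [matrixII, Matrix.mul_apply, Fin.sum_univ_three, hS.apply 0 1, hS.apply 0 2,
    hS.apply 1 2] at m00 m10 m20 m01 m11 m21 m22
  have d11 : S 1 1 = -2 * S 0 2 := by linear_combination e1
  have d12 : S 1 2 = 0 := e2
  have d22 : S 2 2 = -2 * (S 0 1 * p.derivative.eval (u 3) + S 0 2 * q.derivative.eval (u 3)) := by
    linear_combination e3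
  simp only [e0, d11, d12, d22, mul_zero, zero_add, add_zero] at m00 m10 m20 m01 m11 m21 m22
  by_cases hα : S 0 1 = 0
  · have hβ : S 0 2 ≠ 0 := fun hβ => hS0 (by
      ext i j
      fin_cases i <;> fin_cases j <;>
        simp [e0, d11, d12, d22, hα, hβ, hS.apply 0 1, hS.apply 0 2, hS.apply 1 2])
    simp [hα, hβ] at m00 m10 m20 m01 m11
    rw [m20] at m00 m01
    exact exists_isDegenerateII_of_zero m01 (by simpa [m11] using m00)
  · obtain ⟨s, hs⟩ : ∃ s, S 0 2 = s * S 0 1 := ⟨S 0 2 / S 0 1, by field_simp⟩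
    rw [hs] at m00 m10 m20 m01 m11 m21 m22
    have hz : u 2 = -s * u 3 := mul_right_cancel₀ hα (by linear_combination m20)
    have hy : u 1 = s ^ 2 * u 3 := mul_right_cancel₀ hα (by rw [hz] at m10; linear_combination m10)
    have hp : p.eval (u 3) = 2 * u 3 * s ^ 3 := mul_right_cancel₀ hα (by
      rw [hy] at m11; linear_combination m11)
    have hq : q.eval (u 3) = -3 * u 3 * s ^ 2 := mul_right_cancel₀ hα (by
      rw [hy, hz] at m21; linear_combination m21)
    refine exists_isDegenerateII_of_sq hp hq (mul_right_cancel₀ hα ?_)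
    rw [hy, hq] at m22
    linear_combination -1 / 2 * m22

theorem notTransversalAt_matrixII {p q : ℂ[X]} {c s : ℂ} (h : IsDegenerateII p q c s) :
    NotTransversalAt (matrixII p q) ![4 * s ^ 4 * c ^ 2, s ^ 2 * c ^ 2, -s * c ^ 2, c ^ 2] := by
  obtain ⟨h1, h2, h3⟩ := h
  refine (notTransversalAt_iff (.of_forall fun x => isSymm_matrixII p q x)).2
    -- The conormal matrix normalized by `S 0 1 = 1`; its last entry is `-2 (p' + s q')`, which the
    -- third condition turns into `2 s³`.
    ⟨!![0, 1, s; 1, -2 * s, 0; s, 0, 2 * s ^ 3], fun h => ?_, ?_, ?_, fun v => ?_⟩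
  · simpa using congrFun (congrFun h 0) 1
  · ext i j
    fin_cases i <;> fin_cases j <;> rfl
  · ext i j
    fin_cases i <;> fin_cases j <;>
      simp [matrixII, Matrix.mul_apply, Fin.sum_univ_three, h1, h2] <;> ring
  · simp (disch := fun_prop) [matrixII, Fin.sum_univ_three, fderiv_apply_coord, fderiv_fun_add,
      fderiv_eval_comp]
    linear_combination 2 * v 3 * h3

def oddII (p q : ℂ[X]) (x : Fin 2 → ℂ) : ℂ :=
  x 0 ^ 3 + x 0 * q.eval (x 1 ^ 2) + x 1 * p.eval (x 1 ^ 2)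

theorem isSingularZero_oddII_iff {p q : ℂ[X]} {x : Fin 2 → ℂ} :
    IsSingularZero (oddII p q) x ↔ oddII p q x = 0 ∧ 3 * x 0 ^ 2 + q.eval (x 1 ^ 2) = 0 ∧
      2 * x 0 * x 1 * q.derivative.eval (x 1 ^ 2) + p.eval (x 1 ^ 2) +
        2 * x 1 ^ 2 * p.derivative.eval (x 1 ^ 2) = 0 := by
  have hd : ∀ v, fderiv ℂ (oddII p q) x v = (3 * x 0 ^ 2 + q.eval (x 1 ^ 2)) * v 0 +
      (2 * x 0 * x 1 * q.derivative.eval (x 1 ^ 2) + p.eval (x 1 ^ 2) +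
        2 * x 1 ^ 2 * p.derivative.eval (x 1 ^ 2)) * v 1 := fun v => by
    unfold oddII
    simp (disch := fun_prop) [fderiv_apply_coord, fderiv_fun_add, fderiv_fun_mul, fderiv_fun_pow,
      fderiv_eval_comp]
    ring
  refine and_congr_right fun _ => ⟨fun h => ?_, fun h => ?_⟩
  · have h0 := hd (Pi.single 0 1)
    have h1 := hd (Pi.single 1 1)
    simp [h] at h0 h1
    exact ⟨h0.symm, h1.symm⟩
  · ext v
    rw [hd, h.1, h.2]
    simp

theorem exists_isDegenerateII_of_isSingularZero {p q : ℂ[X]} {x : Fin 2 → ℂ}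
    (h : IsSingularZero (oddII p q) x) : ∃ c s, IsDegenerateII p q c s := by
  obtain ⟨h0, h1, h2⟩ := isSingularZero_oddII_iff.1 h
  unfold oddII at h0
  by_cases hx : x 1 = 0
  · rw [hx] at h0 h1 h2
    simp only [ne_eq, OfNat.ofNat_ne_zero, not_false_eq_true, zero_pow, mul_zero, zero_mul,
      zero_add, add_zero] at h0 h1 h2
    refine exists_isDegenerateII_of_zero h2 ?_
    -- On the axis `c = 0`, the cubic `b³ + b q(0)` and its derivative can vanish together only at
    -- `b = 0`.
    have : x 0 ^ 3 = 0 := by linear_combination -1 / 2 * h0 + 1 / 2 * x 0 * h1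
    rw [pow_eq_zero_iff three_ne_zero] at this
    simpa [this] using h1
  · obtain ⟨s, hs⟩ : ∃ s, x 0 = s * x 1 := ⟨x 0 / x 1, by field_simp⟩
    rw [hs] at h0 h1 h2
    have hq : q.eval (x 1 ^ 2) = -3 * x 1 ^ 2 * s ^ 2 := by linear_combination h1
    have hp : p.eval (x 1 ^ 2) = 2 * x 1 ^ 2 * s ^ 3 := by
      refine mul_left_cancel₀ hx ?_
      linear_combination h0 - s * x 1 * hq
    exact exists_isDegenerateII_of_sq hp hq (by linear_combination 1 / 2 * (h2 - hp))

theorem isSingularZero_oddII {p q : ℂ[X]} {c s : ℂ} (h : IsDegenerateII p q c s) :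
    IsSingularZero (oddII p q) ![s * c, c] := by
  obtain ⟨h1, h2, h3⟩ := h
  refine isSingularZero_oddII_iff.2 ⟨?_, ?_, ?_⟩
  · simp [oddII, h1, h2]
    ring
  · simp [h2]
    ring
  · simp [h1]
    linear_combination 2 * c ^ 2 * h3

def curveII (p q : ℂ[X]) (x : Fin 3 → ℂ) : Fin 2 → ℂ :=
  ![x 1 ^ 2 - x 0 * x 2 + q.eval (x 2 ^ 2), x 0 * x 1 - p.eval (x 2 ^ 2)]

theorem isSingularPoint_curveII_iff {p q : ℂ[X]} {x : Fin 3 → ℂ} :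
    IsSingularPoint (curveII p q) x ↔ q.eval (x 2 ^ 2) = x 0 * x 2 - x 1 ^ 2 ∧
      p.eval (x 2 ^ 2) = x 0 * x 1 ∧ ∃ μ ν : ℂ, (μ ≠ 0 ∨ ν ≠ 0) ∧ -x 2 * μ + x 1 * ν = 0 ∧
      2 * x 1 * μ + x 0 * ν = 0 ∧
      (-x 0 + 2 * x 2 * q.derivative.eval (x 2 ^ 2)) * μ -
        2 * x 2 * p.derivative.eval (x 2 ^ 2) * ν = 0 := by
  rw [isSingularPoint_iff_conormal (by
    intro i; fin_cases i <;> simp [curveII] <;> fun_prop)]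
  have hd : ∀ (μ : Fin 2 → ℂ) v, ∑ i, μ i * fderiv ℂ (fun y => curveII p q y i) x v =
      (-x 2 * μ 0 + x 1 * μ 1) * v 0 + (2 * x 1 * μ 0 + x 0 * μ 1) * v 1 +
      ((-x 0 + 2 * x 2 * q.derivative.eval (x 2 ^ 2)) * μ 0 -
        2 * x 2 * p.derivative.eval (x 2 ^ 2) * μ 1) * v 2 := fun μ v => by
    simp (disch := fun_prop) [curveII, Fin.sum_univ_two, fderiv_apply_coord, fderiv_fun_add,
      fderiv_fun_sub, fderiv_fun_mul, fderiv_fun_pow, fderiv_eval_comp]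
    ring
  have h0 : curveII p q x = 0 ↔ q.eval (x 2 ^ 2) = x 0 * x 2 - x 1 ^ 2 ∧
      p.eval (x 2 ^ 2) = x 0 * x 1 := by
    rw [funext_iff, Fin.forall_fin_two]
    simp only [curveII, Matrix.cons_val_zero, Matrix.cons_val_one, Pi.zero_apply]
    refine and_congr ⟨fun h => ?_, fun h => ?_⟩ ⟨fun h => ?_, fun h => ?_⟩
    · linear_combination h
    · linear_combination h
    · linear_combination -h
    · linear_combination -h
  rw [h0, and_assoc]
  refine and_congr_right fun _ => and_congr_right fun _ => ⟨?_, ?_⟩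
  · rintro ⟨μ, hμ, h⟩
    have e0 := h (Pi.single 0 1)
    have e1 := h (Pi.single 1 1)
    have e2 := h (Pi.single 2 1)
    rw [hd] at e0 e1 e2
    refine ⟨μ 0, μ 1, ?_, by simpa using e0, by simpa using e1, by simpa using e2⟩
    by_contra! hcon
    exact hμ (funext (Fin.forall_fin_two.2 hcon))
  · rintro ⟨μ, ν, hμ, e0, e1, e2⟩
    refine ⟨![μ, ν], fun h => ?_, fun v => ?_⟩
    · have a0 : μ = 0 := congrFun h 0
      have a1 : ν = 0 := congrFun h 1
      tauto
    · rw [hd]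
      simp only [Matrix.cons_val_zero, Matrix.cons_val_one]
      rw [e0, e1, e2]
      simp

/-- A conormal covector `(μ, ν)` with `ν = 0` forces `b = c = 0`. Otherwise `s = -μ / ν`, and the
derivatives in `a` and `b` give `b = -s c` and `a = -2 s² c`. -/
theorem exists_isDegenerateII_of_isSingularPoint {p q : ℂ[X]} {x : Fin 3 → ℂ}
    (h : IsSingularPoint (curveII p q) x) : ∃ c s, IsDegenerateII p q c s := by
  obtain ⟨hq, hp, μ, ν, hμν, e0, e1, e2⟩ := isSingularPoint_curveII_iff.1 h
  by_cases hν : ν = 0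
  · subst hν
    have hμ : μ ≠ 0 := by tauto
    simp [hμ] at e0 e1
    rw [e0, e1] at hq hp
    exact exists_isDegenerateII_of_zero (by simpa using hp) (by simpa using hq)
  · obtain ⟨s, rfl⟩ : ∃ s, μ = -s * ν := ⟨-μ / ν, by field_simp⟩
    have hb : x 1 = -s * x 2 := mul_right_cancel₀ hν (by linear_combination e0)
    have ha : x 0 = -2 * s ^ 2 * x 2 := mul_right_cancel₀ hν (by
      rw [hb] at e1; linear_combination e1)
    have hc : x 2 * (p.derivative.eval (x 2 ^ 2) + s * q.derivative.eval (x 2 ^ 2) + s ^ 3) = 0 :=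
      mul_right_cancel₀ hν (by rw [ha] at e2; linear_combination -1 / 2 * e2)
    rw [ha, hb] at hq hp
    exact exists_isDegenerateII_of_sq (by rw [hp]; ring) (by rw [hq]; ring) (by
      linear_combination x 2 * hc)

theorem isSingularPoint_curveII {p q : ℂ[X]} {c s : ℂ} (h : IsDegenerateII p q c s) :
    IsSingularPoint (curveII p q) ![-2 * s ^ 2 * c, -s * c, c] := by
  obtain ⟨h1, h2, h3⟩ := h
  refine isSingularPoint_curveII_iff.2 ⟨?_, ?_, s, -1, by simp, ?_, ?_, ?_⟩
  · simp [h2]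
    ring
  · simp [h1]
    ring
  · simp
    ring
  · simp
    ring
  · simp
    linear_combination 2 * c * h3

end

noncomputable section

open Polynomial

/-! ## The series `I` -/

/-- Data of a degenerate point for the normal forms of type `I` given by the polynomial `p` and
the number `τ`. -/
def IsDegenerateI (p : ℂ[X]) (τ a c : ℂ) : Prop :=
  (a = 0 ∧ τ = 0 ∧ c ^ 2 = -p.eval 0) ∨
    (a ≠ 0 ∧ c ^ 2 = p.eval (a ^ 2) ∧ a ^ 2 * p.derivative.eval (a ^ 2) + c ^ 2 = 0 ∧ τ = -(a * c))

/-- The hyperplane `τ = 0` is contained in the diagram, since `c² = -p(0)` is always solvable. This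
absorbs all the special cases with `a = 0` below. -/
theorem exists_isDegenerateI_of_zero {p : ℂ[X]} {τ : ℂ} (h : τ = 0) :
    ∃ a c, IsDegenerateI p τ a c := by
  obtain ⟨c, hc⟩ := IsAlgClosed.exists_pow_nat_eq (-p.eval 0) two_pos
  exact ⟨0, c, .inl ⟨rfl, h, hc⟩⟩

def matrixI (p : ℂ[X]) (τ : ℂ) (u : Fin 4 → ℂ) : Matrix (Fin 3) (Fin 3) ℂ :=
  !![u 0, τ, u 2; τ, u 1 + p.eval (u 0), u 3; u 2, u 3, u 1]

theorem isSymm_matrixI (p : ℂ[X]) (τ : ℂ) (u : Fin 4 → ℂ) : (matrixI p τ u).IsSymm := by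
  ext i j
  fin_cases i <;> fin_cases j <;> rfl

theorem exists_isDegenerateI_of_notTransversalAt {p : ℂ[X]} {τ : ℂ} {u : Fin 4 → ℂ}
    (h : NotTransversalAt (matrixI p τ) u) : ∃ a c, IsDegenerateI p τ a c := by
  obtain ⟨S, hS0, hS, hmul, hv⟩ :=
    (notTransversalAt_iff (.of_forall fun x => isSymm_matrixI p τ x)).1 h
  have e0 := hv ![1, 0, 0, 0]
  have e1 := hv ![0, 1, 0, 0]
  have e2 := hv ![0, 0, 1, 0]
  have e3 := hv ![0, 0, 0, 1]
  simp (disch := fun_prop) [matrixI, Fin.sum_univ_three, fderiv_apply_coord, fderiv_fun_add,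
    fderiv_eval_comp, hS.apply 0 1, hS.apply 0 2, hS.apply 1 2] at e0 e1 e2 e3
  have m00 := congrFun (congrFun hmul 0) 0
  have m01 := congrFun (congrFun hmul 0) 1
  have m11 := congrFun (congrFun hmul 1) 1
  have m22 := congrFun (congrFun hmul 2) 2
  simp [matrixI, Matrix.mul_apply, Fin.sum_univ_three, hS.apply 0 1, hS.apply 0 2,
    hS.apply 1 2] at m00 m01 m11 m22
  have d00 : S 0 0 = -p.derivative.eval (u 0) * S 1 1 := by linear_combination e0
  have d22 : S 2 2 = -S 1 1 := by linear_combination e1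
  simp only [d00, e2, e3, d22, mul_zero, zero_add, add_zero] at m00 m01 m11 m22
  by_cases hs : S 1 1 = 0
  · have hr : S 0 1 ≠ 0 := fun hr => hS0 (by
      ext i j
      fin_cases i <;> fin_cases j <;>
        simp [d00, d22, e2, e3, hr, hs, hS.apply 0 1, hS.apply 0 2, hS.apply 1 2])
    simp [hs, hr] at m00
    exact exists_isDegenerateI_of_zero m00
  · obtain ⟨r, hr⟩ : ∃ r, S 0 1 = r * S 1 1 := ⟨S 0 1 / S 1 1, by field_simp⟩
    rw [hr] at m00 m01 m11
    have hy : u 1 = 0 := by simpa [hs] using m22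
    have hτ : τ = -(u 0 * r) := mul_right_cancel₀ hs (by linear_combination m01)
    have hp : p.eval (u 0) = u 0 * r ^ 2 := mul_right_cancel₀ hs (by
      rw [hy, hτ] at m11; linear_combination m11)
    have hd : u 0 * (p.derivative.eval (u 0) + r ^ 2) = 0 := mul_right_cancel₀ hs (by
      rw [hτ] at m00; linear_combination -m00)
    by_cases hx : u 0 = 0
    · exact exists_isDegenerateI_of_zero (by simp [hτ, hx])
    -- The data are recovered from `x = a²` and `c = r a`, where `r = S 0 1 / S 1 1`.
    · obtain ⟨a, ha⟩ := IsAlgClosed.exists_pow_nat_eq (u 0) two_pos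
      rw [← ha] at hτ hp hd
      refine ⟨a, r * a, .inr ⟨fun h => hx (by simp [← ha, h]), ?_, ?_, ?_⟩⟩
      · rw [hp]
        ring
      · linear_combination hd
      · rw [hτ]
        ring

theorem notTransversalAt_matrixI_of_zero (p : ℂ[X]) :
    NotTransversalAt (matrixI p 0) ![0, -p.eval 0, 0, 0] := by
  refine (notTransversalAt_iff (.of_forall fun x => isSymm_matrixI p 0 x)).2
    ⟨!![0, 1, 0; 1, 0, 0; 0, 0, 0], fun h => ?_, ?_, ?_, fun v => ?_⟩
  · simpa using congrFun (congrFun h 0) 1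
  · ext i j
    fin_cases i <;> fin_cases j <;> rfl
  · ext i j
    fin_cases i <;> fin_cases j <;> simp [matrixI, Matrix.mul_apply, Fin.sum_univ_three]
  · simp (disch := fun_prop) [matrixI, Fin.sum_univ_three, fderiv_apply_coord]

theorem notTransversalAt_matrixI {p : ℂ[X]} {a c : ℂ} (ha : a ≠ 0) (h1 : c ^ 2 = p.eval (a ^ 2))
    (h2 : a ^ 2 * p.derivative.eval (a ^ 2) + c ^ 2 = 0) :
    NotTransversalAt (matrixI p (-(a * c))) ![a ^ 2, 0, 0, 0] := by
  obtain ⟨r, rfl⟩ : ∃ r, c = r * a := ⟨c / a, by field_simp⟩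
  have hd : p.derivative.eval (a ^ 2) = -r ^ 2 :=
    mul_left_cancel₀ (pow_ne_zero 2 ha) (by linear_combination h2)
  refine (notTransversalAt_iff (.of_forall fun x => isSymm_matrixI p _ x)).2
    ⟨!![r ^ 2, r, 0; r, 1, 0; 0, 0, -1], fun h => ?_, ?_, ?_, fun v => ?_⟩
  · simpa using congrFun (congrFun h 1) 1
  · ext i j
    fin_cases i <;> fin_cases j <;> rfl
  · ext i j
    fin_cases i <;> fin_cases j <;>
      simp [matrixI, Matrix.mul_apply, Fin.sum_univ_three, ← h1] <;> ring
  · simp (disch := fun_prop) [matrixI, Fin.sum_univ_three, fderiv_apply_coord, fderiv_fun_add,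
      fderiv_eval_comp, hd]

def oddI (p : ℂ[X]) (τ : ℂ) (x : Fin 2 → ℂ) : ℂ :=
  x 0 * x 1 ^ 2 + x 0 * p.eval (x 0 ^ 2) + τ * x 1

theorem isSingularZero_oddI_iff {p : ℂ[X]} {τ : ℂ} {x : Fin 2 → ℂ} :
    IsSingularZero (oddI p τ) x ↔ oddI p τ x = 0 ∧
      x 1 ^ 2 + p.eval (x 0 ^ 2) + 2 * x 0 ^ 2 * p.derivative.eval (x 0 ^ 2) = 0 ∧
      2 * x 0 * x 1 + τ = 0 := by
  have hd : ∀ v, fderiv ℂ (oddI p τ) x v =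
      (x 1 ^ 2 + p.eval (x 0 ^ 2) + 2 * x 0 ^ 2 * p.derivative.eval (x 0 ^ 2)) * v 0 +
      (2 * x 0 * x 1 + τ) * v 1 := fun v => by
    unfold oddI
    simp (disch := fun_prop) [fderiv_apply_coord, fderiv_fun_add, fderiv_fun_mul, fderiv_fun_pow,
      fderiv_eval_comp]
    ring
  refine and_congr_right fun _ => ⟨fun h => ?_, fun h => ?_⟩
  · have h0 := hd ![1, 0]
    have h1 := hd ![0, 1]
    simp [h] at h0 h1
    exact ⟨h0.symm, h1.symm⟩
  · ext v
    rw [hd, h.1, h.2]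
    simp

/-- The factor `2` arises because the derivative of `a c²` in `c` gives `2ac` plus the coefficient
of `c`, whereas the matrix and the curve give `τ = -ac`. -/
theorem exists_isDegenerateI_of_isSingularZero {p : ℂ[X]} {τ : ℂ} {x : Fin 2 → ℂ}
    (h : IsSingularZero (oddI p (2 * τ)) x) : ∃ a c, IsDegenerateI p τ a c := by
  obtain ⟨h0, h1, h2⟩ := isSingularZero_oddI_iff.1 h
  have hτ : τ = -(x 0 * x 1) := by linear_combination 1 / 2 * h2
  by_cases hx : x 0 = 0
  · exact exists_isDegenerateI_of_zero (by simp [hτ, hx])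
  · have hp : x 1 ^ 2 = p.eval (x 0 ^ 2) := mul_left_cancel₀ hx (by
      unfold oddI at h0
      rw [hτ] at h0
      linear_combination -h0)
    exact ⟨x 0, x 1, .inr ⟨hx, hp, by linear_combination 1 / 2 * (h1 + hp), hτ⟩⟩

theorem isSingularZero_oddI {p : ℂ[X]} {τ a c : ℂ} (h : IsDegenerateI p τ a c) :
    IsSingularZero (oddI p (2 * τ)) ![a, c] := by
  refine isSingularZero_oddI_iff.2 ?_
  obtain ⟨rfl, rfl, h⟩ | ⟨ha, h1, h2, rfl⟩ := h
  · simp [oddI, h]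
  · simp only [oddI, Matrix.cons_val_zero, Matrix.cons_val_one, ← h1]
    exact ⟨by ring, by linear_combination 2 * h2, by ring⟩

def curveI (p : ℂ[X]) (τ : ℂ) (x : Fin 3 → ℂ) : Fin 2 → ℂ :=
  ![x 2 ^ 2 + 2 * x 1 * x 2 + p.eval (x 0 ^ 2), x 0 * x 1 - τ]

theorem isSingularPoint_curveI_iff {p : ℂ[X]} {τ : ℂ} {x : Fin 3 → ℂ} :
    IsSingularPoint (curveI p τ) x ↔ x 2 ^ 2 + 2 * x 1 * x 2 + p.eval (x 0 ^ 2) = 0 ∧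
      τ = x 0 * x 1 ∧ ∃ μ ν : ℂ, (μ ≠ 0 ∨ ν ≠ 0) ∧
      2 * x 0 * p.derivative.eval (x 0 ^ 2) * μ + x 1 * ν = 0 ∧
      2 * x 2 * μ + x 0 * ν = 0 ∧ (x 1 + x 2) * μ = 0 := by
  rw [isSingularPoint_iff_conormal (by
    intro i; fin_cases i <;> simp [curveI] <;> fun_prop)]
  have hd : ∀ (μ : Fin 2 → ℂ) v, ∑ i, μ i * fderiv ℂ (fun y => curveI p τ y i) x v =
      (2 * x 0 * p.derivative.eval (x 0 ^ 2) * μ 0 + x 1 * μ 1) * v 0 +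
      (2 * x 2 * μ 0 + x 0 * μ 1) * v 1 + 2 * ((x 1 + x 2) * μ 0) * v 2 := fun μ v => by
    simp (disch := fun_prop) [curveI, Fin.sum_univ_two, fderiv_apply_coord, fderiv_fun_add,
      fderiv_fun_sub, fderiv_fun_mul, fderiv_fun_pow, fderiv_eval_comp]
    ring
  have h0 : curveI p τ x = 0 ↔ x 2 ^ 2 + 2 * x 1 * x 2 + p.eval (x 0 ^ 2) = 0 ∧
      τ = x 0 * x 1 := by
    rw [funext_iff, Fin.forall_fin_two]
    simp only [curveI, Matrix.cons_val_zero, Matrix.cons_val_one, Pi.zero_apply, sub_eq_zero]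
    rw [eq_comm (a := τ)]
  rw [h0, and_assoc]
  refine and_congr_right fun _ => and_congr_right fun _ => ⟨?_, ?_⟩
  · rintro ⟨μ, hμ, h⟩
    have e0 := h ![1, 0, 0]
    have e1 := h ![0, 1, 0]
    have e2 := h ![0, 0, 1]
    rw [hd] at e0 e1 e2
    refine ⟨μ 0, μ 1, ?_, by simpa using e0, by simpa using e1, by simpa using e2⟩
    by_contra! hcon
    exact hμ (funext (Fin.forall_fin_two.2 hcon))
  · rintro ⟨μ, ν, hμ, e0, e1, e2⟩
    refine ⟨![μ, ν], fun h => ?_, fun v => ?_⟩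
    · have a0 : μ = 0 := congrFun h 0
      have a1 : ν = 0 := congrFun h 1
      tauto
    · rw [hd]
      simp only [Matrix.cons_val_zero, Matrix.cons_val_one]
      rw [e0, e1, e2]
      simp

theorem exists_isDegenerateI_of_isSingularPoint {p : ℂ[X]} {τ : ℂ} {x : Fin 3 → ℂ}
    (h : IsSingularPoint (curveI p τ) x) : ∃ a c, IsDegenerateI p τ a c := by
  obtain ⟨hp, hτ, μ, ν, hμν, e0, e1, e2⟩ := isSingularPoint_curveI_iff.1 h
  by_cases hx : x 0 = 0
  · exact exists_isDegenerateI_of_zero (by simp [hτ, hx])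
  have hμ : μ ≠ 0 := by
    rintro rfl
    simp [hx] at e1
    tauto
  have hb : x 1 = -x 2 := eq_neg_of_add_eq_zero_left ((mul_eq_zero.1 e2).resolve_right hμ)
  rw [hb] at hp hτ e0
  refine ⟨x 0, x 2, .inr ⟨hx, by linear_combination -hp, mul_right_cancel₀ hμ ?_, by rw [hτ]; ring⟩⟩
  -- Eliminates `ν`, using `b = -c`.
  linear_combination 1 / 2 * (x 0 * e0 + x 2 * e1)

theorem isSingularPoint_curveI_of_zero {p : ℂ[X]} {c : ℂ} (h : c ^ 2 = -p.eval 0) :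
    IsSingularPoint (curveI p 0) ![0, 0, c] := by
  refine isSingularPoint_curveI_iff.2 ⟨?_, ?_, 0, 1, by simp, ?_, ?_, ?_⟩ <;> simp [h]

theorem isSingularPoint_curveI {p : ℂ[X]} {a c : ℂ} (ha : a ≠ 0) (h1 : c ^ 2 = p.eval (a ^ 2))
    (h2 : a ^ 2 * p.derivative.eval (a ^ 2) + c ^ 2 = 0) :
    IsSingularPoint (curveI p (-(a * c))) ![a, -c, c] := by
  refine isSingularPoint_curveI_iff.2 ⟨?_, ?_, a, -2 * c, by simp [ha], ?_, ?_, ?_⟩ <;> simp [← h1]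
  · ring
  · linear_combination 2 * h2
  · ring

end

noncomputable section

open Polynomial

/-! ## Smallness of the degenerate points -/

/-- If `‖z‖ ≥ ε` and the coefficients are below `ε ^ n / (n + 1)` with `ε ≤ 1`, each of the `n`
lower terms is at most `‖z‖ ^ n / (n + 1)`, so they cannot cancel the leading term. -/
theorem eventually_root_mem (n : ℕ) {U : Set ℂ} (hU : U ∈ 𝓝 (0 : ℂ)) :
    ∀ᶠ c : Fin n → ℂ in 𝓝 0, ∀ z, z ^ n + ∑ i, c i * z ^ (i : ℕ) = 0 → z ∈ U := by
  obtain ⟨δ, hδ, hδU⟩ := Metric.mem_nhds_iff.1 hU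
  set ε := min δ 1 with hεdef
  have hε : 0 < ε := lt_min hδ one_pos
  have hη : 0 < ε ^ n / (n + 1) := by positivity
  filter_upwards [Metric.ball_mem_nhds (0 : Fin n → ℂ) hη] with c hc z hz
  refine hδU (mem_ball_zero_iff.2 ?_)
  by_contra! hlt
  have hεz : ε ≤ ‖z‖ := (min_le_left _ _).trans hlt
  have hz0 : 0 < ‖z‖ := hε.trans_le hεz
  have hterm : ∀ i : Fin n, ‖c i * z ^ (i : ℕ)‖ ≤ ‖z‖ ^ n / (n + 1) := fun i => by
    have hci : ‖c i‖ ≤ ε ^ n / (n + 1) := (norm_le_pi_norm c i).trans (mem_ball_zero_iff.1 hc).le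
    have hpow : ε ^ n ≤ ‖z‖ ^ (n - i : ℕ) :=
      (pow_le_pow_of_le_one hε.le (min_le_right _ _) (Nat.sub_le _ _)).trans
        (pow_le_pow_left₀ hε.le hεz _)
    calc ‖c i * z ^ (i : ℕ)‖ = ‖c i‖ * ‖z‖ ^ (i : ℕ) := by rw [norm_mul, norm_pow]
      _ ≤ ‖z‖ ^ (n - i : ℕ) / (n + 1) * ‖z‖ ^ (i : ℕ) := by
        gcongr
        exact hci.trans (by gcongr)
      _ = ‖z‖ ^ n / (n + 1) := by
        rw [div_mul_eq_mul_div, ← pow_add, Nat.sub_add_cancel i.2.le]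
  have hle : ‖z‖ ^ n ≤ n * (‖z‖ ^ n / (n + 1)) := by
    calc ‖z‖ ^ n = ‖∑ i, c i * z ^ (i : ℕ)‖ := by
          rw [← norm_pow, eq_neg_of_add_eq_zero_left hz, norm_neg]
      _ ≤ ∑ i : Fin n, ‖z‖ ^ n / (n + 1) :=
        (norm_sum_le _ _).trans (Finset.sum_le_sum fun i _ => hterm i)
      _ = n * (‖z‖ ^ n / (n + 1)) := by simp
  rw [mul_div_assoc', le_div_iff₀ (by positivity)] at hle
  have : 0 < ‖z‖ ^ n := by positivity
  linarith

theorem eventually_of_sq_mem {U : Set ℂ} (hU : U ∈ 𝓝 (0 : ℂ)) :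
    ∀ᶠ w in 𝓝 (0 : ℂ), ∀ z, z ^ 2 = w → z ∈ U := by
  have hc : ContinuousAt (fun w : ℂ => ![-w, 0]) 0 :=
    Continuous.continuousAt (continuous_pi fun i => by fin_cases i <;> simp <;> fun_prop)
  have := eventually_comp_of_map_zero hc (by simp) (eventually_root_mem 2 hU)
  filter_upwards [this] with w hw z hz
  exact hw z (by simp [hz])

/-- Eliminating `s` from the first two conditions gives `27 w p² + 4 q³ = 0` at `w = c²`; this is,
up to sign, the discriminant of `b³ + b q + c p` in `b`. Once `w` is small, `s` is a root of the
monic cubic `s³ + q'(w) s + p'(w)` with small coefficients. -/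
theorem eventually_isDegenerateII_mem {m : ℕ} {p q : (Fin m → ℂ) → ℂ[X]}
    (hw : ∀ U ∈ 𝓝 (0 : ℂ), ∀ᶠ t in 𝓝 0, ∀ w,
      27 * w * (p t).eval w ^ 2 + 4 * (q t).eval w ^ 3 = 0 → w ∈ U)
    (hp : Tendsto (fun z : ℂ × (Fin m → ℂ) => (p z.2).derivative.eval z.1) (𝓝 0) (𝓝 0))
    (hq : Tendsto (fun z : ℂ × (Fin m → ℂ) => (q z.2).derivative.eval z.1) (𝓝 0) (𝓝 0))
    {U : Set (ℂ × ℂ)} (hU : U ∈ 𝓝 0) :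
    ∀ᶠ t in 𝓝 0, ∀ c s, IsDegenerateII (p t) (q t) c s → (c, s) ∈ U := by
  obtain ⟨V, hV, W, hW, hVW⟩ := mem_nhds_prod_iff.1 hU
  have h1 : Tendsto (fun z : ℂ × (Fin m → ℂ) =>
      ![(p z.2).derivative.eval z.1, (q z.2).derivative.eval z.1, 0]) (𝓝 0) (𝓝 0) := by
    rw [tendsto_pi_nhds]
    intro i
    fin_cases i
    · exact hp
    · exact hq
    · exact tendsto_const_nhds
  have h2 := h1.eventually (eventually_root_mem 3 hW)
  obtain ⟨V', hV', T, hT, hVT⟩ := mem_nhds_prod_iff.1 h2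
  obtain ⟨V'', hV'', hV''V⟩ := (eventually_of_sq_mem hV).exists_mem
  filter_upwards [hw _ (inter_mem hV' hV''), hT] with t ht htT c s h
  obtain ⟨e1, e2, e3⟩ := h
  have hc := ht (c ^ 2) (by rw [e1, e2]; ring)
  refine hVW ⟨hV''V _ hc.2 c rfl, ?_⟩
  refine hVT (Set.mk_mem_prod hc.1 htT) s ?_
  simp [Fin.sum_univ_three]
  linear_combination e3

/-- The normalized polynomial `Xᵏ + ∑ tᵢ Xⁱ`. -/
def polyI (k : ℕ) (t : Fin (k + 1) → ℂ) : ℂ[X] :=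
  X ^ k + ∑ i : Fin k, C (t i.castSucc) * X ^ (i : ℕ)

theorem eval_polyI (k : ℕ) (t : Fin (k + 1) → ℂ) (z : ℂ) :
    (polyI k t).eval z = z ^ k + ∑ i : Fin k, t i.castSucc * z ^ (i : ℕ) := by
  simp [polyI, eval_finsetSum]

theorem mul_eval_derivative_polyI (k : ℕ) (t : Fin (k + 1) → ℂ) (z : ℂ) :
    z * (polyI k t).derivative.eval z =
      k * z ^ k + ∑ i : Fin k, (i : ℕ) * t i.castSucc * z ^ (i : ℕ) := by
  have h : ∀ n : ℕ, z * (n * z ^ (n - 1)) = n * z ^ n := fun n => by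
    cases n with
    | zero => simp
    | succ n => rw [Nat.add_sub_cancel, pow_succ]; ring
  simp only [polyI, derivative_add, derivative_X_pow, derivative_sum, derivative_C_mul, eval_add,
    eval_mul, eval_C, eval_pow, eval_X, eval_finsetSum, mul_add, h, Finset.mul_sum]
  congr 1
  refine Finset.sum_congr rfl fun i _ => ?_
  rw [← mul_assoc, mul_comm z, mul_assoc, h]
  ring

/-- For `a ≠ 0` the conditions make `a²` a root of `p + X p'`, whose leading coefficient is `k + 1`;
after division its lower coefficients are `(i + 1) t_i / (k + 1)`. Then `c²`, which is `p(a²)` or,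
on the branch `a = 0`, `-p(0)`, is small as well. -/
theorem eventually_isDegenerateI_mem {k : ℕ} (hk : 1 ≤ k) {U : Set (ℂ × ℂ)} (hU : U ∈ 𝓝 0) :
    ∀ᶠ t : Fin (k + 1) → ℂ in 𝓝 0, ∀ a c,
      IsDegenerateI (polyI k t) (t (Fin.last k)) a c → (a, c) ∈ U := by
  obtain ⟨V, hV, W, hW, hVW⟩ := mem_nhds_prod_iff.1 hU
  obtain ⟨W', hW', hW'W⟩ := (eventually_of_sq_mem hW).exists_mem
  obtain ⟨V'', hV'', hV''V⟩ := (eventually_of_sq_mem hV).exists_mem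
  have hk0 : k ≠ 0 := by omega
  have hev : ∀ᶠ z : ℂ × (Fin (k + 1) → ℂ) in 𝓝 0, (polyI k z.2).eval z.1 ∈ W' ∧
      -(polyI k z.2).eval z.1 ∈ W' := by
    have hc : Continuous fun z : ℂ × (Fin (k + 1) → ℂ) => (polyI k z.2).eval z.1 := by
      simp only [eval_polyI]
      fun_prop
    have h0 : (polyI k (0 : ℂ × (Fin (k + 1) → ℂ)).2).eval (0 : ℂ × (Fin (k + 1) → ℂ)).1 = 0 := by
      simp [eval_polyI, hk0]
    exact ((hc.tendsto' 0 0 h0).eventually hW').and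
      ((hc.neg.tendsto' 0 0 (neg_eq_zero.2 h0)).eventually hW')
  obtain ⟨V', hV', T, hT, hVT⟩ := mem_nhds_prod_iff.1 hev
  have hroot : ∀ᶠ t : Fin (k + 1) → ℂ in 𝓝 0, ∀ z,
      (polyI k t).eval z + z * (polyI k t).derivative.eval z = 0 → z ∈ V' ∩ V'' := by
    have hc : ContinuousAt (fun (t : Fin (k + 1) → ℂ) (i : Fin k) =>
        ((i : ℕ) + 1 : ℂ) / (k + 1) * t i.castSucc) 0 :=
      (continuous_pi fun i => continuous_const.mul (continuous_apply _)).continuousAt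
    have := eventually_comp_of_map_zero hc (by ext; simp) (eventually_root_mem k
      (inter_mem hV' hV''))
    filter_upwards [this] with t ht z hz
    have hk1 : (k + 1 : ℂ) ≠ 0 := by exact_mod_cast k.succ_ne_zero
    refine ht z (mul_left_cancel₀ hk1 ?_)
    rw [eval_polyI, mul_eval_derivative_polyI] at hz
    rw [mul_zero, ← hz, mul_add, Finset.mul_sum]
    rw [show z ^ k + ∑ i : Fin k, t i.castSucc * z ^ (i : ℕ) +
      (k * z ^ k + ∑ i : Fin k, (i : ℕ) * t i.castSucc * z ^ (i : ℕ)) = (k + 1) * z ^ k +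
      (∑ i : Fin k, t i.castSucc * z ^ (i : ℕ) +
        ∑ i : Fin k, (i : ℕ) * t i.castSucc * z ^ (i : ℕ)) by ring, ← Finset.sum_add_distrib]
    congr 1
    refine Finset.sum_congr rfl fun i _ => ?_
    field_simp
    ring
  filter_upwards [hroot, hT] with t ht htT a c h
  obtain ⟨rfl, -, h⟩ | ⟨-, h1, h2, -⟩ := h
  · exact hVW ⟨mem_of_mem_nhds hV, hW'W _ (hVT (Set.mk_mem_prod (mem_of_mem_nhds hV') htT)).2 c h⟩
  · have ha := ht (a ^ 2) (by rw [← h1]; linear_combination h2)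
    exact hVW ⟨hV''V _ ha.2 a rfl, hW'W _ (hVT (Set.mk_mem_prod ha.1 htT)).1 c h1⟩

/-- `S` is the global bifurcation diagram and also represents its germ at the origin. -/
def IsDiagram {s m : ℕ} (bad : (Fin s → ℂ) → (Fin m → ℂ) → Prop) (S : Set (Fin m → ℂ)) : Prop :=
  bifurcationSet bad = S ∧ RepresentsDiagram bad S

/-- For small parameters all the data `(a, c)` are small and yield degenerate points in any given
neighbourhood, so the whole space can serve as the reference neighbourhood and the global set
represents the germ. -/
theorem isDiagram_of_small {s m : ℕ} {bad : (Fin s → ℂ) → (Fin m → ℂ) → Prop}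
    {D : ℂ → ℂ → (Fin m → ℂ) → Prop} (hsmall : ∀ U ∈ 𝓝 (0 : ℂ × ℂ), ∀ᶠ t in 𝓝 0,
      ∀ a c, D a c t → (a, c) ∈ U) (h1 : ∀ u t, bad u t → ∃ a c, D a c t)
    (h2 : ∀ a c t, D a c t → ∃ u, bad u t)
    (h3 : ∀ U ∈ 𝓝 (0 : Fin s → ℂ), ∀ᶠ x : ℂ × ℂ in 𝓝 0, ∀ t, D x.1 x.2 t → ∃ u ∈ U, bad u t) :
    IsDiagram bad {t | ∃ a c, D a c t} := by
  constructor
  · ext t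
    exact ⟨fun ⟨u, hu⟩ => h1 u t hu, fun ⟨a, c, h⟩ => h2 a c t h⟩
  · refine ⟨Set.univ, univ_mem, fun U hU _ => ?_⟩
    filter_upwards [hsmall _ (h3 U hU)] with t ht
    exact ⟨fun ⟨a, c, h⟩ => ht a c h t h, fun ⟨u, _, hu⟩ => h1 u t hu⟩

theorem isDiagram_of_small_of_continuous {s m : ℕ} {bad : (Fin s → ℂ) → (Fin m → ℂ) → Prop}
    {D : ℂ → ℂ → (Fin m → ℂ) → Prop} (hsmall : ∀ U ∈ 𝓝 (0 : ℂ × ℂ), ∀ᶠ t in 𝓝 0,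
      ∀ a c, D a c t → (a, c) ∈ U) (h1 : ∀ u t, bad u t → ∃ a c, D a c t)
    {pt : ℂ × ℂ → (Fin s → ℂ)} (hpt : ∀ i, Continuous fun x => pt x i) (hpt0 : ∀ i, pt 0 i = 0)
    (h2 : ∀ a c t, D a c t → bad (pt (a, c)) t) : IsDiagram bad {t | ∃ a c, D a c t} := by
  refine isDiagram_of_small hsmall h1 (fun a c t h => ⟨_, h2 a c t h⟩) fun U hU => ?_
  filter_upwards [((continuous_pi hpt).tendsto' 0 0 (funext hpt0)).eventually hU] with x hx t h
  exact ⟨_, hx, h2 _ _ t h⟩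

end

/-! ### Diagrams of the polynomial families and of the listed deformations -/

noncomputable section

open Polynomial

/-- The scaling of the coordinates by non-zero numbers. -/
def diagScale {m : ℕ} (a : Fin m → ℂˣ) : (Fin m → ℂ) ≃L[ℂ] (Fin m → ℂ) :=
  ContinuousLinearEquiv.piCongrRight fun i => ContinuousLinearEquiv.unitsEquivAut ℂ (a i)

@[simp] theorem diagScale_apply {m : ℕ} (a : Fin m → ℂˣ) (t : Fin m → ℂ) (i : Fin m) :
    diagScale a t i = t i * a i := rfl

theorem isDiagram_matrixI {k : ℕ} (hk : 1 ≤ k) :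
    IsDiagram (fun (u : Fin 4 → ℂ) (t : Fin (k + 1) → ℂ) =>
      NotTransversalAt (matrixI (polyI k t) (t (Fin.last k))) u)
      {t | ∃ a c, IsDegenerateI (polyI k t) (t (Fin.last k)) a c} := by
  refine isDiagram_of_small (D := fun a c t => IsDegenerateI (polyI k t) (t (Fin.last k)) a c)
    (fun U hU => eventually_isDegenerateI_mem hk hU)
    (fun u t h => exists_isDegenerateI_of_notTransversalAt h) ?_ ?_
  · rintro a c t (⟨rfl, h0, h⟩ | ⟨ha, h1, h2, h0⟩)
    · exact ⟨_, by rw [h0]; exact notTransversalAt_matrixI_of_zero _⟩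
    · exact ⟨_, by rw [h0]; exact notTransversalAt_matrixI ha h1 h2⟩
  · intro U hU
    -- The two branches of `IsDegenerateI` have different degenerate points; on the first one `y =
    -- -p(0) = c²`.
    have c1 : Continuous fun x : ℂ × ℂ => (![0, x.2 ^ 2, 0, 0] : Fin 4 → ℂ) :=
      continuous_pi fun i => by fin_cases i <;> simp <;> fun_prop
    have c2 : Continuous fun x : ℂ × ℂ => (![x.1 ^ 2, 0, 0, 0] : Fin 4 → ℂ) :=
      continuous_pi fun i => by fin_cases i <;> simp <;> fun_prop
    filter_upwards [(c1.tendsto' 0 0 (by simp)).eventually hU,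
      (c2.tendsto' 0 0 (by simp)).eventually hU] with x hx1 hx2 t h
    obtain ⟨ha, h0, h⟩ | ⟨ha, h1, h2, h0⟩ := h
    · exact ⟨_, hx1, by rw [h0, h]; exact notTransversalAt_matrixI_of_zero _⟩
    · exact ⟨_, hx2, by rw [h0]; exact notTransversalAt_matrixI ha h1 h2⟩

theorem isDiagram_curveI {k : ℕ} (hk : 1 ≤ k) :
    IsDiagram (fun (x : Fin 3 → ℂ) (t : Fin (k + 1) → ℂ) =>
      IsSingularPoint (curveI (polyI k t) (t (Fin.last k))) x)
      {t | ∃ a c, IsDegenerateI (polyI k t) (t (Fin.last k)) a c} := by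
  refine isDiagram_of_small (D := fun a c t => IsDegenerateI (polyI k t) (t (Fin.last k)) a c)
    (fun U hU => eventually_isDegenerateI_mem hk hU)
    (fun u t h => exists_isDegenerateI_of_isSingularPoint h) ?_ ?_
  · rintro a c t (⟨rfl, h0, h⟩ | ⟨ha, h1, h2, h0⟩)
    · exact ⟨_, by rw [h0]; exact isSingularPoint_curveI_of_zero h⟩
    · exact ⟨_, by rw [h0]; exact isSingularPoint_curveI ha h1 h2⟩
  · intro U hU
    have c1 : Continuous fun x : ℂ × ℂ => (![0, 0, x.2] : Fin 3 → ℂ) :=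
      continuous_pi fun i => by fin_cases i <;> simp <;> fun_prop
    have c2 : Continuous fun x : ℂ × ℂ => (![x.1, -x.2, x.2] : Fin 3 → ℂ) :=
      continuous_pi fun i => by fin_cases i <;> simp <;> fun_prop
    filter_upwards [(c1.tendsto' 0 0 (by simp)).eventually hU,
      (c2.tendsto' 0 0 (by simp)).eventually hU] with x hx1 hx2 t h
    obtain ⟨ha, h0, h⟩ | ⟨ha, h1, h2, h0⟩ := h
    · exact ⟨_, hx1, by rw [h0]; exact isSingularPoint_curveI_of_zero h⟩
    · exact ⟨_, hx2, by rw [h0]; exact isSingularPoint_curveI ha h1 h2⟩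

theorem isDiagram_oddI {k : ℕ} (hk : 1 ≤ k) :
    IsDiagram (fun (x : Fin 2 → ℂ) (t : Fin (k + 1) → ℂ) =>
      IsSingularZero (oddI (polyI k t) (2 * t (Fin.last k))) x)
      {t | ∃ a c, IsDegenerateI (polyI k t) (t (Fin.last k)) a c} :=
  isDiagram_of_small_of_continuous
    (D := fun a c t => IsDegenerateI (polyI k t) (t (Fin.last k)) a c)
    (fun U hU => eventually_isDegenerateI_mem hk hU)
    (fun u t h => exists_isDegenerateI_of_isSingularZero h) (pt := fun x => ![x.1, x.2])
    (fun i => by fin_cases i <;> simp <;> fun_prop) (fun i => by fin_cases i <;> simp)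
    fun a c t h => isSingularZero_oddI h

section

variable {m : ℕ} {p q : (Fin m → ℂ) → ℂ[X]}

theorem isDiagram_matrixII
    (hsmall : ∀ U ∈ 𝓝 (0 : ℂ × ℂ), ∀ᶠ t in 𝓝 0, ∀ c s, IsDegenerateII (p t) (q t) c s →
      (c, s) ∈ U) :
    IsDiagram (fun (u : Fin 4 → ℂ) t => NotTransversalAt (matrixII (p t) (q t)) u)
      {t | ∃ c s, IsDegenerateII (p t) (q t) c s} :=
  isDiagram_of_small_of_continuous (D := fun c s t => IsDegenerateII (p t) (q t) c s) hsmall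
    (fun u t h => exists_isDegenerateII_of_notTransversalAt h)
    (pt := fun x => ![4 * x.2 ^ 4 * x.1 ^ 2, x.2 ^ 2 * x.1 ^ 2, -x.2 * x.1 ^ 2, x.1 ^ 2])
    (fun i => by fin_cases i <;> simp <;> fun_prop) (fun i => by fin_cases i <;> simp)
    fun c s t h => notTransversalAt_matrixII h

theorem isDiagram_oddII
    (hsmall : ∀ U ∈ 𝓝 (0 : ℂ × ℂ), ∀ᶠ t in 𝓝 0, ∀ c s, IsDegenerateII (p t) (q t) c s →
      (c, s) ∈ U) :
    IsDiagram (fun (x : Fin 2 → ℂ) t => IsSingularZero (oddII (p t) (q t)) x)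
      {t | ∃ c s, IsDegenerateII (p t) (q t) c s} :=
  isDiagram_of_small_of_continuous (D := fun c s t => IsDegenerateII (p t) (q t) c s) hsmall
    (fun u t h => exists_isDegenerateII_of_isSingularZero h)
    (pt := fun x => ![x.2 * x.1, x.1])
    (fun i => by fin_cases i <;> simp <;> fun_prop) (fun i => by fin_cases i <;> simp)
    fun c s t h => isSingularZero_oddII h

theorem isDiagram_curveII
    (hsmall : ∀ U ∈ 𝓝 (0 : ℂ × ℂ), ∀ᶠ t in 𝓝 0, ∀ c s, IsDegenerateII (p t) (q t) c s →
      (c, s) ∈ U) :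
    IsDiagram (fun (x : Fin 3 → ℂ) t => IsSingularPoint (curveII (p t) (q t)) x)
      {t | ∃ c s, IsDegenerateII (p t) (q t) c s} :=
  isDiagram_of_small_of_continuous (D := fun c s t => IsDegenerateII (p t) (q t) c s) hsmall
    (fun u t h => exists_isDegenerateII_of_isSingularPoint h)
    (pt := fun x => ![-2 * x.2 ^ 2 * x.1, -x.2 * x.1, x.1])
    (fun i => by fin_cases i <;> simp <;> fun_prop) (fun i => by fin_cases i <;> simp)
    fun c s t h => isSingularPoint_curveII h

/-- Degenerate points stay small when `27 w p² + 4 q³` is a polynomial in `w` with constant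
leading coefficient that tends to a monomial. -/
theorem isDegenerateII_small {n : ℕ} {κ : ℂ} (hκ : κ ≠ 0) (c : (Fin m → ℂ) → Fin n → ℂ)
    (hc : ∀ i, Continuous fun t => c t i) (hc0 : ∀ i, c 0 i = 0)
    (h : ∀ t w, 27 * w * (p t).eval w ^ 2 + 4 * (q t).eval w ^ 3 =
      κ * (w ^ n + ∑ i, c t i * w ^ (i : ℕ)))
    (hp : Continuous fun z : ℂ × (Fin m → ℂ) => (p z.2).derivative.eval z.1)
    (hp0 : (p 0).derivative.eval 0 = 0)
    (hq : Continuous fun z : ℂ × (Fin m → ℂ) => (q z.2).derivative.eval z.1)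
    (hq0 : (q 0).derivative.eval 0 = 0) :
    ∀ U ∈ 𝓝 (0 : ℂ × ℂ), ∀ᶠ t in 𝓝 0, ∀ c s, IsDegenerateII (p t) (q t) c s → (c, s) ∈ U := by
  refine fun U hU => eventually_isDegenerateII_mem (fun U hU => ?_) (hp.tendsto' 0 0 hp0)
    (hq.tendsto' 0 0 hq0) hU
  filter_upwards [eventually_comp_of_map_zero (continuous_pi hc).continuousAt (funext hc0)
    (eventually_root_mem n hU)] with t ht w hw
  refine ht w ?_
  rw [h] at hw
  exact (mul_eq_zero.1 hw).resolve_left hκ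

end

/-- The listed numbers are the lower coefficients of `27 w p² + 4 q³` divided by its leading
coefficient. The leading term comes from `27 w p²` in `II4` and `II6`, and from `4 q³` in `II5`. -/
theorem isDegenerateII4_small : ∀ U ∈ 𝓝 (0 : ℂ × ℂ), ∀ᶠ t : Fin 4 → ℂ in 𝓝 0, ∀ c s,
    IsDegenerateII (X ^ 2 + C (t 1) * X + C (t 0)) (C (t 3) * X + C (t 2)) c s → (c, s) ∈ U := by
  refine isDegenerateII_small (κ := 27) (by norm_num) (n := 5) (fun t =>
    ![4 / 27 * t 2 ^ 3, t 0 ^ 2 + 12 / 27 * t 3 * t 2 ^ 2, 2 * t 0 * t 1 + 12 / 27 * t 3 ^ 2 * t 2,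
      t 1 ^ 2 + 2 * t 0 + 4 / 27 * t 3 ^ 3, 2 * t 1])
    (fun i => by fin_cases i <;> simp <;> fun_prop) (fun i => by fin_cases i <;> simp) ?_
    (by simp; fun_prop) (by simp) (by simp; fun_prop) (by simp)
  intro t w
  simp [Fin.sum_univ_five]
  ring

theorem isDegenerateII5_small : ∀ U ∈ 𝓝 (0 : ℂ × ℂ), ∀ᶠ t : Fin 5 → ℂ in 𝓝 0, ∀ c s,
    IsDegenerateII (C (t 2) * X ^ 2 + C (t 1) * X + C (t 0)) (X ^ 2 + C (t 4) * X + C (t 3)) c s →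
      (c, s) ∈ U := by
  refine isDegenerateII_small (κ := 4) (by norm_num) (n := 6) (fun t =>
    ![t 3 ^ 3, 27 / 4 * t 0 ^ 2 + 3 * t 3 ^ 2 * t 4,
      27 / 2 * t 0 * t 1 + 3 * t 3 ^ 2 + 3 * t 3 * t 4 ^ 2,
      27 / 4 * (t 1 ^ 2 + 2 * t 0 * t 2) + 6 * t 3 * t 4 + t 4 ^ 3,
      27 / 2 * t 1 * t 2 + 3 * t 3 + 3 * t 4 ^ 2, 27 / 4 * t 2 ^ 2 + 3 * t 4])
    (fun i => by fin_cases i <;> simp <;> fun_prop) (fun i => by fin_cases i <;> simp) ?_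
    (by simp; fun_prop) (by simp) (by simp; fun_prop) (by simp)
  intro t w
  simp [Fin.sum_univ_six]
  ring

theorem isDegenerateII6_small : ∀ U ∈ 𝓝 (0 : ℂ × ℂ), ∀ᶠ t : Fin 6 → ℂ in 𝓝 0, ∀ c s,
    IsDegenerateII (X ^ 3 + C (t 2) * X ^ 2 + C (t 1) * X + C (t 0))
      (C (t 5) * X ^ 2 + C (t 4) * X + C (t 3)) c s → (c, s) ∈ U := by
  refine isDegenerateII_small (κ := 27) (by norm_num) (n := 7) (fun t =>
    ![4 / 27 * t 3 ^ 3, t 0 ^ 2 + 12 / 27 * t 3 ^ 2 * t 4,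
      2 * t 0 * t 1 + 4 / 27 * (3 * t 3 ^ 2 * t 5 + 3 * t 3 * t 4 ^ 2),
      t 1 ^ 2 + 2 * t 0 * t 2 + 4 / 27 * (6 * t 3 * t 4 * t 5 + t 4 ^ 3),
      2 * t 0 + 2 * t 1 * t 2 + 4 / 27 * (3 * t 3 * t 5 ^ 2 + 3 * t 4 ^ 2 * t 5),
      2 * t 1 + t 2 ^ 2 + 4 / 27 * (3 * t 4 * t 5 ^ 2),
      2 * t 2 + 4 / 27 * t 5 ^ 3])
    (fun i => by fin_cases i <;> simp <;> fun_prop) (fun i => by fin_cases i <;> simp) ?_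
    (by simp; fun_prop) (by simp) (by simp; fun_prop) (by simp)
  intro t w
  simp [Fin.sum_univ_seven]
  ring

theorem IsDiagram.comp_equiv {s m : ℕ} {bad bad' : (Fin s → ℂ) → (Fin m → ℂ) → Prop}
    {S : Set (Fin m → ℂ)} (h : IsDiagram bad S) (e : (Fin m → ℂ) ≃L[ℂ] (Fin m → ℂ))
    (L : (Fin s → ℂ) ≃L[ℂ] (Fin s → ℂ)) (hbad : ∀ u t, bad' u t ↔ bad (L u) (e t)) :
    IsDiagram bad' {t | e t ∈ S} := by
  obtain ⟨h1, U₀, hU₀, h2⟩ := h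
  constructor
  · ext t
    rw [← h1]
    constructor
    · rintro ⟨u, hu⟩
      exact ⟨L u, (hbad u t).1 hu⟩
    · rintro ⟨u, hu⟩
      exact ⟨L.symm u, (hbad _ t).2 (by rwa [L.apply_symm_apply])⟩
  · refine ⟨L ⁻¹' U₀, (L.continuous.tendsto' 0 0 L.map_zero) hU₀, fun U hU hUU => ?_⟩
    have hU' : L.symm ⁻¹' U ∈ 𝓝 0 := (L.symm.continuous.tendsto' 0 0 L.symm.map_zero) hU
    have hsub : L.symm ⁻¹' U ⊆ U₀ := fun x hx => by
      have := hUU hx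
      rwa [Set.mem_preimage, L.apply_symm_apply] at this
    filter_upwards [(e.continuous.tendsto' 0 0 e.map_zero).eventually (h2 _ hU' hsub)] with t ht
    refine ht.trans ?_
    constructor
    · rintro ⟨u, hu, hb⟩
      exact ⟨L.symm u, hu, (hbad _ t).2 (by rwa [L.apply_symm_apply])⟩
    · rintro ⟨u, hu, hb⟩
      exact ⟨L u, by simpa using hu, (hbad u t).1 hb⟩

theorem isSingularZero_comp_equiv_iff {p : ℕ} {f g : (Fin p → ℂ) → ℂ}
    (L : (Fin p → ℂ) ≃L[ℂ] (Fin p → ℂ)) (hf : Differentiable ℂ f) (hg : ∀ x, g x = f (L x))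
    (x : Fin p → ℂ) : IsSingularZero g x ↔ IsSingularZero f (L x) :=
  isSingularZero_comp_iff (hf _) L.differentiableAt (by
    rw [L.fderiv]
    exact L.surjective) (.of_forall hg)

/-! ### The rows as members of the polynomial families -/

section

variable {k : ℕ} (hk : 1 ≤ k) (t : Fin (k + 1) → ℂ)

theorem matrixDef_I_eq : (fun y => TableRow.matrixDef (.I k hk) y t) =
    matrixI (polyI k t) (t (Fin.last k)) := by
  funext y
  simp only [TableRow.matrixDef, matrixI, eval_polyI, add_assoc]

theorem oddDef_I_eq : (fun y => TableRow.oddDef (.I k hk) y t) =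
    oddI (polyI k t) (t (Fin.last k)) := by
  funext y
  simp only [TableRow.oddDef, oddI, eval_polyI, mul_add, Finset.mul_sum, ← pow_mul, ← add_assoc]
  congr 2
  · ring
  · exact Finset.sum_congr rfl fun i _ => by ring

theorem curveDef_I_eq : (fun y => TableRow.curveDef (.I k hk) y t) =
    curveI (polyI k t) (t (Fin.last k)) := by
  funext y
  simp only [TableRow.curveDef, curveI, eval_polyI, ← pow_mul, add_assoc]

end

theorem matrixDef_II4_eq (t : Fin 4 → ℂ) : (fun y => TableRow.matrixDef .II4 y t) =
    matrixII (X ^ 2 + C (t 1) * X + C (t 0)) (C (t 3) * X + C (t 2)) := by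
  funext y
  simp [TableRow.matrixDef, matrixII, add_assoc]

theorem oddDef_II4_eq (t : Fin 4 → ℂ) : (fun y => TableRow.oddDef .II4 y t) =
    oddII (X ^ 2 + C (t 1) * X + C (t 0)) (C (t 3) * X + C (t 2)) := by
  funext y
  simp [TableRow.oddDef, oddII]
  ring

theorem curveDef_II4_eq (t : Fin 4 → ℂ) : (fun y => TableRow.curveDef .II4 y t) =
    curveII (X ^ 2 + C (t 1) * X + C (t 0)) (C (t 3) * X + C (t 2)) := by
  funext y
  simp [TableRow.curveDef, curveII]
  constructor <;> ring

theorem matrixDef_II5_eq (t : Fin 5 → ℂ) : (fun y => TableRow.matrixDef .II5 y t) =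
    matrixII (C (t 2) * X ^ 2 + C (t 1) * X + C (t 0)) (X ^ 2 + C (t 4) * X + C (t 3)) := by
  funext y
  simp [TableRow.matrixDef, matrixII, add_assoc]

theorem curveDef_II5_eq (t : Fin 5 → ℂ) : (fun y => TableRow.curveDef .II5 y t) =
    curveII (C (t 2) * X ^ 2 + C (t 1) * X + C (t 0)) (X ^ 2 + C (t 4) * X + C (t 3)) := by
  funext y
  simp [TableRow.curveDef, curveII]
  constructor <;> ring

theorem matrixDef_II6_eq (t : Fin 6 → ℂ) : (fun y => TableRow.matrixDef .II6 y t) =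
    matrixII (X ^ 3 + C (t 2) * X ^ 2 + C (t 1) * X + C (t 0))
      (C (t 5) * X ^ 2 + C (t 4) * X + C (t 3)) := by
  funext y
  simp [TableRow.matrixDef, matrixII, add_assoc]

theorem oddDef_II6_eq (t : Fin 6 → ℂ) : (fun y => TableRow.oddDef .II6 y t) =
    oddII (X ^ 3 + C (t 2) * X ^ 2 + C (t 1) * X + C (t 0))
      (C (t 5) * X ^ 2 + C (t 4) * X + C (t 3)) := by
  funext y
  simp [TableRow.oddDef, oddII]
  ring

theorem curveDef_II6_eq (t : Fin 6 → ℂ) : (fun y => TableRow.curveDef .II6 y t) =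
    curveII (X ^ 3 + C (t 2) * X ^ 2 + C (t 1) * X + C (t 0))
      (C (t 5) * X ^ 2 + C (t 4) * X + C (t 3)) := by
  funext y
  simp [TableRow.curveDef, curveII]
  constructor <;> ring

/-- Replacing the second coordinate `c` by `ζ c` with `ζ⁴ = -1` changes `-b c⁴` into `b c⁴`, the
sign required by `q = w² + …`; each parameter absorbs the power of `ζ` from its own monomial. -/
theorem oddDef_II5_eq {ζ : ℂˣ} (hζ : (ζ : ℂ) ^ 4 = -1) (t : Fin 5 → ℂ) (y : Fin 2 → ℂ) :
    TableRow.oddDef .II5 y t =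
      oddII (C (diagScale ![ζ, ζ ^ 3, ζ ^ 5, 1, ζ ^ 2] t 2) * X ^ 2 +
        C (diagScale ![ζ, ζ ^ 3, ζ ^ 5, 1, ζ ^ 2] t 1) * X +
        C (diagScale ![ζ, ζ ^ 3, ζ ^ 5, 1, ζ ^ 2] t 0))
      (X ^ 2 + C (diagScale ![ζ, ζ ^ 3, ζ ^ 5, 1, ζ ^ 2] t 4) * X +
        C (diagScale ![ζ, ζ ^ 3, ζ ^ 5, 1, ζ ^ 2] t 3)) (diagScale ![1, ζ⁻¹] y) := by
  obtain ⟨c, hc⟩ : ∃ c, y 1 = ζ * c := ⟨y 1 * (ζ : ℂ)⁻¹, by field_simp⟩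
  have hc' : y 1 * (ζ : ℂ)⁻¹ = c := by rw [hc]; field_simp
  simp [TableRow.oddDef, oddII, hc']
  rw [hc]
  linear_combination -y 0 * c ^ 4 * hζ

theorem TableRow.exists_diagrams (r : TableRow) :
    ∃ (S : Set (Fin r.tau → ℂ)) (e : (Fin r.tau → ℂ) ≃L[ℂ] (Fin r.tau → ℂ)),
      IsDiagram (fun u t => NotTransversalAt (fun y => r.matrixDef y t) u) S ∧
      IsDiagram (fun x t => IsSingularZero (fun y => r.oddDef y t) x) {t | e t ∈ S} ∧
      IsDiagram (fun x t => IsSingularPoint (fun y => r.curveDef y t) x) S := by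
  cases r with
  | I k hk =>
    -- Halving the last parameter compensates for the factor `2` in the singularity condition of the
    -- odd function.
    let e : (Fin (k + 1) → ℂ) ≃L[ℂ] (Fin (k + 1) → ℂ) :=
      diagScale (Function.update 1 (Fin.last k) (Units.mk0 (1 / 2) (by norm_num)))
    have h1 := isDiagram_matrixI hk
    have h2 := isDiagram_curveI hk
    simp only [← matrixDef_I_eq hk] at h1
    simp only [← curveDef_I_eq hk] at h2
    have he : ∀ t, polyI k (e t) = polyI k t := fun t => by
      simp [polyI, e, Fin.castSucc_ne_last]
    exact ⟨_, e, h1, (isDiagram_oddI hk).comp_equiv e (.refl ℂ _) fun u t => by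
      change IsSingularZero (fun y => TableRow.oddDef (.I k hk) y t) u ↔ IsSingularZero _ u
      rw [oddDef_I_eq hk, he, show 2 * e t (Fin.last k) = t (Fin.last k) by simp [e]; ring], h2⟩
  | II4 =>
    have h1 := isDiagram_matrixII isDegenerateII4_small
    have h2 := isDiagram_curveII isDegenerateII4_small
    have h3 := isDiagram_oddII isDegenerateII4_small
    simp only [← matrixDef_II4_eq] at h1
    simp only [← curveDef_II4_eq] at h2
    simp only [← oddDef_II4_eq] at h3
    exact ⟨_, .refl ℂ _, h1, h3, h2⟩
  | II5 =>
    obtain ⟨ζ, hζ⟩ := IsAlgClosed.exists_pow_nat_eq (-1 : ℂ) (n := 4) (by norm_num)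
    have hζ0 : ζ ≠ 0 := by
      rintro rfl
      norm_num at hζ
    have h1 := isDiagram_matrixII isDegenerateII5_small
    have h2 := isDiagram_curveII isDegenerateII5_small
    simp only [← matrixDef_II5_eq] at h1
    simp only [← curveDef_II5_eq] at h2
    refine ⟨_, _, h1, (isDiagram_oddII isDegenerateII5_small).comp_equiv _ _ fun u t =>
      isSingularZero_comp_equiv_iff _ ?_ (oddDef_II5_eq (ζ := Units.mk0 ζ hζ0) hζ t) u, h2⟩
    intro x
    unfold oddII
    fun_prop
  | II6 =>
    have h1 := isDiagram_matrixII isDegenerateII6_small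
    have h2 := isDiagram_curveII isDegenerateII6_small
    have h3 := isDiagram_oddII isDegenerateII6_small
    simp only [← matrixDef_II6_eq] at h1
    simp only [← curveDef_II6_eq] at h2
    simp only [← oddDef_II6_eq] at h3
    exact ⟨_, .refl ℂ _, h1, h3, h2⟩

end

noncomputable section

/-! ## The listed deformations -/

theorem analyticAt_of_contDiff_top {E W : Type*} [NormedAddCommGroup E] [NormedSpace ℂ E]
    [NormedAddCommGroup W] [NormedSpace ℂ W] {f : E → W} (h : ContDiff ℂ ⊤ f) (x : E) :
    AnalyticAt ℂ f x :=
  h.contDiffAt.analyticAt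

theorem isSymmDeformation_matrixDef (r : TableRow) : IsSymmDeformation r.matrix r.matrixDef := by
  refine ⟨fun i j => analyticAt_of_contDiff_top ?_ 0, .of_forall fun p => ?_,
    .of_forall r.matrixDef_zero⟩
  · cases r with
    | I k hk =>
      change ContDiff ℂ ⊤ fun p : (Fin 4 → ℂ) × (Fin (k + 1) → ℂ) =>
        TableRow.matrixDef (.I k hk) p.1 p.2 i j
      fin_cases i <;> fin_cases j <;> simp [TableRow.matrixDef] <;> fun_prop
    | II4 =>
      change ContDiff ℂ ⊤ fun p : (Fin 4 → ℂ) × (Fin 4 → ℂ) => TableRow.matrixDef .II4 p.1 p.2 i j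
      fin_cases i <;> fin_cases j <;> simp [TableRow.matrixDef] <;> fun_prop
    | II5 =>
      change ContDiff ℂ ⊤ fun p : (Fin 4 → ℂ) × (Fin 5 → ℂ) => TableRow.matrixDef .II5 p.1 p.2 i j
      fin_cases i <;> fin_cases j <;> simp [TableRow.matrixDef] <;> fun_prop
    | II6 =>
      change ContDiff ℂ ⊤ fun p : (Fin 4 → ℂ) × (Fin 6 → ℂ) => TableRow.matrixDef .II6 p.1 p.2 i j
      fin_cases i <;> fin_cases j <;> simp [TableRow.matrixDef] <;> fun_prop
  · ext i j
    cases r <;> fin_cases i <;> fin_cases j <;> rfl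

theorem isOddDeformation_oddDef (r : TableRow) : IsOddDeformation r.oddFun r.oddDef := by
  refine ⟨analyticAt_of_contDiff_top ?_ 0, .of_forall fun p => ?_, .of_forall r.oddDef_zero⟩
  · cases r with
    | I k hk =>
      change ContDiff ℂ ⊤ fun p : (Fin 2 → ℂ) × (Fin (k + 1) → ℂ) =>
        TableRow.oddDef (.I k hk) p.1 p.2
      simp only [TableRow.oddDef]
      fun_prop
    | II4 =>
      change ContDiff ℂ ⊤ fun p : (Fin 2 → ℂ) × (Fin 4 → ℂ) => TableRow.oddDef .II4 p.1 p.2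
      simp only [TableRow.oddDef]
      fun_prop
    | II5 =>
      change ContDiff ℂ ⊤ fun p : (Fin 2 → ℂ) × (Fin 5 → ℂ) => TableRow.oddDef .II5 p.1 p.2
      simp only [TableRow.oddDef]
      fun_prop
    | II6 =>
      change ContDiff ℂ ⊤ fun p : (Fin 2 → ℂ) × (Fin 6 → ℂ) => TableRow.oddDef .II6 p.1 p.2
      simp only [TableRow.oddDef]
      fun_prop
  · cases r with
    | I k hk =>
      simp only [TableRow.oddDef, Pi.neg_apply, (odd_two_mul_add_one _).neg_pow, mul_neg,
        Finset.sum_neg_distrib]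
      ring
    | II4 => simp only [TableRow.oddDef, Pi.neg_apply]; ring
    | II5 => simp only [TableRow.oddDef, Pi.neg_apply]; ring
    | II6 => simp only [TableRow.oddDef, Pi.neg_apply]; ring

theorem isEvenDeformation_curveDef (r : TableRow) : IsEvenDeformation r.curve r.curveDef := by
  refine ⟨analyticAt_of_contDiff_top (contDiff_pi.2 fun i => ?_) 0, .of_forall fun p => ?_,
    .of_forall r.curveDef_zero⟩
  · cases r with
    | I k hk =>
      change ContDiff ℂ ⊤ fun p : (Fin 3 → ℂ) × (Fin (k + 1) → ℂ) =>
        TableRow.curveDef (.I k hk) p.1 p.2 i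
      fin_cases i <;> simp [TableRow.curveDef] <;> fun_prop
    | II4 =>
      change ContDiff ℂ ⊤ fun p : (Fin 3 → ℂ) × (Fin 4 → ℂ) => TableRow.curveDef .II4 p.1 p.2 i
      fin_cases i <;> simp [TableRow.curveDef] <;> fun_prop
    | II5 =>
      change ContDiff ℂ ⊤ fun p : (Fin 3 → ℂ) × (Fin 5 → ℂ) => TableRow.curveDef .II5 p.1 p.2 i
      fin_cases i <;> simp [TableRow.curveDef] <;> fun_prop
    | II6 =>
      change ContDiff ℂ ⊤ fun p : (Fin 3 → ℂ) × (Fin 6 → ℂ) => TableRow.curveDef .II6 p.1 p.2 i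
      fin_cases i <;> simp [TableRow.curveDef] <;> fun_prop
  · cases r with
    | I k hk => simp [TableRow.curveDef, pow_mul]
    | II4 => simp [TableRow.curveDef, (show Even 4 by decide).neg_pow]
    | II5 => simp [TableRow.curveDef, (show Even 4 by decide).neg_pow]
    | II6 => simp [TableRow.curveDef, (show Even 4 by decide).neg_pow,
        (show Even 6 by decide).neg_pow]

/-! ## Diagrams of versal deformations -/

theorem eventually_eventually_slice {E T : Type*} [NormedAddCommGroup E] [NormedAddCommGroup T]
    {P : E × T → Prop} (hP : ∀ᶠ p in 𝓝 0, P p) :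
    ∀ᶠ p : E × T in 𝓝 0, ∀ᶠ u in 𝓝 p.1, P (u, p.2) := by
  filter_upwards [hP.eventually_nhds] with p hp
  exact (Continuous.tendsto' (by fun_prop) _ _ rfl : Tendsto (fun u : E => (u, p.2)) (𝓝 p.1)
    (𝓝 p)).eventually hp

theorem differentiableAt_slice {E T W : Type*} [NormedAddCommGroup E] [NormedAddCommGroup T]
    [NormedAddCommGroup W] [NormedSpace ℂ E] [NormedSpace ℂ T] [NormedSpace ℂ W]
    {f : E → T → W} {p : E × T}
    (h : AnalyticAt ℂ (fun q : E × T => f q.1 q.2) p) :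
    DifferentiableAt ℂ (fun u => f u p.2) p.1 :=
  DifferentiableAt.comp (g := fun q : E × T => f q.1 q.2) (f := fun u => (u, p.2)) p.1
    h.differentiableAt (by fun_prop)

theorem eventually_change {s m l : ℕ} {Φ : (Fin s → ℂ) → (Fin l → ℂ) → (Fin s → ℂ)}
    {ψ : (Fin l → ℂ) → (Fin m → ℂ)} (hΦ : IsCoordinateChange Φ) (hψ : IsBaseChange ψ)
    {P : (Fin s → ℂ) × (Fin m → ℂ) → Prop} (hP : ∀ᶠ p in 𝓝 0, P p) :
    ∀ᶠ p : (Fin s → ℂ) × (Fin l → ℂ) in 𝓝 0, P (Φ p.1 p.2, ψ p.2) := by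
  have hψ2 : AnalyticAt ℂ (fun p : (Fin s → ℂ) × (Fin l → ℂ) => ψ p.2) 0 :=
    AnalyticAt.comp (g := ψ) (f := Prod.snd) hψ.1 analyticAt_snd
  have hΦ0 : Φ 0 0 = 0 := hΦ.2.self_of_nhds
  exact eventually_comp_of_map_zero (hΦ.1.prod hψ2).continuousAt (by simp [hΦ0, hψ.2]) hP

theorem IsMatrixChange.eventually_isUnit_det {s l n : ℕ}
    {A : (Fin s → ℂ) → (Fin l → ℂ) → Matrix (Fin n) (Fin n) ℂ} (hA : IsMatrixChange A) :
    ∀ᶠ p in 𝓝 (0 : (Fin s → ℂ) × (Fin l → ℂ)), IsUnit (A p.1 p.2).det := by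
  have hc : ContinuousAt (fun p : (Fin s → ℂ) × (Fin l → ℂ) => A p.1 p.2) 0 :=
    continuousAt_pi.2 fun i => continuousAt_pi.2 fun j => (hA.1 i j).continuousAt
  have hd : ContinuousAt (fun p : (Fin s → ℂ) × (Fin l → ℂ) => (A p.1 p.2).det) 0 :=
    ContinuousAt.comp (g := Matrix.det) (Continuous.continuousAt (continuous_id.matrix_det)) hc
  have h0 : A 0 0 = 1 := hA.2.self_of_nhds
  filter_upwards [hd.eventually_ne (y := 0) (by simp [h0])] with p hp
  exact hp.isUnit

theorem IsMatrixChange.eventually_differentiableAt {s l n : ℕ}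
    {A : (Fin s → ℂ) → (Fin l → ℂ) → Matrix (Fin n) (Fin n) ℂ} (hA : IsMatrixChange A) :
    ∀ᶠ p in 𝓝 (0 : (Fin s → ℂ) × (Fin l → ℂ)), ∀ i j,
      DifferentiableAt ℂ (fun u => A u p.2 i j) p.1 := by
  simp only [eventually_all]
  intro i j
  filter_upwards [(hA.1 i j).eventually_analyticAt] with p hp
  exact differentiableAt_slice (f := fun u t => A u t i j) hp

/-- The listed deformation is induced from `F`, not conversely. Both bases have dimension `τ`, so
independence of the listed directions makes the map of bases locally invertible, and invariance of
transversality under congruence transports the diagram. -/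
theorem TableRow.exists_representsDiagram_of_isSLVersal (r : TableRow)
    {F : (Fin 4 → ℂ) → (Fin r.tau → ℂ) → Matrix (Fin 3) (Fin 3) ℂ} (hF : IsSLVersal r.matrix F)
    {S : Set (Fin r.tau → ℂ)}
    (hS : RepresentsDiagram (fun u t => NotTransversalAt (fun y => r.matrixDef y t) u) S) :
    ∃ S', RepresentsDiagram (fun u t => NotTransversalAt (fun y => F y t) u) S' ∧
      GermBiholomorphic S S' := by
  obtain ⟨ψ, Φ, A, hψ, hΦ, hA, -, hG⟩ := hF.2 _ _ (isSymmDeformation_matrixDef r)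
  refine exists_representsDiagram_of_change hS hΦ hψ
    (fun v hv => r.matrixDef_independent (exists_tangent_of_SLInduced hF.1 hΦ hψ hA hG hv)) ?_
  have hFd : ∀ᶠ q in 𝓝 (0 : (Fin 4 → ℂ) × (Fin r.tau → ℂ)), ∀ i j,
      AnalyticAt ℂ (fun p : (Fin 4 → ℂ) × (Fin r.tau → ℂ) => F p.1 p.2 i j) q := by
    simp only [eventually_all]
    exact fun i j => (hF.1.1 i j).eventually_analyticAt
  filter_upwards [eventually_change hΦ hψ hFd,
    eventually_change hΦ hψ (eventually_eventually_slice hF.1.2.1), hΦ.eventually_surjective,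
    hA.eventually_differentiableAt, hA.eventually_isUnit_det, eventually_eventually_slice hG]
    with p h1 h2 h3 h4 h5 h6
  exact notTransversalAt_congruence_iff (f := fun y => F y (ψ p.2)) (Φ := fun u => Φ u p.2)
    (A := fun u => A u p.2)
    (fun i j => differentiableAt_slice (f := fun u t => F u t i j) (h1 i j)) h2 h3.1 h3.2 h4 h5 h6

theorem TableRow.exists_representsDiagram_of_isROddVersal (r : TableRow)
    {F : (Fin 2 → ℂ) → (Fin r.tau → ℂ) → ℂ} (hF : IsROddVersal r.oddFun F)
    {S : Set (Fin r.tau → ℂ)}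
    (hS : RepresentsDiagram (fun x t => IsSingularZero (fun y => r.oddDef y t) x) S) :
    ∃ S', RepresentsDiagram (fun x t => IsSingularZero (fun y => F y t) x) S' ∧
      GermBiholomorphic S S' := by
  obtain ⟨ψ, Φ, hψ, ⟨hΦ, -⟩, hG⟩ := hF.2 _ _ (isOddDeformation_oddDef r)
  refine exists_representsDiagram_of_change hS hΦ hψ
    (fun v hv => r.oddDef_independent (exists_tangent_of_ROddInduced hF.1 hΦ hψ hG hv)) ?_
  filter_upwards [eventually_change hΦ hψ hF.1.1.eventually_analyticAt, hΦ.eventually_surjective,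
    eventually_eventually_slice hG] with p h1 h3 h6
  exact isSingularZero_comp_iff (f := fun y => F y (ψ p.2)) (Φ := fun u => Φ u p.2)
    (differentiableAt_slice (f := F) h1) h3.1 h3.2 h6

theorem TableRow.exists_representsDiagram_of_isKOddVersal (r : TableRow)
    {F : (Fin 3 → ℂ) → (Fin r.tau → ℂ) → (Fin 2 → ℂ)} (hF : IsKOddVersal r.curve F)
    {S : Set (Fin r.tau → ℂ)}
    (hS : RepresentsDiagram (fun x t => IsSingularPoint (fun y => r.curveDef y t) x) S) :
    ∃ S', RepresentsDiagram (fun x t => IsSingularPoint (fun y => F y t) x) S' ∧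
      GermBiholomorphic S S' := by
  obtain ⟨ψ, Φ, B, hψ, ⟨hΦ, -⟩, hB, hG⟩ := hF.2 _ _ (isEvenDeformation_curveDef r)
  refine exists_representsDiagram_of_change hS hΦ hψ
    (fun v hv => r.curveDef_independent (exists_tangent_of_KOddInduced hF.1 hΦ hψ hB hG hv)) ?_
  filter_upwards [eventually_change hΦ hψ hF.1.1.eventually_analyticAt, hΦ.eventually_surjective,
    hB.eventually_differentiableAt, hB.eventually_isUnit_det, eventually_eventually_slice hG]
    with p h1 h3 h4 h5 h6
  exact isSingularPoint_mulVec_comp_iff (f := fun y => F y (ψ p.2)) (Φ := fun u => Φ u p.2)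
    (B := fun u => B u p.2) (differentiableAt_slice (f := F) h1) h3.1 h3.2 h4 h5 h6

end

end CorankThree

theorem proposition6p6 (r : CorankThree.TableRow) :
    -- the whole spaces, for the listed quasi-homogeneous deformations
    (CorankThree.Biholomorphic
        (CorankThree.bifurcationSet
          (fun u t => CorankThree.NotTransversalAt (fun y => r.matrixDef y t) u))
        (CorankThree.bifurcationSet
          (fun x t => CorankThree.IsSingularZero (fun y => r.oddDef y t) x)) ∧
      CorankThree.Biholomorphic
        (CorankThree.bifurcationSet
          (fun x t => CorankThree.IsSingularZero (fun y => r.oddDef y t) x))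
        (CorankThree.bifurcationSet
          (fun x t => CorankThree.IsSingularPoint (fun y => r.curveDef y t) x))) ∧
    -- the germs at the origin, for arbitrary miniversal deformations
    ∀ (F : (Fin 4 → ℂ) → (Fin r.tau → ℂ) → Matrix (Fin 3) (Fin 3) ℂ)
      (G : (Fin 2 → ℂ) → (Fin r.tau → ℂ) → ℂ)
      (H : (Fin 3 → ℂ) → (Fin r.tau → ℂ) → (Fin 2 → ℂ)),
      CorankThree.IsSLMiniversal r.matrix F →
      CorankThree.IsROddMiniversal r.oddFun G →
      CorankThree.IsKOddMiniversal r.curve H →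
      ∃ S S' S'' : Set (Fin r.tau → ℂ),
        CorankThree.RepresentsDiagram
          (fun u t => CorankThree.NotTransversalAt (fun y => F y t) u) S ∧
        CorankThree.RepresentsDiagram
          (fun x t => CorankThree.IsSingularZero (fun y => G y t) x) S' ∧
        CorankThree.RepresentsDiagram
          (fun x t => CorankThree.IsSingularPoint (fun y => H y t) x) S'' ∧
        CorankThree.GermBiholomorphic S S' ∧
        CorankThree.GermBiholomorphic S' S'' := by
  obtain ⟨S, e, hS, hS', hS''⟩ := r.exists_diagrams
  rw [hS.1, hS'.1, hS''.1]
  -- The diagram of the odd functions is the preimage of `S` under `e`, and the other two are `S`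
  -- itself.
  refine ⟨⟨CorankThree.Biholomorphic.of_linear e.symm fun t => by simp,
    CorankThree.Biholomorphic.of_linear e fun t => Iff.rfl⟩, fun F G H hF hG hH => ?_⟩
  obtain ⟨D, hD, hSD⟩ := r.exists_representsDiagram_of_isSLVersal hF.1 hS.2
  obtain ⟨D', hD', hSD'⟩ := r.exists_representsDiagram_of_isROddVersal hG.1 hS'.2
  obtain ⟨D'', hD'', hSD''⟩ := r.exists_representsDiagram_of_isKOddVersal hH.1 hS''.2
  exact ⟨D, D', D'', hD, hD', hD'',
    hSD.symm.trans ((CorankThree.GermBiholomorphic.of_linear e.symm fun t => by simp).trans hSD'),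
    hSD'.symm.trans ((CorankThree.GermBiholomorphic.of_linear e fun t => Iff.rfl).trans hSD'')⟩
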